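/- Let $\mathcal C$ be a braided monoidal category with braiding $c$; associativity and unit isomorphisms are suppressed, $\otimes$ is written as juxtaposition, and $g.f$ denotes the composite of $f$ followed by $g$. Let $\mathcal Q$ be a class of regular epimorphisms in $\mathcal C$ that contains the isomorphisms, is closed under composition and monoidal product, is right-cancellative (if $s$ and $t.s$ are in $\mathcal Q$, then so is $t$), and such that each $q\in\mathcal Q$ is the coequalizer of some pair of morphisms which is preserved by taking the monoidal product with any fixed object. **Semigroups.** A semigroup $(A,m)$ in $\mathcal C$ is an object with an associative $m\colon A^2\to A$; it is non-degenerate if for all objects $X,Y$ the maps $\mathcal C(X,AY)\to\mathcal C(AX,AY)$, $f\mapsto m1.1f$, and $\mathcal C(X,YA)\to\mathcal C(XA,YA)$, $g\mapsto 1m.g1$, are injective. Let $\mathcal M$ be the monoidal category whose objects are the non-degenerate semigroups with multiplication in $\mathcal Q$, and whose morphisms $A\nrightarrow B$ are the pairs $(f_1\colon AB\to B,\ f_2\colon BA\to B)$ of morphisms in $\mathcal Q$ with $f_1.m1=f_1.1f_1$ and $m.1f_1=m.f_21$. Composition is determined by $(g\bullet f)_1.1g_1=g_1.f_11$ and $(g\bullet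 f)_2.g_21=g_2.1f_2$, and identities are the pairs $(m,m)$. The monoidal product is that of $\mathcal C$ on underlying objects, with multiplication $mm.1c1$; on morphisms it has components $f_1g_1.1c1$ and $f_2g_2.1c1$. The unit is the trivial semigroup $I$. **Multiplier bimonoids.** A multiplier bimonoid $(A,t_1,t_2,e)$ consists of morphisms $t_1,t_2\colon A^2\to A^2$ and $e\colon A\to I$ such that $$1t_1.t_11=t_11.c^{-1}1.1t_1.c1.1t_1,\qquad 1e.t_1=1e,$$ $$t_21.1t_2=1t_2.1c^{-1}.t_21.1c.t_21,\qquad e1.t_2=e1,$$ $$1t_1.t_21=t_21.1t_1,\qquad e1.t_1=1e.t_2.$$ Its multiplication is $m:=e1.t_1=1e.t_2$, and we put $d_1:=m1.c^{-1}1.1t_1.c1$ and $d_2:=1m.1c^{-1}.t_21.1c\colon A^3\to A^2$. **Simplicial sets.** All simplicial sets below have a single $0$-simplex. * The Catalan simplicial set $\mathsf C$ has two $1$-simplices, $s_0(*)$ and $\alpha$; its non-degenerate $2$-simplices are $\tau$ (all faces $\alpha$) and $\varepsilon$ ($d_0=d_2=s_0(*)$, $d_1=\alpha$); every $n$-boundary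 with $n>2$ has a unique filler. * The $1$-simplices of $\mathsf M_{12}$ are the semigroups in $\mathcal C$. A $2$-simplex with faces $d_0=A_{12}$, $d_1=A_{02}$, $d_2=A_{01}$ is a pair $(\varphi\colon A_{02}A_{12}\to A_{01}A_{12}\mid\psi\colon A_{01}A_{02}\to A_{01}A_{12})$ with $$1m_{12}.\varphi1=\varphi.1m_{12},\qquad \varphi.m_{02}1=m_{01}1.c^{-1}1.1\varphi.c1.1\varphi,$$ $$m_{01}1.1\psi=\psi.m_{01}1,\qquad \psi.1m_{02}=1m_{12}.1c^{-1}.\psi1.1c.\psi1,\qquad m_{01}1.1\varphi=1m_{12}.\psi1.$$ A $3$-boundary has a unique filler if $$1\varphi_{123}.\varphi_{013}1=\varphi_{012}1.c^{-1}1.1\varphi_{023}.c1.1\varphi_{123},\qquad \psi_{012}1.1\psi_{023}=1\psi_{123}.1c^{-1}.\psi_{013}1.1c.\psi_{012}1,$$ $$\psi_{012}1.1\varphi_{023}=1\varphi_{123}.\psi_{013}1,$$ and none otherwise; higher simplices are coskeletal. Degeneracies are $s_0(*)=I$, $s_0(A,m)=(m\mid1)$, $s_1(A,m)=(1\mid m)$.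 * The $1$-simplices of the monoidal nerve $\mathsf N(\mathcal M^{\mathrm{op}})$ are the objects of $\mathcal M$. Its $2$-simplices with faces $d_0=A_{12}$, $d_1=A_{02}$, $d_2=A_{01}$ are the morphisms $w\colon A_{02}\nrightarrow A_{01}A_{12}$ of $\mathcal M$. A $3$-boundary has a unique filler if $(w_{012}1)\bullet w_{023}=(1w_{123})\bullet w_{013}$, and none otherwise; higher simplices are coskeletal. The degeneracies are the unit and the unit isomorphisms of $\mathcal M$. **Theorem.** There is a simplicial subset $\mathsf Q\subseteq\mathsf M_{12}$ containing $*$, whose $1$-simplices are the non-degenerate semigroups with multiplication in $\mathcal Q$, whose $2$-simplices are the $2$-simplices $(\varphi\mid\psi)$ of $\mathsf M_{12}$ with faces in $\mathsf Q$ for which $$\widehat\varphi:=m_{01}1.1c.\varphi1.1c^{-1}\colon A_{02}A_{01}A_{12}\to A_{01}A_{12},\qquad \widehat\psi:=1m_{12}.c1.1\psi.c^{-1}1\colon A_{01}A_{12}A_{02}\to A_{01}A_{12}$$ are in $\mathcal Q$ (here $c$ is $c_{A_{12},A_{01}}$), and whose $n$-simplices for $n\ge3$ are those of $\mathsf M_{12}$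 with all faces in $\mathsf Q$. Moreover: 1. Simplicial maps $\mathsf C\to\mathsf M_{12}$ correspond bijectively to multiplier bimonoids in $\mathcal C$, via $\alpha\mapsto(A,m)$, $\tau\mapsto(t_1\mid t_2)$, $\varepsilon\mapsto(e\mid e)$. This restricts to a bijection between simplicial maps $\mathsf C\to\mathsf Q$ and those multiplier bimonoids for which $m$ is non-degenerate and $m,e,d_1,d_2$ belong to $\mathcal Q$. 2. There is a simplicial map $\mathsf Q\to\mathsf N(\mathcal M^{\mathrm{op}})$, injective in every degree, which sends a $1$-simplex $(A,m)$ to the object $(A,m)$ of $\mathcal M$ and a $2$-simplex $(\varphi\mid\psi)$ to $(\widehat\varphi,\widehat\psi)\colon A_{02}\nrightarrow A_{01}A_{12}$. 3. Simplicial maps $\mathsf C\to\mathsf N(\mathcal M^{\mathrm{op}})$ correspond bijectively to comonoids in $\mathcal M$, via the images of $\alpha,\tau,\varepsilon$ (underlying object, comultiplication, and counit followed by $I\cong I\otimes I$). 4. Composing with $\mathsf Q\to\mathsf N(\mathcal M^{\mathrm{op}})$ sends a multiplier bimonoid $(A,t_1,t_2,e)$ as in 1 (with $m$ non-degenerate and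 $m,e,d_1,d_2\in\mathcal Q$) to the comonoid in $\mathcal M$ with underlying object $(A,m)$, comultiplication $(d_1,d_2)$ and counit $(e,e)$; this assignment is injective. Furthermore, a multiplier bimonoid classified by $a\colon\mathsf C\to\mathsf M_{12}$ and a comonoid classified by $k\colon\mathsf C\to\mathsf N(\mathcal M^{\mathrm{op}})$ correspond in this way if and only if there is $q\colon\mathsf C\to\mathsf Q$ whose composites with $\mathsf Q\hookrightarrow\mathsf M_{12}$ and $\mathsf Q\to\mathsf N(\mathcal M^{\mathrm{op}})$ are $a$ and $k$. -/

import Mathlib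

open CategoryTheory MonoidalCategory BraidedCategory Opposite

universe v u

namespace MultBimon

universe w w'

/-- The set of `n`-simplices of a simplicial set. -/
abbrev Simplices (X : SSet.{w}) (n : ℕ) : Type w := X.obj (op (SimplexCategory.mk n))

/-! ### Simplicial sets with one vertex, generated coskeletally from their 3-truncation -/

/-- The low-dimensional part of a simplicial set with a single 0-simplex in which a 3-simplex is
determined by its boundary: 1-simplices `Edge`, 2-simplices `Cell a₁₂ a₀₂ a₀₁` with faces
`d₀ = a₁₂`, `d₁ = a₀₂`, `d₂ = a₀₁`, and the set `Tet` of those 3-boundaries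
`(t₁₂₃, t₀₂₃, t₀₁₃, t₀₁₂)` which have a (then unique) filler; together with the degeneracies
`one = s₀(∗)`, `s0`, `s1` and the fillers required by the degenerate 3-simplices. -/
structure CoskData where
  Edge : Type w
  Cell : Edge → Edge → Edge → Type w'
  Tet : ∀ {a₀₁ a₀₂ a₀₃ a₁₂ a₁₃ a₂₃ : Edge}, Cell a₂₃ a₁₃ a₁₂ → Cell a₂₃ a₀₃ a₀₂ →
    Cell a₁₃ a₀₃ a₀₁ → Cell a₁₂ a₀₂ a₀₁ → Prop
  one : Edge
  s0 : ∀ a, Cell a a one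
  s1 : ∀ a, Cell one a a
  s0_one : s0 one = s1 one
  tet_s0 : ∀ {a₁₂ a₀₂ a₀₁} (t : Cell a₁₂ a₀₂ a₀₁), Tet t t (s0 a₀₂) (s0 a₀₁)
  tet_s1 : ∀ {a₁₂ a₀₂ a₀₁} (t : Cell a₁₂ a₀₂ a₀₁), Tet (s0 a₁₂) t t (s1 a₀₁)
  tet_s2 : ∀ {a₁₂ a₀₂ a₀₁} (t : Cell a₁₂ a₀₂ a₀₁), Tet (s1 a₁₂) (s1 a₀₂) t t

namespace CoskData

variable (D : CoskData.{w, w'})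

/-- A 2-simplex bundled with its faces. -/
structure Tri where
  d0 : D.Edge
  d1 : D.Edge
  d2 : D.Edge
  cell : D.Cell d0 d1 d2

variable {D} in
/-- The 4-tuples of 2-simplices forming the boundary of a 3-simplex. -/
inductive IsTet : D.Tri → D.Tri → D.Tri → D.Tri → Prop
  | mk {a₀₁ a₀₂ a₀₃ a₁₂ a₁₃ a₂₃ : D.Edge} (t₁₂₃ : D.Cell a₂₃ a₁₃ a₁₂) (t₀₂₃ : D.Cell a₂₃ a₀₃ a₀₂)
      (t₀₁₃ : D.Cell a₁₃ a₀₃ a₀₁) (t₀₁₂ : D.Cell a₁₂ a₀₂ a₀₁) (h : D.Tet t₁₂₃ t₀₂₃ t₀₁₃ t₀₁₂) :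
      IsTet ⟨_, _, _, t₁₂₃⟩ ⟨_, _, _, t₀₂₃⟩ ⟨_, _, _, t₀₁₃⟩ ⟨_, _, _, t₀₁₂⟩

/-- The bundled degenerate 2-simplex `s₀(a)`. -/
def s0Tri (a : D.Edge) : D.Tri := ⟨_, _, _, D.s0 a⟩

/-- The bundled degenerate 2-simplex `s₁(a)`. -/
def s1Tri (a : D.Edge) : D.Tri := ⟨_, _, _, D.s1 a⟩

/-- An `n`-simplex of the coskeletal simplicial set generated by `D`, that is, a compatible family
of simplices of dimension at most 3, indexed by the simplices `i ≤ j`, `i ≤ j ≤ k` and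
`i ≤ j ≤ k ≤ l` of the standard `n`-simplex. -/
@[ext]
structure Simplex (n : ℕ) where
  edge : ∀ i j : Fin (n + 1), i ≤ j → D.Edge
  tri : ∀ i j k : Fin (n + 1), i ≤ j → j ≤ k → D.Tri
  tri_d0 : ∀ i j k hij hjk, (tri i j k hij hjk).d0 = edge j k hjk
  tri_d1 : ∀ i j k hij hjk, (tri i j k hij hjk).d1 = edge i k (hij.trans hjk)
  tri_d2 : ∀ i j k hij hjk, (tri i j k hij hjk).d2 = edge i j hij
  edge_refl : ∀ i, edge i i le_rfl = D.one
  tri_left : ∀ i k hik, tri i i k le_rfl hik = D.s0Tri (edge i k hik)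
  tri_right : ∀ i k hik, tri i k k hik le_rfl = D.s1Tri (edge i k hik)
  tet : ∀ i j k l (hij : i ≤ j) (hjk : j ≤ k) (hkl : k ≤ l),
    IsTet (tri j k l hjk hkl) (tri i k l (hij.trans hjk) hkl) (tri i j l hij (hjk.trans hkl))
      (tri i j k hij hjk)

variable {D}

/-- The action of order-preserving maps on simplices. -/
def Simplex.comap {m n : ℕ} (x : D.Simplex n) (f : Fin (m + 1) →o Fin (n + 1)) : D.Simplex m where
  edge i j h := x.edge (f i) (f j) (f.monotone h)
  tri i j k h h' := x.tri (f i) (f j) (f k) (f.monotone h) (f.monotone h')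
  tri_d0 _ _ _ _ _ := x.tri_d0 _ _ _ _ _
  tri_d1 _ _ _ _ _ := x.tri_d1 _ _ _ _ _
  tri_d2 _ _ _ _ _ := x.tri_d2 _ _ _ _ _
  edge_refl _ := x.edge_refl _
  tri_left _ _ _ := x.tri_left _ _ _
  tri_right _ _ _ := x.tri_right _ _ _
  tet _ _ _ _ _ _ _ := x.tet _ _ _ _ _ _ _

variable (D) in
/-- The simplicial set generated coskeletally by `D`. -/
def sset : SSet.{max w w'} where
  obj n := D.Simplex n.unop.len
  map f := ↾fun x => x.comap f.unop.toOrderHom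
  map_id _ := rfl
  map_comp _ _ := rfl

/-- An `n`-simplex of `D.sset`, seen as a compatible family. -/
def fam {n : ℕ} (x : Simplices D.sset n) : D.Simplex n := x

/-- The element of `D.Edge` underlying a 1-simplex of `D.sset`. -/
def toEdge (x : Simplices D.sset 1) : D.Edge := (fam x).edge 0 1 (by decide)

/-- The element of `D.Tri` underlying a 2-simplex of `D.sset`. -/
def toTri (x : Simplices D.sset 2) : D.Tri := (fam x).tri 0 1 2 (by decide) (by decide)

theorem isTet_s0 (t : D.Tri) : IsTet t t (D.s0Tri t.d1) (D.s0Tri t.d2) :=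
  IsTet.mk _ _ _ _ (D.tet_s0 t.cell)

theorem isTet_s1 (t : D.Tri) : IsTet (D.s0Tri t.d0) t t (D.s1Tri t.d2) :=
  IsTet.mk _ _ _ _ (D.tet_s1 t.cell)

theorem isTet_s2 (t : D.Tri) : IsTet (D.s1Tri t.d0) (D.s1Tri t.d1) t t :=
  IsTet.mk _ _ _ _ (D.tet_s2 t.cell)

/-- The edges of the 2-simplex with given faces. -/
def edge₂ (t : D.Tri) (i j : Fin 3) : D.Edge :=
  if i = j then D.one else if i = 1 then t.d0 else if j = 1 then t.d2 else t.d1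

/-- The 2-dimensional simplices of the 2-simplex with given faces. -/
def tri₂ (t : D.Tri) (i j k : Fin 3) : D.Tri :=
  if i = j then D.s0Tri (edge₂ t i k) else if j = k then D.s1Tri (edge₂ t i j) else t

theorem edge₂_refl (t : D.Tri) (i : Fin 3) : edge₂ t i i = D.one := if_pos rfl

theorem tri₂_left (t : D.Tri) (i k : Fin 3) : tri₂ t i i k = D.s0Tri (edge₂ t i k) := if_pos rfl

theorem tri₂_right (t : D.Tri) (i k : Fin 3) : tri₂ t i k k = D.s1Tri (edge₂ t i k) := by
  by_cases h : i = k
  · subst h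
    rw [tri₂_left, edge₂_refl, s0Tri, s1Tri, D.s0_one]
  · rw [tri₂, if_neg h, if_pos rfl]

theorem tri₂_faces (t : D.Tri) (i j k : Fin 3) (hij : i ≤ j) (hjk : j ≤ k) :
    (tri₂ t i j k).d0 = edge₂ t j k ∧ (tri₂ t i j k).d1 = edge₂ t i k ∧
      (tri₂ t i j k).d2 = edge₂ t i j := by
  rcases hij.eq_or_lt with rfl | hij'
  · rw [tri₂_left, edge₂_refl]
    exact ⟨rfl, rfl, rfl⟩
  rcases hjk.eq_or_lt with rfl | hjk'
  · rw [tri₂_right, edge₂_refl]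
    exact ⟨rfl, rfl, rfl⟩
  obtain rfl : i = 0 := by omega
  obtain rfl : j = 1 := by omega
  obtain rfl : k = 2 := by omega
  exact ⟨rfl, rfl, rfl⟩

/-- The 2-simplex of `D.sset` given by a 2-simplex of `D`. -/
def ofTri (t : D.Tri) : Simplices D.sset 2 :=
  show D.Simplex 2 from
  { edge := fun i j _ => edge₂ t i j
    tri := fun i j k _ _ => tri₂ t i j k
    tri_d0 := fun i j k hij hjk => (tri₂_faces t i j k hij hjk).1
    tri_d1 := fun i j k hij hjk => (tri₂_faces t i j k hij hjk).2.1
    tri_d2 := fun i j k hij hjk => (tri₂_faces t i j k hij hjk).2.2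
    edge_refl := fun i => edge₂_refl t i
    tri_left := fun i k _ => tri₂_left t i k
    tri_right := fun i k _ => tri₂_right t i k
    tet := fun i j k l hij hjk hkl => by
      rcases hij.eq_or_lt with rfl | hij'
      · obtain ⟨_, h1, h2⟩ := tri₂_faces t i k l hjk hkl
        rw [tri₂_left t i k, tri₂_left t i l, ← h1, ← h2]
        exact isTet_s0 _
      rcases hjk.eq_or_lt with rfl | hjk'
      · obtain ⟨h0, _, h2⟩ := tri₂_faces t i j l hij hkl
        rw [tri₂_left t j l, tri₂_right t i j, ← h0, ← h2]
        exact isTet_s1 _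
      rcases hkl.eq_or_lt with rfl | hkl'
      · obtain ⟨h0, h1, _⟩ := tri₂_faces t i j k hij hjk
        rw [tri₂_right t j k, tri₂_right t i k, ← h0, ← h1]
        exact isTet_s2 _
      · omega }

/-- The 1-simplex of `D.sset` given by a 1-simplex of `D`. -/
def ofEdge (a : D.Edge) : Simplices D.sset 1 := D.sset.δ 0 (ofTri (D.s0Tri a))

end CoskData

/-! ### The Catalan simplicial set -/

/-- The 1-simplices of the Catalan simplicial set. -/
inductive CatalanEdge : Type w
  | one
  | alpha

/-- The 2-simplices of the Catalan simplicial set. -/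
inductive CatalanCell : CatalanEdge.{w} → CatalanEdge.{w} → CatalanEdge.{w} → Type w
  | s0s0 : CatalanCell .one .one .one
  | s0alpha : CatalanCell .alpha .alpha .one
  | s1alpha : CatalanCell .one .alpha .alpha
  | tau : CatalanCell .alpha .alpha .alpha
  | eps : CatalanCell .one .alpha .one

/-- The low-dimensional part of the Catalan simplicial set; every 3-boundary has a unique filler. -/
def catalanData : CoskData.{w, w} where
  Edge := CatalanEdge
  Cell := CatalanCell
  Tet _ _ _ _ := True
  one := .one
  s0 | .one => .s0s0 | .alpha => .s0alpha
  s1 | .one => .s0s0 | .alpha => .s1alpha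
  s0_one := rfl
  tet_s0 _ := trivial
  tet_s1 _ := trivial
  tet_s2 _ := trivial

/-- The Catalan simplicial set. -/
abbrev catalanSSet : SSet.{w} := catalanData.sset

/-- The non-degenerate 1-simplex `α`. -/
def catalanα : Simplices catalanSSet.{w} 1 := CoskData.ofEdge (D := catalanData) .alpha

/-- The non-degenerate 2-simplex `τ` all of whose faces are `α`. -/
def catalanτ : Simplices catalanSSet.{w} 2 := CoskData.ofTri (D := catalanData) ⟨_, _, _, .tau⟩

/-- The non-degenerate 2-simplex `ε` with faces `d₀ = d₂ = s₀(∗)` and `d₁ = α`. -/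
def catalanε : Simplices catalanSSet.{w} 2 := CoskData.ofTri (D := catalanData) ⟨_, _, _, .eps⟩

/-! ### The nerve of a monoidal category -/

/-- The low-dimensional part of the nerve of a monoidal category, seen as a one-object bicategory
in which the composite `w₁₂ ∘ w₀₁` is `w₀₁ ⊗ w₁₂`. -/
def monoidalNerveData (D : Type u) [Category.{v} D] [MonoidalCategory D] : CoskData.{u, v} where
  Edge := D
  Cell a₁₂ a₀₂ a₀₁ := a₀₁ ⊗ a₁₂ ⟶ a₀₂
  Tet {a₀₁ _ _ a₁₂ _ a₂₃} w₁₂₃ w₀₂₃ w₀₁₃ w₀₁₂ :=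
    w₀₁₂ ▷ a₂₃ ≫ w₀₂₃ = (α_ a₀₁ a₁₂ a₂₃).hom ≫ a₀₁ ◁ w₁₂₃ ≫ w₀₁₃
  one := 𝟙_ D
  s0 a := (λ_ a).hom
  s1 a := (ρ_ a).hom
  s0_one := unitors_equal
  tet_s0 _ := by simp
  tet_s1 _ := by simp
  tet_s2 _ := by simp

/-- The nerve of a monoidal category. -/
abbrev monoidalNerve (D : Type u) [Category.{v} D] [MonoidalCategory D] : SSet.{max u v} :=
  (monoidalNerveData D).sset

/-! ### Non-degenerate semigroups and their category -/

section Semigroups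

variable {C : Type u} [Category.{v} C] [MonoidalCategory C]

variable (C) in
/-- A semigroup in a monoidal category. -/
@[ext]
structure SemigroupIn where
  X : C
  mul : X ⊗ X ⟶ X
  assoc : mul ▷ X ≫ mul = (α_ X X X).hom ≫ X ◁ mul ≫ mul

/-- Non-degeneracy of the multiplication of a semigroup `A`: both maps
`C(X, AY) → C(AX, AY)` and `C(X, YA) → C(XA, YA)` induced by the multiplication are injective. -/
structure SemigroupIn.NonDegenerate (A : SemigroupIn C) : Prop where
  left : ∀ X Y : C, Function.Injective
    fun f : X ⟶ A.X ⊗ Y => A.X ◁ f ≫ (α_ A.X A.X Y).inv ≫ A.mul ▷ Y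
  right : ∀ X Y : C, Function.Injective
    fun g : X ⟶ Y ⊗ A.X => g ▷ A.X ≫ (α_ Y A.X A.X).hom ≫ Y ◁ A.mul

theorem SemigroupIn.NonDegenerate.hom_ext {A : SemigroupIn C} (hA : A.NonDegenerate) {X : C}
    {f g : X ⟶ A.X} (h : A.X ◁ f ≫ A.mul = A.X ◁ g ≫ A.mul) : f = g := by
  have := @hA.left X (𝟙_ C) (f ≫ (ρ_ _).inv) (g ≫ (ρ_ _).inv) (by
    have e (f : X ⟶ A.X) : A.X ◁ (f ≫ (ρ_ _).inv) ≫ (α_ A.X A.X (𝟙_ C)).inv ≫ A.mul ▷ (𝟙_ C) =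
        (A.X ◁ f ≫ A.mul) ≫ (ρ_ _).inv := by
      simp
    simp only [e, h])
  simpa using this

theorem SemigroupIn.NonDegenerate.hom_ext' {A : SemigroupIn C} (hA : A.NonDegenerate) {X : C}
    {f g : X ⟶ A.X} (h : f ▷ A.X ≫ A.mul = g ▷ A.X ≫ A.mul) : f = g := by
  have := @hA.right X (𝟙_ C) (f ≫ (λ_ _).inv) (g ≫ (λ_ _).inv) (by
    have e (f : X ⟶ A.X) : (f ≫ (λ_ _).inv) ▷ A.X ≫ (α_ (𝟙_ C) A.X A.X).hom ≫ (𝟙_ C) ◁ A.mul =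
        (f ▷ A.X ≫ A.mul) ≫ (λ_ _).inv := by
      simp
    simp only [e, h])
  simpa using this

/-- The standing assumptions on a class of morphisms: it consists of regular epimorphisms, each
of them being the coequalizer of a pair which is preserved by the monoidal product with any object;
it contains the isomorphisms, is closed under composition and monoidal product, and is
right-cancellative. -/
class SuitableClass (𝒬 : MorphismProperty C) : Prop where
  exists_isColimit : ∀ {X Y : C} (q : X ⟶ Y), 𝒬 q → ∃ (Z : C) (a b : Z ⟶ X) (w : a ≫ q = b ≫ q),
    Nonempty (Limits.IsColimit (Limits.Cofork.ofπ q w)) ∧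
    (∀ W : C, Nonempty (Limits.IsColimit (Limits.Cofork.ofπ (f := W ◁ a) (g := W ◁ b) (W ◁ q)
      (by simp only [← whiskerLeft_comp, w])))) ∧
    (∀ W : C, Nonempty (Limits.IsColimit (Limits.Cofork.ofπ (f := a ▷ W) (g := b ▷ W) (q ▷ W)
      (by simp only [← comp_whiskerRight, w]))))
  of_isIso : ∀ {X Y : C} (f : X ⟶ Y), IsIso f → 𝒬 f
  comp : ∀ {X Y Z : C} (f : X ⟶ Y) (g : Y ⟶ Z), 𝒬 f → 𝒬 g → 𝒬 (f ≫ g)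
  tensor : ∀ {X Y X' Y' : C} (f : X ⟶ Y) (f' : X' ⟶ Y'), 𝒬 f → 𝒬 f' → 𝒬 (f ⊗ₘ f')
  cancel : ∀ {X Y Z : C} (s : X ⟶ Y) (t : Y ⟶ Z), 𝒬 s → 𝒬 (s ≫ t) → 𝒬 t

namespace SuitableClass

variable {𝒬 : MorphismProperty C} [h𝒬 : SuitableClass 𝒬]

theorem whiskerLeft (W : C) {X Y : C} {f : X ⟶ Y} (hf : 𝒬 f) : 𝒬 (W ◁ f) := by
  rw [← id_tensorHom]
  exact h𝒬.tensor _ _ (h𝒬.of_isIso _ inferInstance) hf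

theorem whiskerRight (W : C) {X Y : C} {f : X ⟶ Y} (hf : 𝒬 f) : 𝒬 (f ▷ W) := by
  rw [← tensorHom_id]
  exact h𝒬.tensor _ _ hf (h𝒬.of_isIso _ inferInstance)

theorem epi {X Y : C} {f : X ⟶ Y} (hf : 𝒬 f) : Epi f := by
  obtain ⟨Z, a, b, w, ⟨h⟩, -⟩ := h𝒬.exists_isColimit f hf
  exact Limits.epi_of_isColimit_cofork h

/-- Left whiskerings of morphisms in the class have the universal property of a coequalizer. -/
theorem exists_desc_left (W : C) {X Y Z : C} {q : X ⟶ Y} (hq : 𝒬 q) (k : W ⊗ X ⟶ Z)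
    (hk : ∀ (P : C) (a b : P ⟶ X), a ≫ q = b ≫ q → W ◁ a ≫ k = W ◁ b ≫ k) :
    ∃ l : W ⊗ Y ⟶ Z, W ◁ q ≫ l = k := by
  obtain ⟨P, a, b, w, -, h, -⟩ := h𝒬.exists_isColimit q hq
  obtain ⟨h⟩ := h W
  exact ⟨Limits.Cofork.IsColimit.desc h k (hk P a b w), Limits.Cofork.IsColimit.π_desc' h _ _⟩

/-- Right whiskerings of morphisms in the class have the universal property of a coequalizer. -/
theorem exists_desc_right (W : C) {X Y Z : C} {q : X ⟶ Y} (hq : 𝒬 q) (k : X ⊗ W ⟶ Z)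
    (hk : ∀ (P : C) (a b : P ⟶ X), a ≫ q = b ≫ q → a ▷ W ≫ k = b ▷ W ≫ k) :
    ∃ l : Y ⊗ W ⟶ Z, q ▷ W ≫ l = k := by
  obtain ⟨P, a, b, w, -, -, h⟩ := h𝒬.exists_isColimit q hq
  obtain ⟨h⟩ := h W
  exact ⟨Limits.Cofork.IsColimit.desc h k (hk P a b w), Limits.Cofork.IsColimit.π_desc' h _ _⟩

end SuitableClass

/-- The objects of the category associated to the class `𝒬`: semigroups whose multiplication is
non-degenerate and belongs to `𝒬`. -/
@[ext]
structure NDSemigroup (𝒬 : MorphismProperty C) extends SemigroupIn C where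
  nonDegenerate : toSemigroupIn.NonDegenerate
  mul_mem : 𝒬 mul

/-- A morphism `A ⇸ B`: a pair `f₁ : AB ⟶ B`, `f₂ : BA ⟶ B` of morphisms in `𝒬` such that
`f₁(aa', b) = f₁(a, f₁(a', b))` and `b f₁(a, b') = f₂(b, a) b'`. -/
@[ext]
structure MHom {𝒬 : MorphismProperty C} (A B : NDSemigroup 𝒬) where
  fst : A.X ⊗ B.X ⟶ B.X
  snd : B.X ⊗ A.X ⟶ B.X
  fst_mem : 𝒬 fst
  snd_mem : 𝒬 snd
  mul_fst : A.mul ▷ B.X ≫ fst = (α_ _ _ _).hom ≫ A.X ◁ fst ≫ fst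
  snd_mul : snd ▷ B.X ≫ B.mul = (α_ _ _ _).hom ≫ B.X ◁ fst ≫ B.mul

namespace MHom

variable {𝒬 : MorphismProperty C} {A B D E : NDSemigroup 𝒬}

/-- The first component determines the morphism. -/
theorem ext_fst {f g : MHom A B} (h : f.fst = g.fst) : f = g := by
  refine MHom.ext h ?_
  apply B.nonDegenerate.hom_ext'
  rw [f.snd_mul, g.snd_mul, h]

/-- `f₁(a, bb') = f₁(a, b) b'`. -/
theorem fst_mul (f : MHom A B) :
    A.X ◁ B.mul ≫ f.fst = (α_ _ _ _).inv ≫ f.fst ▷ B.X ≫ B.mul := by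
  apply B.nonDegenerate.hom_ext
  have h1 : B.X ◁ (A.X ◁ B.mul ≫ f.fst) ≫ B.mul =
      𝟙 _ ⊗≫ (B.X ⊗ A.X) ◁ B.mul ⊗≫ (f.snd ▷ B.X ≫ B.mul) := by
    rw [f.snd_mul]; monoidal
  have h2 : B.X ◁ ((α_ _ _ _).inv ≫ f.fst ▷ B.X ≫ B.mul) ≫ B.mul =
      𝟙 _ ⊗≫ (B.X ◁ f.fst) ▷ B.X ⊗≫ ((α_ _ _ _).hom ≫ B.X ◁ B.mul ≫ B.mul) := by
    monoidal
  rw [h1, h2, ← B.assoc]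
  calc
    _ = 𝟙 _ ⊗≫ ((B.X ⊗ A.X) ◁ B.mul ≫ f.snd ▷ B.X) ≫ B.mul := by monoidal
    _ = 𝟙 _ ⊗≫ f.snd ▷ (B.X ⊗ B.X) ⊗≫ ((α_ _ _ _).hom ≫ B.X ◁ B.mul ≫ B.mul) := by
      rw [whisker_exchange]; monoidal
    _ = 𝟙 _ ⊗≫ (f.snd ▷ B.X ≫ B.mul) ▷ B.X ⊗≫ B.mul := by
      rw [← B.assoc]; monoidal
    _ = _ := by rw [f.snd_mul]; monoidal

/-- The key identity behind composition:
`g₂(c, f₂(b, a)) g₁(b', c') = g₂(c, b) g₁(f₁(a, b'), c')`. -/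
theorem key (f : MHom A B) (g : MHom B D) :
    ((α_ _ _ _).hom ≫ D.X ◁ f.snd ≫ g.snd) ▷ (B.X ⊗ D.X) ≫ D.X ◁ g.fst ≫ D.mul =
      (g.snd ▷ A.X) ▷ (B.X ⊗ D.X) ≫ (α_ _ _ _).hom ≫
        D.X ◁ ((α_ _ _ _).inv ≫ f.fst ▷ D.X ≫ g.fst) ≫ D.mul := by
  calc
    _ = 𝟙 _ ⊗≫ (D.X ◁ f.snd) ▷ (B.X ⊗ D.X) ⊗≫ (g.snd ▷ (B.X ⊗ D.X) ≫ D.X ◁ g.fst) ⊗≫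
        D.mul := by monoidal
    _ = 𝟙 _ ⊗≫ (D.X ◁ f.snd) ▷ (B.X ⊗ D.X) ⊗≫ (D.X ⊗ B.X) ◁ g.fst ⊗≫
        (g.snd ▷ D.X ≫ D.mul) := by rw [← whisker_exchange]; monoidal
    _ = 𝟙 _ ⊗≫ (D.X ◁ f.snd) ▷ (B.X ⊗ D.X) ⊗≫
        D.X ◁ ((α_ _ _ _).hom ≫ B.X ◁ g.fst ≫ g.fst) ⊗≫ D.mul := by
      rw [g.snd_mul]; monoidal
    _ = 𝟙 _ ⊗≫ D.X ◁ (f.snd ▷ B.X ≫ B.mul) ▷ D.X ⊗≫ D.X ◁ g.fst ⊗≫ D.mul := by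
      rw [← g.mul_fst]; monoidal
    _ = 𝟙 _ ⊗≫ (D.X ⊗ B.X) ◁ (f.fst ▷ D.X) ⊗≫
        D.X ◁ (B.mul ▷ D.X ≫ g.fst) ⊗≫ D.mul := by
      rw [f.snd_mul]; monoidal
    _ = 𝟙 _ ⊗≫ (D.X ⊗ B.X) ◁ (f.fst ▷ D.X ≫ g.fst) ⊗≫
        ((α_ _ _ _).hom ≫ D.X ◁ g.fst ≫ D.mul) := by
      rw [g.mul_fst]; monoidal
    _ = 𝟙 _ ⊗≫ ((D.X ⊗ B.X) ◁ ((α_ _ _ _).inv ≫ f.fst ▷ D.X ≫ g.fst) ≫ g.snd ▷ D.X) ⊗≫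
        D.mul := by
      rw [← g.snd_mul]; monoidal
    _ = _ := by rw [whisker_exchange]; monoidal

variable [h𝒬 : SuitableClass 𝒬]

theorem exists_comp_fst (f : MHom A B) (g : MHom B D) :
    ∃ h : A.X ⊗ D.X ⟶ D.X, A.X ◁ g.fst ≫ h = (α_ _ _ _).inv ≫ f.fst ▷ D.X ≫ g.fst := by
  refine SuitableClass.exists_desc_left (𝒬 := 𝒬) _ g.fst_mem _ fun P a b hab => ?_
  apply D.nonDegenerate.hom_ext
  have : Epi (g.snd ▷ (A.X ⊗ P)) := SuitableClass.epi (𝒬 := 𝒬)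
    (SuitableClass.whiskerRight _ g.snd_mem)
  have e (a : P ⟶ B.X ⊗ D.X) : g.snd ▷ (A.X ⊗ P) ≫
      D.X ◁ (A.X ◁ a ≫ (α_ _ _ _).inv ≫ f.fst ▷ D.X ≫ g.fst) ≫ D.mul =
      (α_ _ _ _).inv ≫ ((α_ _ _ _).hom ≫ D.X ◁ f.snd ≫ g.snd) ▷ P ≫ D.X ◁ (a ≫ g.fst) ≫
        D.mul := by
    have k := key f g
    calc
      _ = 𝟙 _ ⊗≫ ((D.X ⊗ B.X) ⊗ A.X) ◁ a ≫ ((g.snd ▷ A.X) ▷ (B.X ⊗ D.X) ≫ (α_ _ _ _).hom ≫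
        D.X ◁ ((α_ _ _ _).inv ≫ f.fst ▷ D.X ≫ g.fst) ≫ D.mul) := by
          rw [whisker_exchange_assoc]; monoidal
      _ = 𝟙 _ ⊗≫ (((D.X ⊗ B.X) ⊗ A.X) ◁ a ≫
          ((α_ _ _ _).hom ≫ D.X ◁ f.snd ≫ g.snd) ▷ (B.X ⊗ D.X)) ≫ D.X ◁ g.fst ≫ D.mul := by
          rw [← k]; monoidal
      _ = _ := by rw [whisker_exchange]; monoidal
  rw [← cancel_epi (g.snd ▷ (A.X ⊗ P)), e, e, hab]

theorem exists_comp_snd (f : MHom A B) (g : MHom B D) :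
    ∃ h : D.X ⊗ A.X ⟶ D.X, g.snd ▷ A.X ≫ h = (α_ _ _ _).hom ≫ D.X ◁ f.snd ≫ g.snd := by
  refine SuitableClass.exists_desc_right (𝒬 := 𝒬) _ g.snd_mem _ fun P a b hab => ?_
  have : Epi ((P ⊗ A.X) ◁ g.fst) := SuitableClass.epi (𝒬 := 𝒬)
    (SuitableClass.whiskerLeft _ g.fst_mem)
  have e (a : P ⟶ D.X ⊗ B.X) : (P ⊗ A.X) ◁ g.fst ≫
      (a ▷ A.X ≫ (α_ _ _ _).hom ≫ D.X ◁ f.snd ≫ g.snd) ▷ D.X ≫ D.mul =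
      ((a ≫ g.snd) ▷ A.X) ▷ (B.X ⊗ D.X) ≫ (α_ _ _ _).hom ≫
        D.X ◁ ((α_ _ _ _).inv ≫ f.fst ▷ D.X ≫ g.fst) ≫ D.mul := by
    rw [whisker_exchange_assoc, comp_whiskerRight, Category.assoc, key f g]
    monoidal
  apply D.nonDegenerate.hom_ext'
  rw [← cancel_epi ((P ⊗ A.X) ◁ g.fst), e, e, hab]

/-- The identity morphism `(m, m)`. -/
def id (A : NDSemigroup 𝒬) : MHom A A where
  fst := A.mul
  snd := A.mul
  fst_mem := A.mul_mem
  snd_mem := A.mul_mem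
  mul_fst := A.assoc
  snd_mul := A.assoc

/-- The composite `g ∙ f`, with components defined by the universal property of coequalizers:
`(g ∙ f)₁(a, g₁(b, c)) = g₁(f₁(a, b), c)` and `(g ∙ f)₂(g₂(c, b), a) = g₂(c, f₂(b, a))`. -/
noncomputable def comp (f : MHom A B) (g : MHom B D) : MHom A D where
  fst := (exists_comp_fst f g).choose
  snd := (exists_comp_snd f g).choose
  fst_mem := by
    refine h𝒬.cancel _ _ (SuitableClass.whiskerLeft A.X g.fst_mem) ?_
    rw [(exists_comp_fst f g).choose_spec]
    exact h𝒬.comp _ _ (h𝒬.of_isIso _ inferInstance)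
      (h𝒬.comp _ _ (SuitableClass.whiskerRight _ f.fst_mem) g.fst_mem)
  snd_mem := by
    refine h𝒬.cancel _ _ (SuitableClass.whiskerRight A.X g.snd_mem) ?_
    rw [(exists_comp_snd f g).choose_spec]
    exact h𝒬.comp _ _ (h𝒬.of_isIso _ inferInstance)
      (h𝒬.comp _ _ (SuitableClass.whiskerLeft _ f.snd_mem) g.snd_mem)
  mul_fst := by
    have h1 := (exists_comp_fst f g).choose_spec
    set h := (exists_comp_fst f g).choose
    have : Epi ((A.X ⊗ A.X) ◁ g.fst) := SuitableClass.epi (𝒬 := 𝒬)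
      (SuitableClass.whiskerLeft _ g.fst_mem)
    rw [← cancel_epi ((A.X ⊗ A.X) ◁ g.fst)]
    calc
      _ = A.mul ▷ (B.X ⊗ D.X) ≫ A.X ◁ g.fst ≫ h := by rw [whisker_exchange_assoc]
      _ = 𝟙 _ ⊗≫ (A.mul ▷ B.X ≫ f.fst) ▷ D.X ≫ g.fst := by rw [h1]; monoidal
      _ = 𝟙 _ ⊗≫ A.X ◁ f.fst ▷ D.X ⊗≫ ((α_ _ _ _).inv ≫ f.fst ▷ D.X ≫ g.fst) := by
        rw [f.mul_fst]; monoidal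
      _ = 𝟙 _ ⊗≫ A.X ◁ f.fst ▷ D.X ⊗≫ (A.X ◁ g.fst ≫ h) := by rw [h1]
      _ = 𝟙 _ ⊗≫ A.X ◁ ((α_ _ _ _).inv ≫ f.fst ▷ D.X ≫ g.fst) ≫ h := by monoidal
      _ = 𝟙 _ ⊗≫ A.X ◁ (A.X ◁ g.fst ≫ h) ≫ h := by rw [h1]
      _ = _ := by monoidal
  snd_mul := by
    have h1 := (exists_comp_fst f g).choose_spec
    have h2 := (exists_comp_snd f g).choose_spec
    set h := (exists_comp_fst f g).choose
    set h' := (exists_comp_snd f g).choose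
    have : Epi ((g.snd ▷ A.X) ▷ (B.X ⊗ D.X)) := SuitableClass.epi (𝒬 := 𝒬)
      (SuitableClass.whiskerRight _ (SuitableClass.whiskerRight _ g.snd_mem))
    have : Epi ((D.X ⊗ A.X) ◁ g.fst) := SuitableClass.epi (𝒬 := 𝒬)
      (SuitableClass.whiskerLeft _ g.fst_mem)
    rw [← cancel_epi ((D.X ⊗ A.X) ◁ g.fst), ← cancel_epi ((g.snd ▷ A.X) ▷ (B.X ⊗ D.X))]
    calc
      _ = (g.snd ▷ A.X ≫ h') ▷ (B.X ⊗ D.X) ≫ D.X ◁ g.fst ≫ D.mul := by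
        rw [whisker_exchange_assoc, comp_whiskerRight_assoc]
      _ = (g.snd ▷ A.X) ▷ (B.X ⊗ D.X) ≫ (α_ _ _ _).hom ≫
        D.X ◁ (A.X ◁ g.fst ≫ h) ≫ D.mul := by rw [h2, key, h1]
      _ = _ := by monoidal

theorem comp_fst (f : MHom A B) (g : MHom B D) :
    A.X ◁ g.fst ≫ (f.comp g).fst = (α_ _ _ _).inv ≫ f.fst ▷ D.X ≫ g.fst :=
  (exists_comp_fst f g).choose_spec

theorem comp_snd (f : MHom A B) (g : MHom B D) :
    g.snd ▷ A.X ≫ (f.comp g).snd = (α_ _ _ _).hom ≫ D.X ◁ f.snd ≫ g.snd :=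
  (exists_comp_snd f g).choose_spec

/-- The composite is determined by the defining property of its first component. -/
theorem comp_eq {f : MHom A B} {g : MHom B D} {h : MHom A D}
    (e : A.X ◁ g.fst ≫ h.fst = (α_ _ _ _).inv ≫ f.fst ▷ D.X ≫ g.fst) : f.comp g = h := by
  have : Epi (A.X ◁ g.fst) := SuitableClass.epi (𝒬 := 𝒬) (SuitableClass.whiskerLeft _ g.fst_mem)
  apply ext_fst
  rw [← cancel_epi (A.X ◁ g.fst), e, comp_fst]

end MHom

variable {𝒬 : MorphismProperty C} [h𝒬 : SuitableClass 𝒬]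

noncomputable instance : Category (NDSemigroup 𝒬) where
  Hom := MHom
  id := MHom.id
  comp := MHom.comp
  id_comp {A B} f := MHom.comp_eq (by
    change A.X ◁ f.fst ≫ f.fst = (α_ A.X A.X B.X).inv ≫ A.mul ▷ B.X ≫ f.fst
    rw [f.mul_fst, Iso.inv_hom_id_assoc])
  comp_id f := MHom.comp_eq f.fst_mul
  assoc {A B D E} f g h := MHom.comp_eq (by
    have : Epi (A.X ◁ (g.fst ▷ E.X ≫ h.fst)) := SuitableClass.epi (𝒬 := 𝒬)
      (SuitableClass.whiskerLeft _ (h𝒬.comp _ _ (SuitableClass.whiskerRight _ g.fst_mem) h.fst_mem))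
    have h1 := MHom.comp_fst f g
    have h2 := MHom.comp_fst g h
    have h3 := MHom.comp_fst f (g.comp h)
    have : Epi (A.X ◁ (B.X ◁ h.fst)) := SuitableClass.epi (𝒬 := 𝒬)
      (SuitableClass.whiskerLeft _ (SuitableClass.whiskerLeft _ h.fst_mem))
    have : Epi (A.X ◁ (g.fst ▷ E.X)) := SuitableClass.epi (𝒬 := 𝒬)
      (SuitableClass.whiskerLeft _ (SuitableClass.whiskerRight _ g.fst_mem))
    rw [← cancel_epi (A.X ◁ (g.fst ▷ E.X))]
    calc
      _ = 𝟙 _ ⊗≫ A.X ◁ ((α_ _ _ _).inv ≫ g.fst ▷ E.X ≫ h.fst) ≫ (f.comp (g.comp h)).fst := by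
        monoidal
      _ = 𝟙 _ ⊗≫ (A.X ⊗ B.X) ◁ h.fst ⊗≫ (A.X ◁ (g.comp h).fst ≫ (f.comp (g.comp h)).fst) := by
        rw [← h2]; monoidal
      _ = 𝟙 _ ⊗≫ ((A.X ⊗ B.X) ◁ h.fst ≫ f.fst ▷ E.X) ≫ (g.comp h).fst := by
        rw [h3]; monoidal
      _ = 𝟙 _ ⊗≫ f.fst ▷ (D.X ⊗ E.X) ≫ (B.X ◁ h.fst ≫ (g.comp h).fst) := by
        rw [whisker_exchange]; monoidal
      _ = 𝟙 _ ⊗≫ ((α_ _ _ _).inv ≫ f.fst ▷ D.X ≫ g.fst) ▷ E.X ≫ h.fst := by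
        rw [h2]; monoidal
      _ = _ := by rw [← h1]; monoidal)

namespace NDSemigroup

@[ext]
theorem hom_ext {A B : NDSemigroup 𝒬} {f g : A ⟶ B} (h : f.fst = g.fst) : f = g := MHom.ext_fst h

theorem id_fst (A : NDSemigroup 𝒬) : MHom.fst (𝟙 A) = A.mul := rfl

theorem comp_fst {A B D : NDSemigroup 𝒬} (f : A ⟶ B) (g : B ⟶ D) :
    A.X ◁ g.fst ≫ (f ≫ g).fst = (α_ _ _ _).inv ≫ f.fst ▷ D.X ≫ g.fst := MHom.comp_fst f g

theorem comp_eq {A B D : NDSemigroup 𝒬} {f : A ⟶ B} {g : B ⟶ D} {h : A ⟶ D}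
    (e : A.X ◁ g.fst ≫ h.fst = (α_ _ _ _).inv ≫ f.fst ▷ D.X ≫ g.fst) : f ≫ g = h :=
  MHom.comp_eq e

/-- The morphism `A ⇸ B` given by a multiplicative isomorphism of underlying objects. -/
def homOfIso {A B : NDSemigroup 𝒬} (i : A.X ≅ B.X)
    (h : A.mul ≫ i.hom = (i.hom ⊗ₘ i.hom) ≫ B.mul) : A ⟶ B where
  fst := i.hom ▷ B.X ≫ B.mul
  snd := B.X ◁ i.hom ≫ B.mul
  fst_mem := h𝒬.comp _ _ (h𝒬.of_isIso _ inferInstance) B.mul_mem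
  snd_mem := h𝒬.comp _ _ (h𝒬.of_isIso _ inferInstance) B.mul_mem
  mul_fst := by
    rw [← comp_whiskerRight_assoc, h]
    calc
      _ = (i.hom ⊗ₘ i.hom) ▷ B.X ≫ (B.mul ▷ B.X ≫ B.mul) := by monoidal
      _ = 𝟙 _ ⊗≫ A.X ◁ i.hom ▷ B.X ⊗≫ (i.hom ▷ (B.X ⊗ B.X) ≫ B.X ◁ B.mul) ≫ B.mul := by
        rw [B.assoc, tensorHom_def']; monoidal
      _ = _ := by rw [← whisker_exchange]; monoidal
  snd_mul := by
    calc
      _ = (B.X ◁ i.hom) ▷ B.X ≫ (B.mul ▷ B.X ≫ B.mul) := by monoidal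
      _ = _ := by rw [B.assoc]; monoidal

theorem homOfIso_fst {A B : NDSemigroup 𝒬} (i : A.X ≅ B.X)
    (h : A.mul ≫ i.hom = (i.hom ⊗ₘ i.hom) ≫ B.mul) :
    (homOfIso i h).fst = i.hom ▷ B.X ≫ B.mul := rfl

theorem homOfIso_comp_fst {A B D : NDSemigroup 𝒬} (i : A.X ≅ B.X)
    (h : A.mul ≫ i.hom = (i.hom ⊗ₘ i.hom) ≫ B.mul) (g : B ⟶ D) :
    (homOfIso i h ≫ g).fst = i.hom ▷ D.X ≫ g.fst := by
  have : Epi (A.X ◁ g.fst) := SuitableClass.epi (𝒬 := 𝒬) (SuitableClass.whiskerLeft _ g.fst_mem)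
  rw [← cancel_epi (A.X ◁ g.fst), comp_fst, homOfIso_fst]
  calc
    _ = 𝟙 _ ⊗≫ i.hom ▷ (B.X ⊗ D.X) ⊗≫ (B.mul ▷ D.X ≫ g.fst) := by monoidal
    _ = i.hom ▷ (B.X ⊗ D.X) ≫ B.X ◁ g.fst ≫ g.fst := by rw [g.mul_fst]; monoidal
    _ = _ := by rw [← whisker_exchange_assoc]

theorem comp_homOfIso_fst {A B D : NDSemigroup 𝒬} (f : A ⟶ B) (i : B.X ≅ D.X)
    (h : B.mul ≫ i.hom = (i.hom ⊗ₘ i.hom) ≫ D.mul) :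
    A.X ◁ i.hom ≫ (f ≫ homOfIso i h).fst = f.fst ≫ i.hom := by
  have : Epi (A.X ◁ B.mul) := SuitableClass.epi (𝒬 := 𝒬) (SuitableClass.whiskerLeft _ B.mul_mem)
  rw [← cancel_epi (A.X ◁ B.mul), ← whiskerLeft_comp_assoc, h]
  have e := comp_fst f (homOfIso i h)
  rw [homOfIso_fst] at e
  calc
    _ = A.X ◁ (B.X ◁ i.hom) ≫ (A.X ◁ (i.hom ▷ D.X ≫ D.mul) ≫ (f ≫ homOfIso i h).fst) := by
      rw [tensorHom_def']; simp
    _ = 𝟙 _ ⊗≫ ((A.X ⊗ B.X) ◁ i.hom ≫ f.fst ▷ D.X) ⊗≫ i.hom ▷ D.X ≫ D.mul := by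
      rw [e]; monoidal
    _ = 𝟙 _ ⊗≫ f.fst ▷ B.X ⊗≫ (B.X ◁ i.hom ≫ i.hom ▷ D.X) ≫ D.mul := by
      rw [whisker_exchange]; monoidal
    _ = (A.X ◁ B.mul ≫ f.fst) ≫ i.hom := by
      rw [← tensorHom_def', f.fst_mul, Category.assoc, Category.assoc, h]; monoidal
    _ = _ := by rw [Category.assoc]

theorem homOfIso_congr {A B : NDSemigroup 𝒬} {i j : A.X ≅ B.X} (e : i.hom = j.hom)
    (h : A.mul ≫ i.hom = (i.hom ⊗ₘ i.hom) ≫ B.mul)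
    (h' : A.mul ≫ j.hom = (j.hom ⊗ₘ j.hom) ≫ B.mul) : homOfIso i h = homOfIso j h' := by
  ext
  rw [homOfIso_fst, homOfIso_fst, e]

theorem homOfIso_refl (A : NDSemigroup 𝒬) {i : A.X ≅ A.X} (e : i.hom = 𝟙 _)
    (h : A.mul ≫ i.hom = (i.hom ⊗ₘ i.hom) ≫ A.mul) : homOfIso i h = 𝟙 A := by
  ext
  rw [homOfIso_fst, e, id_fst]
  simp

theorem homOfIso_comp {A B D : NDSemigroup 𝒬} (i : A.X ≅ B.X)
    (h : A.mul ≫ i.hom = (i.hom ⊗ₘ i.hom) ≫ B.mul) (j : B.X ≅ D.X)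
    (h' : B.mul ≫ j.hom = (j.hom ⊗ₘ j.hom) ≫ D.mul) :
    homOfIso i h ≫ homOfIso j h' = homOfIso (i ≪≫ j) (by
      rw [Iso.trans_hom, reassoc_of% h, h', tensorHom_comp_tensorHom_assoc]) := by
  ext
  rw [homOfIso_comp_fst, homOfIso_fst, homOfIso_fst]
  simp

/-- The isomorphism given by a multiplicative isomorphism of underlying objects. -/
noncomputable def isoOfIso {A B : NDSemigroup 𝒬} (i : A.X ≅ B.X)
    (h : A.mul ≫ i.hom = (i.hom ⊗ₘ i.hom) ≫ B.mul) : A ≅ B where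
  hom := homOfIso i h
  inv := homOfIso i.symm (by
    rw [← cancel_mono i.hom]
    simp [h])
  hom_inv_id := by
    rw [homOfIso_comp]
    exact homOfIso_refl _ (by simp) _
  inv_hom_id := by
    rw [homOfIso_comp]
    exact homOfIso_refl _ (by simp) _

theorem comp_homOfIso_eq {A B A' B' : NDSemigroup 𝒬} {f : A ⟶ B} {g : A' ⟶ B'} {i : A.X ≅ A'.X}
    (hi : A.mul ≫ i.hom = (i.hom ⊗ₘ i.hom) ≫ A'.mul) {j : B.X ≅ B'.X}
    (hj : B.mul ≫ j.hom = (j.hom ⊗ₘ j.hom) ≫ B'.mul)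
    (h : f.fst ≫ j.hom = (i.hom ⊗ₘ j.hom) ≫ g.fst) :
    f ≫ homOfIso j hj = homOfIso i hi ≫ g := by
  ext
  rw [homOfIso_comp_fst, ← cancel_epi (A.X ◁ j.hom), comp_homOfIso_fst, h, tensorHom_def']
  simp

end NDSemigroup

end Semigroups

/-! ### The monoidal structure -/

section Braided

variable {C : Type u} [Category.{v} C] [MonoidalCategory C] [BraidedCategory C]

theorem tensorμ_comp_left {X₁ X₂ Y₁ Y₂ Z₁ Z₂ W₁ W₂ V₁ V₂ : C} (p : X₁ ⊗ Y₁ ⟶ W₁)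
    (q : X₂ ⊗ Y₂ ⟶ W₂) (r : W₁ ⊗ Z₁ ⟶ V₁) (s : W₂ ⊗ Z₂ ⟶ V₂) :
    (tensorμ X₁ X₂ Y₁ Y₂ ≫ (p ⊗ₘ q)) ▷ (Z₁ ⊗ Z₂) ≫ tensorμ W₁ W₂ Z₁ Z₂ ≫ (r ⊗ₘ s) =
      (α_ _ _ _).hom ≫ (X₁ ⊗ X₂) ◁ tensorμ Y₁ Y₂ Z₁ Z₂ ≫ tensorμ X₁ X₂ (Y₁ ⊗ Z₁) (Y₂ ⊗ Z₂) ≫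
        (((α_ _ _ _).inv ≫ p ▷ Z₁ ≫ r) ⊗ₘ ((α_ _ _ _).inv ≫ q ▷ Z₂ ≫ s)) := by
  rw [comp_whiskerRight_assoc, tensorμ_natural_left_assoc, ← tensorHom_comp_tensorHom,
    ← tensorHom_comp_tensorHom, ← tensor_associativity_assoc, tensorHom_comp_tensorHom_assoc]
  simp

theorem tensorμ_comp_right {X₁ X₂ Y₁ Y₂ Z₁ Z₂ W₁ W₂ V₁ V₂ : C} (p : Y₁ ⊗ Z₁ ⟶ W₁)
    (q : Y₂ ⊗ Z₂ ⟶ W₂) (r : X₁ ⊗ W₁ ⟶ V₁) (s : X₂ ⊗ W₂ ⟶ V₂) :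
    (X₁ ⊗ X₂) ◁ (tensorμ Y₁ Y₂ Z₁ Z₂ ≫ (p ⊗ₘ q)) ≫ tensorμ X₁ X₂ W₁ W₂ ≫ (r ⊗ₘ s) =
      (X₁ ⊗ X₂) ◁ tensorμ Y₁ Y₂ Z₁ Z₂ ≫ tensorμ X₁ X₂ (Y₁ ⊗ Z₁) (Y₂ ⊗ Z₂) ≫
        ((X₁ ◁ p ≫ r) ⊗ₘ (X₂ ◁ q ≫ s)) := by
  rw [whiskerLeft_comp_assoc, tensorμ_natural_right_assoc, tensorHom_comp_tensorHom]

instance (X₁ X₂ Y₁ Y₂ : C) : IsIso (tensorμ X₁ X₂ Y₁ Y₂) :=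
  ⟨tensorδ X₁ X₂ Y₁ Y₂, tensorμ_tensorδ _ _ _ _, tensorδ_tensorμ _ _ _ _⟩

/-- The trivial semigroup on the monoidal unit. -/
abbrev SemigroupIn.unit : SemigroupIn C where
  X := 𝟙_ C
  mul := (λ_ (𝟙_ C)).hom
  assoc := by monoidal

/-- The monoidal product of semigroups. -/
abbrev SemigroupIn.tensor (A B : SemigroupIn C) : SemigroupIn C where
  X := A.X ⊗ B.X
  mul := tensorμ A.X B.X A.X B.X ≫ (A.mul ⊗ₘ B.mul)
  assoc := by
    rw [tensorμ_comp_left, tensorμ_comp_right, A.assoc, B.assoc]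
    simp

set_option linter.unusedSectionVars false in
theorem SemigroupIn.unit_nonDegenerate : (SemigroupIn.unit : SemigroupIn C).NonDegenerate where
  left X Y := by
    have e (f : X ⟶ 𝟙_ C ⊗ Y) : 𝟙_ C ◁ f ≫ (α_ (𝟙_ C) (𝟙_ C) Y).inv ≫ (λ_ (𝟙_ C)).hom ▷ Y =
        (λ_ X).hom ≫ f := by
      rw [← leftUnitor_naturality]; monoidal
    intro f g h
    exact (cancel_epi (λ_ X).hom).mp ((e f).symm.trans (Eq.trans h (e g)))
  right X Y := by
    have e (f : X ⟶ Y ⊗ 𝟙_ C) : f ▷ 𝟙_ C ≫ (α_ Y (𝟙_ C) (𝟙_ C)).hom ≫ Y ◁ (λ_ (𝟙_ C)).hom =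
        (ρ_ X).hom ≫ f := by
      rw [← rightUnitor_naturality]; monoidal
    intro f g h
    exact (cancel_epi (ρ_ X).hom).mp ((e f).symm.trans (Eq.trans h (e g)))

theorem braid_mul_left (A : C) (B : SemigroupIn C) :
    B.X ◁ (β_ B.X A).inv ≫ (α_ _ _ _).inv ≫ B.mul ▷ A =
      (α_ _ _ _).inv ≫ (β_ B.X A).hom ▷ B.X ≫ (α_ _ _ _).hom ≫ A ◁ B.mul ≫ (β_ B.X A).inv := by
  rw [braiding_inv_naturality_right, braiding_tensor_left_inv]
  simp

theorem braid_mul_right (A : SemigroupIn C) (B : C) :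
    (β_ B A.X).inv ▷ A.X ≫ (α_ _ _ _).hom ≫ B ◁ A.mul =
      (α_ _ _ _).hom ≫ A.X ◁ (β_ B A.X).hom ≫ (α_ _ _ _).inv ≫ A.mul ▷ B ≫ (β_ B A.X).inv := by
  rw [braiding_inv_naturality_left, braiding_tensor_right_inv]
  simp

theorem SemigroupIn.NonDegenerate.tensor_left {A B : SemigroupIn C} (hA : A.NonDegenerate)
    (hB : B.NonDegenerate) {X Y : C} {f g : X ⟶ (A.X ⊗ B.X) ⊗ Y}
    (h : (A.X ⊗ B.X) ◁ f ≫ (α_ (A.X ⊗ B.X) (A.X ⊗ B.X) Y).inv ≫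
        (tensorμ A.X B.X A.X B.X ≫ (A.mul ⊗ₘ B.mul)) ▷ Y =
      (A.X ⊗ B.X) ◁ g ≫ (α_ (A.X ⊗ B.X) (A.X ⊗ B.X) Y).inv ≫
        (tensorμ A.X B.X A.X B.X ≫ (A.mul ⊗ₘ B.mul)) ▷ Y) : f = g := by
  let b (f : X ⟶ (A.X ⊗ B.X) ⊗ Y) : B.X ⊗ X ⟶ A.X ⊗ (B.X ⊗ Y) :=
    B.X ◁ f ≫ (α_ _ _ _).inv ≫ ((α_ _ _ _).inv ≫ (β_ B.X A.X).hom ▷ B.X ≫ (α_ _ _ _).hom ≫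
      A.X ◁ B.mul) ▷ Y ≫ (α_ _ _ _).hom
  have e1 (f : X ⟶ (A.X ⊗ B.X) ⊗ Y) :
      A.X ◁ b f ≫ (α_ A.X A.X (B.X ⊗ Y)).inv ≫ A.mul ▷ (B.X ⊗ Y) =
      (α_ _ _ _).inv ≫ ((A.X ⊗ B.X) ◁ f ≫ (α_ (A.X ⊗ B.X) (A.X ⊗ B.X) Y).inv ≫
      (tensorμ A.X B.X A.X B.X ≫ (A.mul ⊗ₘ B.mul)) ▷ Y) ≫ (α_ _ _ _).hom := by
    simp only [b, tensorμ, tensorHom_def']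
    monoidal
  have hb : b f = b g := hA.left (B.X ⊗ X) (B.X ⊗ Y)
    ((e1 f).trans (Eq.trans (by rw [h]) (e1 g).symm))
  have e2 (f : X ⟶ (A.X ⊗ B.X) ⊗ Y) :
      B.X ◁ (f ≫ (β_ B.X A.X).inv ▷ Y ≫ (α_ _ _ _).hom) ≫ (α_ _ _ _).inv ≫
        B.mul ▷ (A.X ⊗ Y) = b f ≫ (α_ _ _ _).inv ≫ (β_ B.X A.X).inv ▷ Y ≫ (α_ _ _ _).hom := by
    calc
      _ = B.X ◁ f ⊗≫ (B.X ◁ (β_ B.X A.X).inv ≫ (α_ _ _ _).inv ≫ B.mul ▷ A.X) ▷ Y ⊗≫ 𝟙 _ := by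
        monoidal
      _ = _ := by
        rw [braid_mul_left]
        simp only [b]
        monoidal
  exact (cancel_mono _).mp (hB.left X (A.X ⊗ Y) ((e2 f).trans (Eq.trans (by rw [hb]) (e2 g).symm)))

theorem SemigroupIn.NonDegenerate.tensor_right {A B : SemigroupIn C} (hA : A.NonDegenerate)
    (hB : B.NonDegenerate) {X Y : C} {f g : X ⟶ Y ⊗ (A.X ⊗ B.X)}
    (h : f ▷ (A.X ⊗ B.X) ≫ (α_ Y (A.X ⊗ B.X) (A.X ⊗ B.X)).hom ≫
        Y ◁ (tensorμ A.X B.X A.X B.X ≫ (A.mul ⊗ₘ B.mul)) =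
      g ▷ (A.X ⊗ B.X) ≫ (α_ Y (A.X ⊗ B.X) (A.X ⊗ B.X)).hom ≫
        Y ◁ (tensorμ A.X B.X A.X B.X ≫ (A.mul ⊗ₘ B.mul))) : f = g := by
  let b (f : X ⟶ Y ⊗ (A.X ⊗ B.X)) : X ⊗ A.X ⟶ (Y ⊗ A.X) ⊗ B.X :=
    f ▷ A.X ≫ (α_ _ _ _).hom ≫ Y ◁ ((α_ _ _ _).hom ≫ A.X ◁ (β_ B.X A.X).hom ≫ (α_ _ _ _).inv ≫
      A.mul ▷ B.X) ≫ (α_ _ _ _).inv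
  have e1 (f : X ⟶ Y ⊗ (A.X ⊗ B.X)) :
      b f ▷ B.X ≫ (α_ (Y ⊗ A.X) B.X B.X).hom ≫ (Y ⊗ A.X) ◁ B.mul =
      (α_ _ _ _).hom ≫ (f ▷ (A.X ⊗ B.X) ≫ (α_ Y (A.X ⊗ B.X) (A.X ⊗ B.X)).hom ≫
      Y ◁ (tensorμ A.X B.X A.X B.X ≫ (A.mul ⊗ₘ B.mul))) ≫ (α_ _ _ _).inv := by
    simp only [b, tensorμ, MonoidalCategory.tensorHom_def]
    monoidal
  have hb : b f = b g := hB.right (X ⊗ A.X) (Y ⊗ A.X)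
    ((e1 f).trans (Eq.trans (by rw [h]) (e1 g).symm))
  have e2 (f : X ⟶ Y ⊗ (A.X ⊗ B.X)) :
      (f ≫ Y ◁ (β_ B.X A.X).inv ≫ (α_ _ _ _).inv) ▷ A.X ≫ (α_ _ _ _).hom ≫
        (Y ⊗ B.X) ◁ A.mul = b f ≫ (α_ _ _ _).hom ≫ Y ◁ (β_ B.X A.X).inv ≫ (α_ _ _ _).inv := by
    calc
      _ = f ▷ A.X ⊗≫ Y ◁ ((β_ B.X A.X).inv ▷ A.X ≫ (α_ _ _ _).hom ≫ B.X ◁ A.mul) ⊗≫ 𝟙 _ := by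
        monoidal
      _ = _ := by
        rw [braid_mul_right]
        simp only [b]
        monoidal
  exact (cancel_mono _).mp (hA.right X (Y ⊗ B.X) ((e2 f).trans (Eq.trans (by rw [hb]) (e2 g).symm)))

theorem SemigroupIn.NonDegenerate.tensor {A B : SemigroupIn C} (hA : A.NonDegenerate)
    (hB : B.NonDegenerate) : (A.tensor B).NonDegenerate where
  left _ _ := fun _ _ h => hA.tensor_left hB h
  right _ _ := fun _ _ h => hA.tensor_right hB h

namespace NDSemigroup

variable {𝒬 : MorphismProperty C} [h𝒬 : SuitableClass 𝒬]

/-- The monoidal unit. -/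
abbrev unit (𝒬 : MorphismProperty C) [h𝒬 : SuitableClass 𝒬] : NDSemigroup 𝒬 where
  toSemigroupIn := SemigroupIn.unit
  nonDegenerate := SemigroupIn.unit_nonDegenerate
  mul_mem := h𝒬.of_isIso _ (inferInstanceAs (IsIso (λ_ (𝟙_ C)).hom))

/-- The monoidal product of objects. -/
abbrev tensor (A B : NDSemigroup 𝒬) : NDSemigroup 𝒬 where
  toSemigroupIn := A.toSemigroupIn.tensor B.toSemigroupIn
  nonDegenerate := A.nonDegenerate.tensor B.nonDegenerate
  mul_mem := h𝒬.comp _ _ (h𝒬.of_isIso _ inferInstance) (h𝒬.tensor _ _ A.mul_mem B.mul_mem)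

/-- The monoidal product of morphisms. -/
def tensorHom {A B D E : NDSemigroup 𝒬} (f : A ⟶ B) (g : D ⟶ E) : A.tensor D ⟶ B.tensor E where
  fst := tensorμ A.X D.X B.X E.X ≫ (f.fst ⊗ₘ g.fst)
  snd := tensorμ B.X E.X A.X D.X ≫ (f.snd ⊗ₘ g.snd)
  fst_mem := h𝒬.comp _ _ (h𝒬.of_isIso _ inferInstance) (h𝒬.tensor _ _ f.fst_mem g.fst_mem)
  snd_mem := h𝒬.comp _ _ (h𝒬.of_isIso _ inferInstance) (h𝒬.tensor _ _ f.snd_mem g.snd_mem)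
  mul_fst := by
    dsimp only [tensor, SemigroupIn.tensor]
    rw [tensorμ_comp_left, tensorμ_comp_right, f.mul_fst, g.mul_fst]
    simp
  snd_mul := by
    dsimp only [tensor, SemigroupIn.tensor]
    rw [tensorμ_comp_left, tensorμ_comp_right, f.snd_mul, g.snd_mul]
    simp

theorem tensorHom_homOfIso {A B D E : NDSemigroup 𝒬} (i : A.X ≅ B.X)
    (h : A.mul ≫ i.hom = (i.hom ⊗ₘ i.hom) ≫ B.mul) (j : D.X ≅ E.X)
    (h' : D.mul ≫ j.hom = (j.hom ⊗ₘ j.hom) ≫ E.mul) :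
    tensorHom (homOfIso i h) (homOfIso j h') = homOfIso (A := A.tensor D) (B := B.tensor E)
      (tensorIso i j) (by
        dsimp only [tensor, SemigroupIn.tensor]
        rw [tensorIso_hom, tensorμ_natural_assoc, Category.assoc, tensorHom_comp_tensorHom,
          tensorHom_comp_tensorHom, h, h']) := by
  ext
  dsimp only [tensorHom, homOfIso, tensor, SemigroupIn.tensor]
  rw [tensorIso_hom, tensorμ_natural_left_assoc, tensorHom_comp_tensorHom]

theorem tensorHom_id_id (A B : NDSemigroup 𝒬) : tensorHom (𝟙 A) (𝟙 B) = 𝟙 (A.tensor B) := by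
  ext
  rfl

theorem tensorHom_comp {A B D A' B' D' : NDSemigroup 𝒬} (f : A ⟶ B) (g : B ⟶ D) (f' : A' ⟶ B')
    (g' : B' ⟶ D') : tensorHom f f' ≫ tensorHom g g' = tensorHom (f ≫ g) (f' ≫ g') := by
  apply comp_eq
  dsimp only [tensorHom, tensor, SemigroupIn.tensor]
  rw [tensorμ_comp_left, tensorμ_comp_right, comp_fst, comp_fst, Iso.inv_hom_id_assoc]

theorem tensor_assoc_mul (A B D : NDSemigroup 𝒬) :
    ((A.tensor B).tensor D).mul ≫ (α_ A.X B.X D.X).hom =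
      ((α_ A.X B.X D.X).hom ⊗ₘ (α_ A.X B.X D.X).hom) ≫ (A.tensor (B.tensor D)).mul := by
  have h := associator_monoidal A.X B.X D.X A.X B.X D.X
  calc
    _ = (tensorμ (A.X ⊗ B.X) D.X (A.X ⊗ B.X) D.X ≫
        (tensorμ A.X B.X A.X B.X ▷ (D.X ⊗ D.X)) ≫ (α_ (A.X ⊗ A.X) (B.X ⊗ B.X) (D.X ⊗ D.X)).hom) ≫
        (A.mul ⊗ₘ (B.mul ⊗ₘ D.mul)) := by simp [MonoidalCategory.tensorHom_def]
    _ = _ := by rw [h]; simp [tensorHom_def']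

theorem unit_tensor_mul (A : NDSemigroup 𝒬) :
    ((unit 𝒬).tensor A).mul ≫ (λ_ A.X).hom = ((λ_ A.X).hom ⊗ₘ (λ_ A.X).hom) ≫ A.mul := by
  rw [leftUnitor_monoidal]
  simp [MonoidalCategory.tensorHom_def]

theorem tensor_unit_mul (A : NDSemigroup 𝒬) :
    (A.tensor (unit 𝒬)).mul ≫ (ρ_ A.X).hom = ((ρ_ A.X).hom ⊗ₘ (ρ_ A.X).hom) ≫ A.mul := by
  rw [rightUnitor_monoidal]
  simp [tensorHom_def']

noncomputable instance : MonoidalCategoryStruct (NDSemigroup 𝒬) where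
  tensorObj A B := A.tensor B
  tensorUnit := unit 𝒬
  tensorHom f g := tensorHom f g
  whiskerLeft A _ _ g := tensorHom (𝟙 A) g
  whiskerRight f B := tensorHom f (𝟙 B)
  associator A B D := isoOfIso _ (tensor_assoc_mul A B D)
  leftUnitor A := isoOfIso _ (unit_tensor_mul A)
  rightUnitor A := isoOfIso _ (tensor_unit_mul A)

theorem associator_naturality {A B D A' B' D' : NDSemigroup 𝒬} (f : A ⟶ A') (g : B ⟶ B')
    (h : D ⟶ D') : tensorHom (tensorHom f g) h ≫ homOfIso _ (tensor_assoc_mul A' B' D') =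
      homOfIso _ (tensor_assoc_mul A B D) ≫ tensorHom f (tensorHom g h) := by
  apply comp_homOfIso_eq
  have e := associator_monoidal A.X B.X D.X A'.X B'.X D'.X
  calc
    _ = (tensorμ (A.X ⊗ B.X) D.X (A'.X ⊗ B'.X) D'.X ≫
        (tensorμ A.X B.X A'.X B'.X ▷ (D.X ⊗ D'.X)) ≫
        (α_ (A.X ⊗ A'.X) (B.X ⊗ B'.X) (D.X ⊗ D'.X)).hom) ≫
        (f.fst ⊗ₘ (g.fst ⊗ₘ h.fst)) := by simp [tensorHom, MonoidalCategory.tensorHom_def]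
    _ = _ := by rw [e]; simp [tensorHom, tensorHom_def']

theorem leftUnitor_naturality {A B : NDSemigroup 𝒬} (f : A ⟶ B) :
    tensorHom (𝟙 (unit 𝒬)) f ≫ homOfIso _ (unit_tensor_mul B) =
      homOfIso _ (unit_tensor_mul A) ≫ f := by
  apply comp_homOfIso_eq
  rw [leftUnitor_monoidal]
  simp [tensorHom, id_fst, MonoidalCategory.tensorHom_def]

theorem rightUnitor_naturality {A B : NDSemigroup 𝒬} (f : A ⟶ B) :
    tensorHom f (𝟙 (unit 𝒬)) ≫ homOfIso _ (tensor_unit_mul B) =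
      homOfIso _ (tensor_unit_mul A) ≫ f := by
  apply comp_homOfIso_eq
  rw [rightUnitor_monoidal]
  simp [tensorHom, id_fst, tensorHom_def']

noncomputable instance : MonoidalCategory (NDSemigroup 𝒬) :=
  MonoidalCategory.ofTensorHom
    (id_tensorHom_id := tensorHom_id_id)
    (id_tensorHom := fun _ _ _ _ => rfl)
    (tensorHom_id := fun _ _ => rfl)
    (tensorHom_comp_tensorHom := fun f f' g g' => tensorHom_comp f g f' g')
    (associator_naturality := associator_naturality)
    (leftUnitor_naturality := leftUnitor_naturality)
    (rightUnitor_naturality := rightUnitor_naturality)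
    (pentagon := fun A B D E => by
      change tensorHom (homOfIso _ (tensor_assoc_mul A B D)) (𝟙 E) ≫
        homOfIso _ (tensor_assoc_mul A (B.tensor D) E) ≫
        tensorHom (𝟙 A) (homOfIso _ (tensor_assoc_mul B D E)) =
        homOfIso _ (tensor_assoc_mul (A.tensor B) D E) ≫
        homOfIso _ (tensor_assoc_mul A B (D.tensor E))
      rw [← homOfIso_refl E (i := Iso.refl _) rfl (by simp),
        ← homOfIso_refl A (i := Iso.refl _) rfl (by simp), tensorHom_homOfIso, tensorHom_homOfIso,
        homOfIso_comp, homOfIso_comp, homOfIso_comp]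
      refine homOfIso_congr ?_ _ _
      simp only [Iso.trans_hom, tensorIso_hom, Iso.refl_hom, MonoidalCategory.tensorHom_id,
        MonoidalCategory.id_tensorHom]
      exact MonoidalCategory.pentagon A.X B.X D.X E.X)
    (triangle := fun A B => by
      change homOfIso _ (tensor_assoc_mul A (unit 𝒬) B) ≫
        tensorHom (𝟙 A) (homOfIso _ (unit_tensor_mul B)) =
        tensorHom (homOfIso _ (tensor_unit_mul A)) (𝟙 B)
      rw [← homOfIso_refl A (i := Iso.refl _) rfl (by simp),
        ← homOfIso_refl B (i := Iso.refl _) rfl (by simp), tensorHom_homOfIso, tensorHom_homOfIso,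
        homOfIso_comp]
      exact homOfIso_congr (by simp) _ _)

end NDSemigroup


/-! ### The simplicial set `M₁₂` -/

/-- For `φ : A D ⟶ B D`, the composite `(c⁻¹ 1)(1 φ)(c 1) : A E D ⟶ E A D ⟶ E B D ⟶ B E D`. -/
def midL (E : C) {A B D : C} (φ : A ⊗ D ⟶ B ⊗ D) : A ⊗ (E ⊗ D) ⟶ B ⊗ (E ⊗ D) :=
  (α_ _ _ _).inv ≫ (β_ A E).hom ▷ D ≫ (α_ _ _ _).hom ≫ E ◁ φ ≫ (α_ _ _ _).inv ≫
    (β_ B E).inv ▷ D ≫ (α_ _ _ _).hom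

/-- For `ψ : D A ⟶ D B`, the composite `(1 c⁻¹)(ψ 1)(1 c) : D E A ⟶ D A E ⟶ D B E ⟶ D E B`. -/
def midR (E : C) {A B D : C} (ψ : D ⊗ A ⟶ D ⊗ B) : (D ⊗ E) ⊗ A ⟶ (D ⊗ E) ⊗ B :=
  (α_ _ _ _).hom ≫ D ◁ (β_ E A).hom ≫ (α_ _ _ _).inv ≫ ψ ▷ E ≫ (α_ _ _ _).hom ≫
    D ◁ (β_ E B).inv ≫ (α_ _ _ _).inv

theorem midL_unit {A B D : C} (φ : A ⊗ D ⟶ B ⊗ D) :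
    midL (𝟙_ C) φ = A ◁ (λ_ D).hom ≫ φ ≫ B ◁ (λ_ D).inv := by
  rw [midL, braiding_tensorUnit_right, braiding_inv_tensorUnit_right]
  monoidal

theorem midR_unit {A B D : C} (ψ : D ⊗ A ⟶ D ⊗ B) :
    midR (𝟙_ C) ψ = (ρ_ D).hom ▷ A ≫ ψ ≫ (ρ_ D).inv ▷ B := by
  rw [midR, braiding_tensorUnit_left, braiding_inv_tensorUnit_left]
  monoidal

theorem midL_id (E A D : C) : midL E (𝟙 (A ⊗ D)) = 𝟙 _ := by
  simp [midL, ← comp_whiskerRight_assoc]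

theorem midR_id (E A D : C) : midR E (𝟙 (D ⊗ A)) = 𝟙 _ := by
  simp [midR, ← whiskerLeft_comp_assoc]

/-- A 2-simplex `(φ | ψ)` of `M₁₂` with faces `d₀ = A₁₂`, `d₁ = A₀₂`, `d₂ = A₀₁`. -/
@[ext]
structure M12Cell (A₁₂ A₀₂ A₀₁ : SemigroupIn C) where
  φ : A₀₂.X ⊗ A₁₂.X ⟶ A₀₁.X ⊗ A₁₂.X
  ψ : A₀₁.X ⊗ A₀₂.X ⟶ A₀₁.X ⊗ A₁₂.X
  φ_mul : φ ▷ A₁₂.X ≫ (α_ _ _ _).hom ≫ A₀₁.X ◁ A₁₂.mul = (α_ _ _ _).hom ≫ A₀₂.X ◁ A₁₂.mul ≫ φ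
  mul_φ : A₀₂.mul ▷ A₁₂.X ≫ φ =
    (α_ _ _ _).hom ≫ A₀₂.X ◁ φ ≫ midL A₀₁.X φ ≫ (α_ _ _ _).inv ≫ A₀₁.mul ▷ A₁₂.X
  mul_ψ : A₀₁.X ◁ ψ ≫ (α_ _ _ _).inv ≫ A₀₁.mul ▷ A₁₂.X = (α_ _ _ _).inv ≫ A₀₁.mul ▷ A₀₂.X ≫ ψ
  ψ_mul : A₀₁.X ◁ A₀₂.mul ≫ ψ =
    (α_ _ _ _).inv ≫ ψ ▷ A₀₂.X ≫ midR A₁₂.X ψ ≫ (α_ _ _ _).hom ≫ A₀₁.X ◁ A₁₂.mul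
  compat : A₀₁.X ◁ φ ≫ (α_ _ _ _).inv ≫ A₀₁.mul ▷ A₁₂.X =
    (α_ _ _ _).inv ≫ ψ ▷ A₁₂.X ≫ (α_ _ _ _).hom ≫ A₀₁.X ◁ A₁₂.mul

namespace M12Cell

variable {A₀₁ A₀₂ A₀₃ A₁₂ A₁₃ A₂₃ : SemigroupIn C}

/-- The condition for a 3-boundary of `M₁₂` to have a filler. -/
structure IsTet (t₁₂₃ : M12Cell A₂₃ A₁₃ A₁₂) (t₀₂₃ : M12Cell A₂₃ A₀₃ A₀₂)
    (t₀₁₃ : M12Cell A₁₃ A₀₃ A₀₁) (t₀₁₂ : M12Cell A₁₂ A₀₂ A₀₁) : Prop where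
  fusion₁ : t₀₁₃.φ ▷ A₂₃.X ≫ (α_ _ _ _).hom ≫ A₀₁.X ◁ t₁₂₃.φ =
    (α_ _ _ _).hom ≫ A₀₃.X ◁ t₁₂₃.φ ≫ midL A₁₂.X t₀₂₃.φ ≫ (α_ _ _ _).inv ≫ t₀₁₂.φ ▷ A₂₃.X ≫
      (α_ _ _ _).hom
  fusion₂ : A₀₁.X ◁ t₀₂₃.ψ ≫ (α_ _ _ _).inv ≫ t₀₁₂.ψ ▷ A₂₃.X =
    (α_ _ _ _).inv ≫ t₀₁₂.ψ ▷ A₀₃.X ≫ midR A₁₂.X t₀₁₃.ψ ≫ (α_ _ _ _).hom ≫ A₀₁.X ◁ t₁₂₃.ψ ≫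
      (α_ _ _ _).inv
  compat : A₀₁.X ◁ t₀₂₃.φ ≫ (α_ _ _ _).inv ≫ t₀₁₂.ψ ▷ A₂₃.X =
    (α_ _ _ _).inv ≫ t₀₁₃.ψ ▷ A₂₃.X ≫ (α_ _ _ _).hom ≫ A₀₁.X ◁ t₁₂₃.φ ≫ (α_ _ _ _).inv

/-- The degenerate 2-simplex `s₀(A, m) = (m | 1)`. -/
def s0 (A : SemigroupIn C) : M12Cell A A SemigroupIn.unit where
  φ := A.mul ≫ (λ_ A.X).inv
  ψ := 𝟙 _
  φ_mul := by
    calc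
      _ = (A.mul ▷ A.X ≫ A.mul) ≫ (λ_ A.X).inv := by monoidal
      _ = _ := by rw [A.assoc]; monoidal
  mul_φ := by
    rw [midL_unit, reassoc_of% A.assoc]
    monoidal
  mul_ψ := by monoidal
  ψ_mul := by
    rw [midR_id]
    monoidal
  compat := by monoidal

/-- The degenerate 2-simplex `s₁(A, m) = (1 | m)`. -/
def s1 (A : SemigroupIn C) : M12Cell SemigroupIn.unit A A where
  φ := 𝟙 _
  ψ := A.mul ≫ (ρ_ A.X).inv
  φ_mul := by monoidal
  mul_φ := by
    rw [midL_id]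
    monoidal
  mul_ψ := by
    calc
      _ = ((α_ _ _ _).inv ≫ (α_ _ _ _).hom ≫ A.X ◁ A.mul ≫ A.mul) ≫ (ρ_ A.X).inv := by monoidal
      _ = _ := by rw [← A.assoc]; monoidal
  ψ_mul := by
    rw [midR_unit]
    calc
      _ = ((α_ _ _ _).inv ≫ (α_ _ _ _).hom ≫ A.X ◁ A.mul ≫ A.mul) ≫ (ρ_ A.X).inv := by monoidal
      _ = _ := by rw [← A.assoc]; monoidal
  compat := by monoidal

/-- The morphism `φ̂ : A₀₂ (A₀₁ A₁₂) ⟶ A₀₁ A₁₂`. -/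
def hatφ (t : M12Cell A₁₂ A₀₂ A₀₁) : A₀₂.X ⊗ (A₀₁.X ⊗ A₁₂.X) ⟶ A₀₁.X ⊗ A₁₂.X :=
  A₀₂.X ◁ (β_ A₁₂.X A₀₁.X).inv ≫ (α_ _ _ _).inv ≫ t.φ ▷ A₀₁.X ≫ (α_ _ _ _).hom ≫
    A₀₁.X ◁ (β_ A₁₂.X A₀₁.X).hom ≫ (α_ _ _ _).inv ≫ A₀₁.mul ▷ A₁₂.X

/-- The morphism `ψ̂ : (A₀₁ A₁₂) A₀₂ ⟶ A₀₁ A₁₂`. -/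
def hatψ (t : M12Cell A₁₂ A₀₂ A₀₁) : (A₀₁.X ⊗ A₁₂.X) ⊗ A₀₂.X ⟶ A₀₁.X ⊗ A₁₂.X :=
  (β_ A₁₂.X A₀₁.X).inv ▷ A₀₂.X ≫ (α_ _ _ _).hom ≫ A₁₂.X ◁ t.ψ ≫ (α_ _ _ _).inv ≫
    (β_ A₁₂.X A₀₁.X).hom ▷ A₁₂.X ≫ (α_ _ _ _).hom ≫ A₀₁.X ◁ A₁₂.mul

end M12Cell

variable (C) in
/-- The low-dimensional part of the simplicial set `M₁₂`. -/
def M12Data : CoskData.{max u v, v} where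
  Edge := SemigroupIn C
  Cell := M12Cell
  Tet := M12Cell.IsTet
  one := SemigroupIn.unit
  s0 := M12Cell.s0
  s1 := M12Cell.s1
  s0_one := by
    ext
    · simp [M12Cell.s0, M12Cell.s1]
    · simp [M12Cell.s0, M12Cell.s1, unitors_equal]
  tet_s0 {A₁₂ A₀₂ A₀₁} t := by
    constructor
    · have := t.mul_φ
      dsimp only [M12Cell.s0]
      calc
        _ = (A₀₂.mul ▷ A₁₂.X ≫ t.φ) ≫ (λ_ _).inv := by monoidal
        _ = _ := by rw [this]; monoidal
    · dsimp only [M12Cell.s0]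
      rw [midR_id]
      monoidal
    · dsimp only [M12Cell.s0]
      monoidal
  tet_s1 {A₁₂ A₀₂ A₀₁} t := by
    constructor
    · have := t.φ_mul
      dsimp only [M12Cell.s0, M12Cell.s1]
      rw [midL_unit]
      calc
        _ = (t.φ ▷ A₁₂.X ≫ (α_ _ _ _).hom ≫ A₀₁.X ◁ A₁₂.mul) ≫ A₀₁.X ◁ (λ_ _).inv := by monoidal
        _ = _ := by rw [this]; monoidal
    · have := t.mul_ψ
      dsimp only [M12Cell.s0, M12Cell.s1]
      rw [midR_unit]
      calc
        _ = (A₀₁.X ◁ t.ψ ≫ (α_ _ _ _).inv ≫ A₀₁.mul ▷ A₁₂.X) ≫ (ρ_ _).inv ▷ _ := by monoidal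
        _ = _ := by rw [this]; monoidal
    · have := t.compat
      dsimp only [M12Cell.s0, M12Cell.s1]
      calc
        _ = (A₀₁.X ◁ t.φ ≫ (α_ _ _ _).inv ≫ A₀₁.mul ▷ A₁₂.X) ≫ (ρ_ _).inv ▷ _ := by monoidal
        _ = _ := by rw [this]; monoidal
  tet_s2 {A₁₂ A₀₂ A₀₁} t := by
    constructor
    · dsimp only [M12Cell.s1]
      rw [midL_id]
      monoidal
    · have := t.ψ_mul
      dsimp only [M12Cell.s1]
      calc
        _ = (A₀₁.X ◁ A₀₂.mul ≫ t.ψ) ≫ (ρ_ _).inv := by monoidal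
        _ = _ := by rw [this]; monoidal
    · dsimp only [M12Cell.s1]
      monoidal

variable (C) in
/-- The simplicial set `M₁₂`. -/
abbrev M12 : SSet.{max u v} := (M12Data C).sset

/-! ### Multiplier bimonoids -/

variable (C) in
/-- A multiplier bimonoid: a fusion morphism `t₁` in `C` and a fusion morphism `t₂` in the
reversed monoidal category, with a common counit `e` and satisfying two compatibility relations. -/
@[ext]
structure MultiplierBimonoid where
  X : C
  t₁ : X ⊗ X ⟶ X ⊗ X
  t₂ : X ⊗ X ⟶ X ⊗ X
  e : X ⟶ 𝟙_ C
  fusion₁ : t₁ ▷ X ≫ (α_ _ _ _).hom ≫ X ◁ t₁ =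
    (α_ _ _ _).hom ≫ X ◁ t₁ ≫ midL X t₁ ≫ (α_ _ _ _).inv ≫ t₁ ▷ X ≫ (α_ _ _ _).hom
  counit₁ : t₁ ≫ X ◁ e = X ◁ e
  fusion₂ : X ◁ t₂ ≫ (α_ _ _ _).inv ≫ t₂ ▷ X =
    (α_ _ _ _).inv ≫ t₂ ▷ X ≫ midR X t₂ ≫ (α_ _ _ _).hom ≫ X ◁ t₂ ≫ (α_ _ _ _).inv
  counit₂ : t₂ ≫ e ▷ X = e ▷ X
  compat : t₂ ▷ X ≫ (α_ _ _ _).hom ≫ X ◁ t₁ =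
    (α_ _ _ _).hom ≫ X ◁ t₁ ≫ (α_ _ _ _).inv ≫ t₂ ▷ X ≫ (α_ _ _ _).hom
  mul_eq : t₁ ≫ e ▷ X ≫ (λ_ X).hom = t₂ ≫ X ◁ e ≫ (ρ_ X).hom

namespace MultiplierBimonoid

theorem midL_naturality {A B D E E' : C} (e : E ⟶ E') (φ : A ⊗ D ⟶ B ⊗ D) :
    midL E φ ≫ B ◁ e ▷ D = A ◁ e ▷ D ≫ midL E' φ := by
  calc
    _ = (α_ _ _ _).inv ≫ (β_ A E).hom ▷ D ≫ (α_ _ _ _).hom ≫ E ◁ φ ≫ (α_ _ _ _).inv ≫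
        ((β_ B E).inv ≫ B ◁ e) ▷ D ≫ (α_ _ _ _).hom := by simp [midL]
    _ = (α_ _ _ _).inv ≫ (β_ A E).hom ▷ D ≫ (α_ _ _ _).hom ≫ (E ◁ φ ≫ e ▷ (B ⊗ D)) ≫
        (α_ _ _ _).inv ≫ (β_ B E').inv ▷ D ≫ (α_ _ _ _).hom := by
      rw [← braiding_inv_naturality_left]; monoidal
    _ = (α_ _ _ _).inv ≫ ((β_ A E).hom ≫ e ▷ A) ▷ D ≫ (α_ _ _ _).hom ≫ E' ◁ φ ≫
        (α_ _ _ _).inv ≫ (β_ B E').inv ▷ D ≫ (α_ _ _ _).hom := by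
      rw [whisker_exchange]; monoidal
    _ = _ := by rw [← braiding_naturality_right, midL]; monoidal

/-- The semigroup underlying a multiplier bimonoid, with multiplication `m = (e 1) t₁`. -/
def semigroup (B : MultiplierBimonoid C) : SemigroupIn C where
  X := B.X
  mul := B.t₁ ≫ B.e ▷ B.X ≫ (λ_ B.X).hom
  assoc := by
    have h1 : (B.t₁ ≫ B.e ▷ B.X ≫ (λ_ B.X).hom) ▷ B.X ≫ B.t₁ ≫ B.e ▷ B.X ≫ (λ_ B.X).hom =
        (B.t₁ ▷ B.X ≫ (α_ _ _ _).hom ≫ B.X ◁ B.t₁) ≫ B.e ▷ (B.X ⊗ B.X) ≫ (λ_ _).hom ≫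
          B.e ▷ B.X ≫ (λ_ B.X).hom := by
      simp only [Category.assoc]
      rw [whisker_exchange_assoc]
      monoidal
    rw [h1, B.fusion₁]
    calc
      _ = (α_ _ _ _).hom ≫ B.X ◁ B.t₁ ≫ midL B.X B.t₁ ≫ (α_ _ _ _).inv ≫
          B.t₁ ▷ B.X ⊗≫ (B.e ▷ (B.X ⊗ B.X) ≫ 𝟙_ C ◁ B.e ▷ B.X) ⊗≫ 𝟙 _ := by monoidal
      _ = (α_ _ _ _).hom ≫ B.X ◁ B.t₁ ≫ midL B.X B.t₁ ≫ (α_ _ _ _).inv ≫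
          (B.t₁ ≫ B.X ◁ B.e) ▷ B.X ⊗≫ B.e ▷ B.X ⊗≫ 𝟙 _ := by
        rw [← whisker_exchange]; monoidal
      _ = (α_ _ _ _).hom ≫ B.X ◁ B.t₁ ≫ (midL B.X B.t₁ ≫ B.X ◁ B.e ▷ B.X) ⊗≫
          B.e ▷ B.X ⊗≫ 𝟙 _ := by
        rw [B.counit₁]; monoidal
      _ = _ := by
        rw [midL_naturality, midL_unit]; monoidal

/-- The morphism `d₁ = (m 1)(c⁻¹ 1)(1 t₁)(c 1)`. -/
def d₁ (B : MultiplierBimonoid C) : B.X ⊗ (B.X ⊗ B.X) ⟶ B.X ⊗ B.X :=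
  midL B.X B.t₁ ≫ (α_ _ _ _).inv ≫ B.semigroup.mul ▷ B.X

/-- The morphism `d₂ = (1 m)(1 c⁻¹)(t₂ 1)(1 c)`. -/
def d₂ (B : MultiplierBimonoid C) : (B.X ⊗ B.X) ⊗ B.X ⟶ B.X ⊗ B.X :=
  midR B.X B.t₂ ≫ (α_ _ _ _).hom ≫ B.X ◁ B.semigroup.mul

/-- The multiplication is non-degenerate and the structure morphisms `m, e, d₁, d₂` are in `𝒬`. -/
structure InClass (B : MultiplierBimonoid C) (𝒬 : MorphismProperty C) : Prop where
  nonDegenerate : B.semigroup.NonDegenerate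
  mul_mem : 𝒬 B.semigroup.mul
  e_mem : 𝒬 B.e
  d₁_mem : 𝒬 B.d₁
  d₂_mem : 𝒬 B.d₂

/-- The underlying semigroup, as an object of the category `NDSemigroup 𝒬`. -/
def ndSemigroup (B : MultiplierBimonoid C) {𝒬 : MorphismProperty C} (h : B.InClass 𝒬) :
    NDSemigroup 𝒬 where
  toSemigroupIn := B.semigroup
  nonDegenerate := h.nonDegenerate
  mul_mem := h.mul_mem

end MultiplierBimonoid

/-- The simplicial map `f` sends `α` to the semigroup underlying `B`, `τ` to `(t₁ | t₂)`, and `ε`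
to `(e | e)`. -/
structure IsClassifiedBy (f : catalanSSet.{max u v} ⟶ M12 C) (B : MultiplierBimonoid C) : Prop where
  map_α : f.app _ catalanα = CoskData.ofEdge (D := M12Data C) B.semigroup
  map_τ : ∃ t : M12Cell B.semigroup B.semigroup B.semigroup, t.φ = B.t₁ ∧ t.ψ = B.t₂ ∧
    f.app _ catalanτ = CoskData.ofTri (D := M12Data C) ⟨_, _, _, t⟩
  map_ε : ∃ t : M12Cell SemigroupIn.unit B.semigroup SemigroupIn.unit,
    t.φ = (ρ_ B.X).hom ≫ B.e ≫ (λ_ (𝟙_ C)).inv ∧ t.ψ = (λ_ B.X).hom ≫ B.e ≫ (λ_ (𝟙_ C)).inv ∧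
    f.app _ catalanε = CoskData.ofTri (D := M12Data C) ⟨_, _, _, t⟩

section Comonoids

variable {𝒬 : MorphismProperty C} [SuitableClass 𝒬]

/-- The 2-simplex of the nerve of `(NDSemigroup 𝒬)ᵒᵖ` given by a morphism `A₀₂ ⇸ A₀₁ A₁₂`. -/
noncomputable def nerveTri {A₁₂ A₀₂ A₀₁ : NDSemigroup 𝒬} (w : A₀₂ ⟶ A₀₁ ⊗ A₁₂) :
    (monoidalNerveData (NDSemigroup 𝒬)ᵒᵖ).Tri :=
  ⟨op A₁₂, op A₀₂, op A₀₁, w.op⟩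

/-- The simplicial map `f` sends `α` to the object underlying the comonoid `K`, and `τ` and `ε` to
its comultiplication and counit. -/
structure IsClassifiedByComon (f : catalanSSet.{max u v} ⟶ monoidalNerve (NDSemigroup 𝒬)ᵒᵖ)
    (K : Comon (NDSemigroup 𝒬)) : Prop where
  map_α : f.app _ catalanα =
    CoskData.ofEdge (D := monoidalNerveData (NDSemigroup 𝒬)ᵒᵖ) (op K.X)
  map_τ : f.app _ catalanτ = CoskData.ofTri (nerveTri (ComonObj.comul (X := K.X)))
  map_ε : f.app _ catalanε = CoskData.ofTri
    (nerveTri (ComonObj.counit (X := K.X) ≫ (λ_ (𝟙_ (NDSemigroup 𝒬))).inv))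

/-- `s` is the 2-simplex of the nerve given by the morphism with components `φ̂` and `ψ̂`, where
`t = (φ | ψ)` is a 2-simplex of `M₁₂`. -/
def IsHat (t : (M12Data C).Tri) (s : (monoidalNerveData (NDSemigroup 𝒬)ᵒᵖ).Tri) : Prop :=
  ∃ (A₁₂ A₀₂ A₀₁ : NDSemigroup 𝒬)
    (c : M12Cell A₁₂.toSemigroupIn A₀₂.toSemigroupIn A₀₁.toSemigroupIn) (w : A₀₂ ⟶ A₀₁ ⊗ A₁₂),
    t = ⟨_, _, _, c⟩ ∧ s = nerveTri w ∧ w.fst = c.hatφ ∧ w.snd = c.hatψ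

/-- The multiplier bimonoid `B` satisfies `B.InClass 𝒬`, and `K` is the comonoid with underlying
object `(A, m)`, with comultiplication `(d₁, d₂)` and with counit `(e, e)`. -/
def Corresponds (B : MultiplierBimonoid C) (K : Comon (NDSemigroup 𝒬)) : Prop :=
  ∃ (h : B.InClass 𝒬) (s : ComonObj (B.ndSemigroup h)), K = { X := B.ndSemigroup h, comon := s } ∧
    s.comul.fst = B.d₁ ∧ s.comul.snd = B.d₂ ∧
    s.counit.fst = (ρ_ B.X).hom ≫ B.e ∧ s.counit.snd = (λ_ B.X).hom ≫ B.e

end Comonoids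

end Braided

end MultBimon

open CategoryTheory MonoidalCategory MultBimon

/-!
The simplicial sets involved are 3-coskeletal with a single vertex, so a map between them is
determined by its effect on 1- and 2-simplices, and a map out of the Catalan simplicial set amounts
to images of `α`, `τ`, `ε` such that four 3-boundaries have fillers: those with all faces `τ`, those
obtained by putting `ε` on the right or on the left of `τ`, and one involving only `ε`
(`CatalanMap.equiv`). Spelled out in the nerve of an opposite monoidal category, the four conditions
are coassociativity, the two counit laws, and a tautology (`comonEquiv`). Spelled out in `M₁₂`, they
are the axioms of a multiplier bimonoid, and the equations that make `(t₁ | t₂)` and `(e | e)`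
2-simplices follow from these axioms (`CatalanMap.multiplierBimonoidEquiv`).

The map from `Q` to the nerve rests on one construction. A morphism `φ : A D ⟶ B D` carries an
action `ρ : B M ⟶ M` to `act φ ρ : A (M D) ⟶ M D`, where the strand `M` passes under `φ`. If `φ` is
compatible with the multiplications of `A` and `B`, this is again an action (`mul_act`). For a
2-simplex `(φ | ψ)` of `M₁₂`, the morphism `φ̂` is the transport of the multiplication of `A₀₁`, so
it is an action of `A₀₂` on `A₀₁ A₁₂`. Together with the compatibility `hat_compat` of `φ̂` and `ψ̂`
this gives a morphism `A₀₂ ⇸ A₀₁ A₁₂`. Transport is functorial in two ways: `act φ ρ` is the first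
component of a composite (`tensorμ_comp_act`), and the fusion equation of a 3-simplex lets one
replace a transport along `φ₀₁₃` and `φ₁₂₃` by one along `φ₀₂₃` and `φ₀₁₂`
(`tensorμ_comp_act_act`). Since a morphism of `NDSemigroup 𝒬` is determined by its first component,
3-simplices of `M₁₂` go to 3-simplices of the nerve (`M12Cell.IsTet.comp_hat`). Injectivity holds
because non-degeneracy allows the multiplications in `φ̂` and `ψ̂` to be cancelled.

Finally, a map from the Catalan simplicial set to `M₁₂` lands in `Q` if and only if its values at
`α`, `τ` and `ε` do, and `φ̂`, `ψ̂` for `(t₁ | t₂)` are `d₁`, `d₂`, whereas for `(e | e)` they agree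
with `e` up to unit isomorphisms. The correspondence between multiplier bimonoids and comonoids is
then composition with the two maps out of `Q`, and it is injective because the map to the nerve is.
-/

namespace MultBimon

universe w w'

/-! ### Simplices and maps in terms of edges and triangles -/

namespace CoskData

variable {D : CoskData.{w, w'}}

theorem isTet_mk_iff {a₀₁ a₀₂ a₀₃ a₁₂ a₁₃ a₂₃ : D.Edge} {t₁₂₃ : D.Cell a₂₃ a₁₃ a₁₂}
    {t₀₂₃ : D.Cell a₂₃ a₀₃ a₀₂} {t₀₁₃ : D.Cell a₁₃ a₀₃ a₀₁} {t₀₁₂ : D.Cell a₁₂ a₀₂ a₀₁} :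
    IsTet ⟨_, _, _, t₁₂₃⟩ ⟨_, _, _, t₀₂₃⟩ ⟨_, _, _, t₀₁₃⟩ ⟨_, _, _, t₀₁₂⟩ ↔
      D.Tet t₁₂₃ t₀₂₃ t₀₁₃ t₀₁₂ :=
  ⟨fun h => by cases h; assumption, IsTet.mk _ _ _ _⟩

theorem simplex_ext {n : ℕ} {x y : D.Simplex n} (he : ∀ i j h, x.edge i j h = y.edge i j h)
    (ht : ∀ i j k h h', x.tri i j k h h' = y.tri i j k h h') : x = y :=
  Simplex.ext (by funext i j h; exact he i j h) (by funext i j k h h'; exact ht i j k h h')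

theorem eq_of_lt {i j : Fin 2} (h : i < j) : i = 0 ∧ j = 1 := by
  omega

theorem eq_of_lt_lt {i j k : Fin 3} (hij : i < j) (hjk : j < k) : i = 0 ∧ j = 1 ∧ k = 2 := by
  omega

theorem eq_of_lt_lt_lt {i j k l : Fin 4} (hij : i < j) (hjk : j < k) (hkl : k < l) :
    i = 0 ∧ j = 1 ∧ k = 2 ∧ l = 3 := by
  omega

theorem eq_ofTri (x : D.Simplex 2) : x = fam (ofTri (x.tri 0 1 2 (by decide) (by decide))) := by
  have he : ∀ i j h, x.edge i j h =
      edge₂ (x.tri 0 1 2 (by decide) (by decide)) i j := by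
    intro i j h
    rcases h.eq_or_lt with rfl | h'
    · rw [edge₂_refl, x.edge_refl]
    fin_cases i <;> fin_cases j <;> first | (exfalso; revert h'; decide) | skip
    · exact (x.tri_d2 0 1 2 (by decide) (by decide)).symm
    · exact (x.tri_d1 0 1 2 (by decide) (by decide)).symm
    · exact (x.tri_d0 0 1 2 (by decide) (by decide)).symm
  refine simplex_ext he fun i j k h h' => ?_
  change _ = tri₂ _ i j k
  rcases h.eq_or_lt with rfl | hij
  · rw [tri₂_left, x.tri_left, he]
  rcases h'.eq_or_lt with rfl | hjk
  · rw [tri₂_right, x.tri_right, he]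
  obtain ⟨rfl, rfl, rfl⟩ := eq_of_lt_lt hij hjk
  rfl

theorem eq_ofEdge (x : D.Simplex 1) : x = fam (ofEdge (x.edge 0 1 (by decide))) := by
  have he : ∀ i j h, x.edge i j h = (fam (ofEdge (x.edge 0 1 (by decide)))).edge i j h := by
    intro i j h
    rcases h.eq_or_lt with rfl | h'
    · rw [x.edge_refl, Simplex.edge_refl]
    obtain ⟨rfl, rfl⟩ := eq_of_lt h'
    rfl
  refine simplex_ext he fun i j k h h' => ?_
  rcases h.eq_or_lt with rfl | hij
  · rw [x.tri_left, Simplex.tri_left, he]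
  rcases h'.eq_or_lt with rfl | hjk
  · rw [x.tri_right, Simplex.tri_right, he]
  obtain ⟨rfl, rfl⟩ := eq_of_lt hij
  obtain ⟨h0, -⟩ := eq_of_lt hjk
  exact absurd h0 (by decide)

/-- The order-preserving map `[1] → [n]` with values `i ≤ j`. -/
def edgeMap {n : ℕ} (i j : Fin (n + 1)) (h : i ≤ j) : Fin 2 →o Fin (n + 1) where
  toFun p := if p = 0 then i else j
  monotone' p q hpq := by
    fin_cases p <;> fin_cases q <;> simp_all

/-- The order-preserving map `[2] → [n]` with values `i ≤ j ≤ k`. -/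
def triMap {n : ℕ} (i j k : Fin (n + 1)) (h : i ≤ j) (h' : j ≤ k) : Fin 3 →o Fin (n + 1) where
  toFun p := if p = 0 then i else if p = 1 then j else k
  monotone' p q hpq := by
    have := h.trans h'
    fin_cases p <;> fin_cases q <;> simp_all

theorem comap_edgeMap {n : ℕ} (x : D.Simplex n) (i j : Fin (n + 1)) (h : i ≤ j) :
    x.comap (edgeMap i j h) = fam (ofEdge (x.edge i j h)) := eq_ofEdge _

theorem comap_triMap {n : ℕ} (x : D.Simplex n) (i j k : Fin (n + 1)) (h : i ≤ j) (h' : j ≤ k) :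
    x.comap (triMap i j k h h') = fam (ofTri (x.tri i j k h h')) := eq_ofTri _

section Maps

variable {D : CoskData.{max w w', max w w'}} {E : CoskData.{w, w'}}

/-- The action of a simplicial map on 1-simplices. The source is in a single universe, so that both
simplicial sets live in the same one. -/
def onEdge (f : D.sset ⟶ E.sset) (a : D.Edge) : E.Edge := toEdge (f.app _ (ofEdge a))

/-- The action of a simplicial map on 2-simplices. -/
def onTri (f : D.sset ⟶ E.sset) (t : D.Tri) : E.Tri := toTri (f.app _ (ofTri t))

theorem app_comap (f : D.sset ⟶ E.sset) {m n : ℕ} (g : Fin (m + 1) →o Fin (n + 1))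
    (x : D.Simplex n) : fam (n := m) (f.app (op (.mk m)) (x.comap g)) =
      (fam (n := n) (f.app (op (.mk n)) x)).comap g :=
  ConcreteCategory.congr_hom (f.naturality (SimplexCategory.mkHom g).op) x

theorem app_edge (f : D.sset ⟶ E.sset) {n : ℕ} (x : D.Simplex n) (i j : Fin (n + 1)) (h : i ≤ j) :
    (fam (n := n) (f.app (op (.mk n)) x)).edge i j h = onEdge f (x.edge i j h) := by
  have := app_comap f (edgeMap i j h) x
  rw [comap_edgeMap] at this
  exact (congrArg (fun y : E.Simplex 1 => y.edge 0 1 (by decide)) this).symm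

theorem app_tri (f : D.sset ⟶ E.sset) {n : ℕ} (x : D.Simplex n) (i j k : Fin (n + 1)) (h : i ≤ j)
    (h' : j ≤ k) :
    (fam (n := n) (f.app (op (.mk n)) x)).tri i j k h h' = onTri f (x.tri i j k h h') := by
  have := app_comap f (triMap i j k h h') x
  rw [comap_triMap] at this
  exact (congrArg (fun y : E.Simplex 2 => y.tri 0 1 2 (by decide) (by decide)) this).symm

theorem map_ext {f g : D.sset ⟶ E.sset} (he : ∀ a, onEdge f a = onEdge g a)
    (ht : ∀ t, onTri f t = onTri g t) : f = g := by
  ext ⟨n⟩ x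
  obtain ⟨n⟩ := n
  refine simplex_ext (n := n) (x := f.app (op (.mk n)) x) (fun i j h => ?_) fun i j k h h' => ?_
  · exact (app_edge f x i j h).trans ((he _).trans (app_edge g x i j h).symm)
  · exact (app_tri f x i j k h h').trans ((ht _).trans (app_tri g x i j k h h').symm)

theorem onTri_d0 (f : D.sset ⟶ E.sset) (t : D.Tri) : (onTri f t).d0 = onEdge f t.d0 :=
  (Simplex.tri_d0 _ _ _ _ _ _).trans (app_edge f (ofTri t) 1 2 (by decide))

theorem onTri_d1 (f : D.sset ⟶ E.sset) (t : D.Tri) : (onTri f t).d1 = onEdge f t.d1 :=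
  (Simplex.tri_d1 _ _ _ _ _ _).trans (app_edge f (ofTri t) 0 2 (by decide))

theorem onTri_d2 (f : D.sset ⟶ E.sset) (t : D.Tri) : (onTri f t).d2 = onEdge f t.d2 :=
  (Simplex.tri_d2 _ _ _ _ _ _).trans (app_edge f (ofTri t) 0 1 (by decide))

theorem onEdge_one (f : D.sset ⟶ E.sset) : onEdge f D.one = E.one :=
  (app_edge f (ofTri (D.s0Tri D.one)) 0 0 le_rfl).symm.trans (Simplex.edge_refl _ _)

theorem onTri_s0Tri (f : D.sset ⟶ E.sset) (a : D.Edge) :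
    onTri f (D.s0Tri a) = E.s0Tri (onEdge f a) := by
  have h := Simplex.tri_left (fam (n := 2) (f.app _ (ofTri (D.s0Tri a)))) 0 2 (by decide)
  rw [app_edge f (ofTri (D.s0Tri a)) 0 2, app_tri f (ofTri (D.s0Tri a)) 0 0 2] at h
  exact h

theorem onTri_s1Tri (f : D.sset ⟶ E.sset) (a : D.Edge) :
    onTri f (D.s1Tri a) = E.s1Tri (onEdge f a) := by
  have h := Simplex.tri_right (fam (n := 2) (f.app _ (ofTri (D.s1Tri a)))) 0 2 (by decide)
  rw [app_edge f (ofTri (D.s1Tri a)) 0 2, app_tri f (ofTri (D.s1Tri a)) 0 2 2] at h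
  exact h

end Maps

/-! ### 3-simplices from their boundaries -/

/-- The edge `i ≤ j` of the 3-simplex with boundary `(t₁₂₃, t₀₂₃, t₀₁₃, t₀₁₂)`. -/
def edge₃ (t₁₂₃ t₀₁₃ t₀₁₂ : D.Tri) (i j : Fin 4) : D.Edge :=
  if i = j then D.one
  else if i = 0 then if j = 1 then t₀₁₂.d2 else if j = 2 then t₀₁₂.d1 else t₀₁₃.d1
  else if i = 1 then if j = 2 then t₁₂₃.d2 else t₁₂₃.d1 else t₁₂₃.d0

/-- The triangle `i ≤ j ≤ k` of the 3-simplex with boundary `(t₁₂₃, t₀₂₃, t₀₁₃, t₀₁₂)`. -/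
def tri₃ (t₁₂₃ t₀₂₃ t₀₁₃ t₀₁₂ : D.Tri) (i j k : Fin 4) : D.Tri :=
  if i = j then D.s0Tri (edge₃ t₁₂₃ t₀₁₃ t₀₁₂ i k)
  else if j = k then D.s1Tri (edge₃ t₁₂₃ t₀₁₃ t₀₁₂ i j)
  else if i = 1 then t₁₂₃ else if j = 2 then t₀₂₃ else if k = 3 then t₀₁₃ else t₀₁₂

section

variable {t₁₂₃ t₀₂₃ t₀₁₃ t₀₁₂ : D.Tri}

theorem edge₃_refl (i : Fin 4) : edge₃ t₁₂₃ t₀₁₃ t₀₁₂ i i = D.one := if_pos rfl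

theorem tri₃_left (i k : Fin 4) :
    tri₃ t₁₂₃ t₀₂₃ t₀₁₃ t₀₁₂ i i k = D.s0Tri (edge₃ t₁₂₃ t₀₁₃ t₀₁₂ i k) := if_pos rfl

theorem tri₃_right (i k : Fin 4) :
    tri₃ t₁₂₃ t₀₂₃ t₀₁₃ t₀₁₂ i k k = D.s1Tri (edge₃ t₁₂₃ t₀₁₃ t₀₁₂ i k) := by
  by_cases h : i = k
  · subst h
    rw [tri₃_left, edge₃_refl, s0Tri, s1Tri, D.s0_one]
  · rw [tri₃, if_neg h, if_pos rfl]

theorem tri₃_faces (ht : IsTet t₁₂₃ t₀₂₃ t₀₁₃ t₀₁₂) (i j k : Fin 4) (hij : i ≤ j) (hjk : j ≤ k) :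
    (tri₃ t₁₂₃ t₀₂₃ t₀₁₃ t₀₁₂ i j k).d0 = edge₃ t₁₂₃ t₀₁₃ t₀₁₂ j k ∧
    (tri₃ t₁₂₃ t₀₂₃ t₀₁₃ t₀₁₂ i j k).d1 = edge₃ t₁₂₃ t₀₁₃ t₀₁₂ i k ∧
    (tri₃ t₁₂₃ t₀₂₃ t₀₁₃ t₀₁₂ i j k).d2 = edge₃ t₁₂₃ t₀₁₃ t₀₁₂ i j := by
  rcases hij.eq_or_lt with rfl | hij'
  · rw [tri₃_left, edge₃_refl]
    exact ⟨rfl, rfl, rfl⟩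
  rcases hjk.eq_or_lt with rfl | hjk'
  · rw [tri₃_right, edge₃_refl]
    exact ⟨rfl, rfl, rfl⟩
  cases ht
  fin_cases i <;> fin_cases j <;> first | (exfalso; revert hij'; decide) | skip
  all_goals fin_cases k <;> first | (exfalso; revert hjk'; decide) | exact ⟨rfl, rfl, rfl⟩

/-- The 3-simplex of `D.sset` with a given boundary. -/
def ofTet (ht : IsTet t₁₂₃ t₀₂₃ t₀₁₃ t₀₁₂) : D.Simplex 3 where
  edge i j _ := edge₃ t₁₂₃ t₀₁₃ t₀₁₂ i j
  tri i j k _ _ := tri₃ t₁₂₃ t₀₂₃ t₀₁₃ t₀₁₂ i j k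
  tri_d0 i j k hij hjk := (tri₃_faces ht i j k hij hjk).1
  tri_d1 i j k hij hjk := (tri₃_faces ht i j k hij hjk).2.1
  tri_d2 i j k hij hjk := (tri₃_faces ht i j k hij hjk).2.2
  edge_refl i := edge₃_refl i
  tri_left i k _ := tri₃_left i k
  tri_right i k _ := tri₃_right i k
  tet i j k l hij hjk hkl := by
    rcases hij.eq_or_lt with rfl | hij'
    · obtain ⟨_, h1, h2⟩ := tri₃_faces ht i k l hjk hkl
      rw [tri₃_left i k, tri₃_left i l, ← h1, ← h2]
      exact isTet_s0 _
    rcases hjk.eq_or_lt with rfl | hjk'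
    · obtain ⟨h0, _, h2⟩ := tri₃_faces ht i j l hij hkl
      rw [tri₃_left j l, tri₃_right i j, ← h0, ← h2]
      exact isTet_s1 _
    rcases hkl.eq_or_lt with rfl | hkl'
    · obtain ⟨h0, h1, _⟩ := tri₃_faces ht i j k hij hjk
      rw [tri₃_right j k, tri₃_right i k, ← h0, ← h1]
      exact isTet_s2 _
    obtain ⟨rfl, rfl, rfl, rfl⟩ := eq_of_lt_lt_lt hij' hjk' hkl'
    exact ht

/-- Simplicial maps preserve fillability of 3-boundaries, because a filler is itself a simplex. -/
theorem isTet_onTri {D : CoskData.{max w w', max w w'}} {E : CoskData.{w, w'}}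
    {t₁₂₃ t₀₂₃ t₀₁₃ t₀₁₂ : D.Tri} (f : D.sset ⟶ E.sset) (ht : IsTet t₁₂₃ t₀₂₃ t₀₁₃ t₀₁₂) :
    IsTet (onTri f t₁₂₃) (onTri f t₀₂₃) (onTri f t₀₁₃) (onTri f t₀₁₂) := by
  have h := Simplex.tet (fam (n := 3) (f.app (op (.mk 3)) (ofTet ht))) 0 1 2 3 (by decide)
    (by decide) (by decide)
  simp only [app_tri f (ofTet ht)] at h
  exact h

end

end CoskData

/-! ### Maps out of the Catalan simplicial set -/

/-- The data classified by simplicial maps from the Catalan simplicial set: the images `a`, `τ`,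
`ε` of its non-degenerate generators, subject to the existence of fillers for the images of the four
boundaries of non-degenerate 3-simplices. -/
structure CatalanMap (D : CoskData.{w, w'}) where
  a : D.Edge
  τ : D.Cell a a a
  ε : D.Cell D.one a D.one
  tet_assoc : D.Tet τ τ τ τ
  tet_right : D.Tet ε (D.s1 a) τ (D.s1 a)
  tet_left : D.Tet (D.s0 a) τ (D.s0 a) ε
  tet_counit : D.Tet ε (D.s1 a) (D.s0 a) ε

namespace CatalanMap

open CoskData

variable {D : CoskData.{w, w'}}

/-- Extensionality, with the equalities between 2-simplices stated for bundled ones. -/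
theorem ext_tri {x y : CatalanMap D} (ha : x.a = y.a)
    (hτ : (⟨_, _, _, x.τ⟩ : D.Tri) = ⟨_, _, _, y.τ⟩)
    (hε : (⟨_, _, _, x.ε⟩ : D.Tri) = ⟨_, _, _, y.ε⟩) : x = y := by
  obtain ⟨a, τ, ε, h1, h2, h3, h4⟩ := x
  obtain ⟨b, τ', ε', h1', h2', h3', h4'⟩ := y
  obtain rfl : a = b := ha
  simp only [Tri.mk.injEq, heq_eq_eq, true_and] at hτ hε
  subst hτ hε
  rfl

/-- The images of the 1-simplices. -/
def mapEdge (x : CatalanMap D) : CatalanEdge.{max w w'} → D.Edge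
  | .one => D.one
  | .alpha => x.a

/-- The images of the 2-simplices. -/
def mapCell (x : CatalanMap D) : {p q r : CatalanEdge.{max w w'}} → CatalanCell p q r →
    D.Cell (x.mapEdge p) (x.mapEdge q) (x.mapEdge r)
  | _, _, _, .s0s0 => D.s0 D.one
  | _, _, _, .s0alpha => D.s0 x.a
  | _, _, _, .s1alpha => D.s1 x.a
  | _, _, _, .tau => x.τ
  | _, _, _, .eps => x.ε

/-- The images of the bundled 2-simplices. -/
def mapTri (x : CatalanMap D) (t : catalanData.{max w w'}.Tri) : D.Tri :=
  ⟨_, _, _, x.mapCell t.cell⟩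

/-- The 3-boundaries of the Catalan simplicial set other than the four in the definition of
`CatalanMap` are boundaries of degenerate simplices. -/
theorem tet_mapCell (x : CatalanMap D) {a₀₁ a₀₂ a₀₃ a₁₂ a₁₃ a₂₃ : CatalanEdge.{max w w'}}
    (t₁₂₃ : CatalanCell a₂₃ a₁₃ a₁₂) (t₀₂₃ : CatalanCell a₂₃ a₀₃ a₀₂)
    (t₀₁₃ : CatalanCell a₁₃ a₀₃ a₀₁) (t₀₁₂ : CatalanCell a₁₂ a₀₂ a₀₁) :
    D.Tet (x.mapCell t₁₂₃) (x.mapCell t₀₂₃) (x.mapCell t₀₁₃) (x.mapCell t₀₁₂) := by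
  cases t₁₂₃ <;> cases t₀₁₂ <;> cases t₀₂₃ <;> cases t₀₁₃
  all_goals
    simp only [mapCell]
    first
    | exact x.tet_assoc | exact x.tet_right | exact x.tet_left | exact x.tet_counit
    | exact D.tet_s0 _ | exact D.tet_s1 _ | exact D.tet_s2 _
    | (rw [D.s0_one]; exact D.tet_s2 _)
    | (have := D.tet_s2 x.ε; rwa [← D.s0_one] at this)
    | (have := D.tet_s1 x.ε; rwa [← D.s0_one] at this)

theorem isTet_mapTri (x : CatalanMap D) {t₁₂₃ t₀₂₃ t₀₁₃ t₀₁₂ : catalanData.{max w w'}.Tri}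
    (h : IsTet t₁₂₃ t₀₂₃ t₀₁₃ t₀₁₂) :
    IsTet (x.mapTri t₁₂₃) (x.mapTri t₀₂₃) (x.mapTri t₀₁₃) (x.mapTri t₀₁₂) := by
  cases h
  exact IsTet.mk _ _ _ _ (x.tet_mapCell _ _ _ _)

theorem mapTri_s0Tri (x : CatalanMap D) (p : CatalanEdge.{max w w'}) :
    x.mapTri (catalanData.s0Tri p) = D.s0Tri (x.mapEdge p) := by
  cases p <;> rfl

theorem mapTri_s1Tri (x : CatalanMap D) (p : CatalanEdge.{max w w'}) :
    x.mapTri (catalanData.s1Tri p) = D.s1Tri (x.mapEdge p) := by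
  cases p
  · exact congrArg (Tri.mk _ _ _) D.s0_one
  · rfl

/-- The simplicial map classifying a `CatalanMap`. -/
def toMap (x : CatalanMap D) : catalanSSet.{max w w'} ⟶ D.sset where
  app _ := ↾fun y =>
    show D.Simplex _ from
    { edge := fun i j h => x.mapEdge (Simplex.edge y i j h)
      tri := fun i j k h h' => x.mapTri (Simplex.tri y i j k h h')
      tri_d0 := fun i j k h h' => congrArg x.mapEdge (Simplex.tri_d0 y i j k h h')
      tri_d1 := fun i j k h h' => congrArg x.mapEdge (Simplex.tri_d1 y i j k h h')
      tri_d2 := fun i j k h h' => congrArg x.mapEdge (Simplex.tri_d2 y i j k h h')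
      edge_refl := fun i => congrArg x.mapEdge (Simplex.edge_refl y i)
      tri_left := fun i k h =>
        (congrArg x.mapTri (Simplex.tri_left y i k h)).trans (x.mapTri_s0Tri _)
      tri_right := fun i k h =>
        (congrArg x.mapTri (Simplex.tri_right y i k h)).trans (x.mapTri_s1Tri _)
      tet := fun i j k l hij hjk hkl => x.isTet_mapTri (Simplex.tet y i j k l hij hjk hkl) }
  naturality _ _ _ := rfl

theorem toMap_injective : Function.Injective (toMap (D := D)) := by
  intro x y h
  exact ext_tri (congrArg (fun f : catalanSSet ⟶ D.sset => onEdge f CatalanEdge.alpha) h)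
    (congrArg (fun f : catalanSSet ⟶ D.sset => onTri f ⟨_, _, _, CatalanCell.tau⟩) h)
    (congrArg (fun f : catalanSSet ⟶ D.sset => onTri f ⟨_, _, _, CatalanCell.eps⟩) h)

/-- A bundled 2-simplex with known faces, as a cell with these faces. -/
theorem exists_cell {t : D.Tri} {a b c : D.Edge} (h0 : t.d0 = a) (h1 : t.d1 = b) (h2 : t.d2 = c) :
    ∃ s : D.Cell a b c, t = ⟨_, _, _, s⟩ := by
  subst h0 h1 h2
  exact ⟨t.cell, rfl⟩

theorem toMap_surjective : Function.Surjective (toMap (D := D)) := by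
  intro f
  have h1 : onEdge f CatalanEdge.one = D.one := onEdge_one f
  obtain ⟨a, ha⟩ : ∃ a, onEdge f CatalanEdge.alpha = a := ⟨_, rfl⟩
  obtain ⟨τ, hτ⟩ := exists_cell (t := onTri f ⟨_, _, _, CatalanCell.tau⟩)
    ((onTri_d0 f _).trans ha) ((onTri_d1 f _).trans ha) ((onTri_d2 f _).trans ha)
  obtain ⟨ε, hε⟩ := exists_cell (t := onTri f ⟨_, _, _, CatalanCell.eps⟩)
    ((onTri_d0 f _).trans h1) ((onTri_d1 f _).trans ha) ((onTri_d2 f _).trans h1)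
  have hs0 : onTri f ⟨_, _, _, CatalanCell.s0alpha⟩ = D.s0Tri a :=
    (onTri_s0Tri f CatalanEdge.alpha).trans (by rw [ha])
  have hs1 : onTri f ⟨_, _, _, CatalanCell.s1alpha⟩ = D.s1Tri a :=
    (onTri_s1Tri f CatalanEdge.alpha).trans (by rw [ha])
  have hs : onTri f ⟨_, _, _, CatalanCell.s0s0⟩ = D.s0Tri D.one :=
    (onTri_s0Tri f CatalanEdge.one).trans (by rw [h1])
  have tet {a₀₁ a₀₂ a₀₃ a₁₂ a₁₃ a₂₃ : CatalanEdge.{max w w'}}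
    (t₁₂₃ : CatalanCell a₂₃ a₁₃ a₁₂) (t₀₂₃ : CatalanCell a₂₃ a₀₃ a₀₂)
    (t₀₁₃ : CatalanCell a₁₃ a₀₃ a₀₁) (t₀₁₂ : CatalanCell a₁₂ a₀₂ a₀₁) :=
    isTet_onTri f (IsTet.mk (D := catalanData) t₁₂₃ t₀₂₃ t₀₁₃ t₀₁₂ trivial)
  let x : CatalanMap D :=
    { a := a
      τ := τ
      ε := ε
      tet_assoc := by
        have := tet .tau .tau .tau .tau
        rw [hτ] at this
        exact isTet_mk_iff.mp this
      tet_right := by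
        have := tet .eps .s1alpha .tau .s1alpha
        rw [hτ, hs1, hε] at this
        exact isTet_mk_iff.mp this
      tet_left := by
        have := tet .s0alpha .tau .s0alpha .eps
        rw [hτ, hs0, hε] at this
        exact isTet_mk_iff.mp this
      tet_counit := by
        have := tet .eps .s1alpha .s0alpha .eps
        rw [hs1, hs0, hε] at this
        exact isTet_mk_iff.mp this }
  refine ⟨x, map_ext (fun p => ?_) fun ⟨p, q, r, t⟩ => ?_⟩
  · cases p
    · exact h1.symm
    · exact ha.symm
  · cases t
    · exact hs.symm
    · exact hs0.symm
    · exact hs1.symm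
    · exact hτ.symm
    · exact hε.symm

variable (D) in
/-- Simplicial maps out of the Catalan simplicial set, in terms of generators. -/
noncomputable def equiv : CatalanMap D ≃ (catalanSSet.{max w w'} ⟶ D.sset) :=
  Equiv.ofBijective toMap ⟨toMap_injective, toMap_surjective⟩

theorem ofTri_toTri (x : Simplices D.sset 2) : ofTri (toTri x) = x := (eq_ofTri (fam x)).symm

theorem ofEdge_toEdge (x : Simplices D.sset 1) : ofEdge (toEdge x) = x := (eq_ofEdge (fam x)).symm

theorem toMap_α (x : CatalanMap D) : x.toMap.app _ catalanα = ofEdge x.a :=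
  (ofEdge_toEdge _).symm

theorem toMap_τ (x : CatalanMap D) : x.toMap.app _ catalanτ = ofTri ⟨_, _, _, x.τ⟩ :=
  (ofTri_toTri _).symm

theorem toMap_ε (x : CatalanMap D) : x.toMap.app _ catalanε = ofTri ⟨_, _, _, x.ε⟩ :=
  (ofTri_toTri _).symm

end CatalanMap

/-! ### Comonoids as maps from the Catalan simplicial set -/

section Comonoids

variable {D : Type u} [Category.{v} D] [MonoidalCategory D]

/-- The data of a map from the Catalan simplicial set to the nerve of `Dᵒᵖ` given by a comonoid in
`D`. The fillers `tet_assoc`, `tet_right` and `tet_left` express coassociativity and the two counit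
laws, while `tet_counit` holds for any morphism `K.X ⟶ 𝟙_ D`. -/
def CatalanMap.ofComon (K : Comon D) : CatalanMap (monoidalNerveData Dᵒᵖ) where
  a := op K.X
  τ := (ComonObj.comul (X := K.X)).op
  ε := (ComonObj.counit (X := K.X) ≫ (λ_ (𝟙_ D)).inv).op
  tet_assoc := by
    apply Quiver.Hom.unop_inj
    change ComonObj.comul ≫ ComonObj.comul ▷ K.X =
      (ComonObj.comul ≫ K.X ◁ ComonObj.comul) ≫ (α_ _ _ _).inv
    simp
  tet_right := by
    apply Quiver.Hom.unop_inj
    change (ρ_ K.X).inv ≫ (ρ_ K.X).inv ▷ _ = (ComonObj.comul ≫ K.X ◁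
      (ComonObj.counit ≫ (λ_ (𝟙_ D)).inv)) ≫ (α_ _ _ _).inv
    rw [whiskerLeft_comp, ComonObj.comul_counit_assoc]
    monoidal
  tet_left := by
    apply Quiver.Hom.unop_inj
    change ComonObj.comul ≫ (ComonObj.counit ≫ (λ_ (𝟙_ D)).inv) ▷ K.X =
      ((λ_ K.X).inv ≫ _ ◁ (λ_ K.X).inv) ≫ (α_ _ _ _).inv
    rw [comp_whiskerRight, ComonObj.counit_comul_assoc]
    monoidal
  tet_counit := by
    apply Quiver.Hom.unop_inj
    change (ρ_ K.X).inv ≫ (ComonObj.counit ≫ (λ_ (𝟙_ D)).inv) ▷ _ =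
      ((λ_ K.X).inv ≫ _ ◁ (ComonObj.counit ≫ (λ_ (𝟙_ D)).inv)) ≫ (α_ _ _ _).inv
    rw [comp_whiskerRight, whiskerLeft_comp, ← rightUnitor_inv_naturality_assoc, Category.assoc,
      Category.assoc, ← leftUnitor_inv_naturality_assoc]
    monoidal

theorem CatalanMap.ofComon_injective : Function.Injective (ofComon (D := D)) := by
  rintro @⟨X, ⟨e, d, h1, h2, h3⟩⟩ @⟨X', ⟨e', d', h1', h2', h3'⟩⟩ h
  obtain ⟨h, hd, he⟩ := CatalanMap.mk.inj h
  obtain rfl : X = X' := congrArg unop h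
  obtain rfl : d = d' := Quiver.Hom.op_inj (eq_of_heq hd)
  obtain rfl : e = e' := by
    have := Quiver.Hom.op_inj (eq_of_heq he)
    exact (cancel_mono _).mp this
  rfl

theorem CatalanMap.ofComon_surjective : Function.Surjective (ofComon (D := D)) := by
  rintro ⟨⟨X⟩, d, e, h1, h2, h3, h4⟩
  obtain ⟨d, rfl⟩ : ∃ d' : X ⟶ X ⊗ X, d = d'.op := ⟨d.unop, rfl⟩
  obtain ⟨e, rfl⟩ : ∃ e' : X ⟶ 𝟙_ D ⊗ 𝟙_ D, e = e'.op := ⟨e.unop, rfl⟩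
  replace h1 : d ≫ d ▷ X = (d ≫ X ◁ d) ≫ (α_ _ _ _).inv := congrArg Quiver.Hom.unop h1
  replace h2 : (ρ_ X).inv ≫ (ρ_ X).inv ▷ _ = (d ≫ X ◁ e) ≫ (α_ _ _ _).inv :=
    congrArg Quiver.Hom.unop h2
  replace h3 : d ≫ e ▷ X = ((λ_ X).inv ≫ _ ◁ (λ_ X).inv) ≫ (α_ _ _ _).inv :=
    congrArg Quiver.Hom.unop h3
  let K : Comon D :=
    { X := X
      comon :=
        { counit := e ≫ (λ_ (𝟙_ D)).hom
          comul := d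
          counit_comul := by
            rw [comp_whiskerRight, reassoc_of% h3]
            monoidal
          comul_counit := by
            have e' : d ≫ X ◁ e = (ρ_ X).inv ≫ (ρ_ X).inv ▷ _ ≫ (α_ _ _ _).hom := by
              rw [reassoc_of% h2]
              simp
            rw [whiskerLeft_comp, reassoc_of% e']
            monoidal
          comul_assoc := by
            rw [reassoc_of% h1]
            simp } }
  refine ⟨K, ?_⟩
  refine ext_tri rfl rfl (congrArg (CoskData.Tri.mk _ _ _) (congrArg Quiver.Hom.op ?_))
  change (e ≫ (λ_ (𝟙_ D)).hom) ≫ (λ_ (𝟙_ D)).inv = e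
  simp

variable (D) in
/-- Maps from the Catalan simplicial set to the nerve of `Dᵒᵖ` are comonoids in `D`. -/
noncomputable def comonEquiv : (catalanSSet.{max u v} ⟶ monoidalNerve Dᵒᵖ) ≃ Comon D :=
  ((Equiv.ofBijective CatalanMap.ofComon
    ⟨CatalanMap.ofComon_injective, CatalanMap.ofComon_surjective⟩).trans
      (CatalanMap.equiv (monoidalNerveData Dᵒᵖ))).symm

end Comonoids

section Unitors

variable {C : Type u} [Category.{v} C] [MonoidalCategory C]

theorem exists_eq_rightUnitor {X : C} (f : X ⊗ 𝟙_ C ⟶ 𝟙_ C ⊗ 𝟙_ C) :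
    ∃ e : X ⟶ 𝟙_ C, f = (ρ_ X).hom ≫ e ≫ (λ_ (𝟙_ C)).inv :=
  ⟨(ρ_ X).inv ≫ f ≫ (λ_ (𝟙_ C)).hom, by simp⟩

theorem exists_eq_leftUnitor {X : C} (f : 𝟙_ C ⊗ X ⟶ 𝟙_ C ⊗ 𝟙_ C) :
    ∃ e : X ⟶ 𝟙_ C, f = (λ_ X).hom ≫ e ≫ (λ_ (𝟙_ C)).inv :=
  ⟨(λ_ X).inv ≫ f ≫ (λ_ (𝟙_ C)).hom, by simp⟩

end Unitors

section Braided

variable {C : Type u} [Category.{v} C] [MonoidalCategory C] [BraidedCategory C]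

/-! ### Passing a strand under a morphism -/

/-- The strand `E` may be taken around `φ` on the right instead of on the left. -/
theorem midL_eq (E : C) {A B D : C} (φ : A ⊗ D ⟶ B ⊗ D) :
    midL E φ = A ◁ (β_ D E).inv ≫ (α_ _ _ _).inv ≫ φ ▷ E ≫ (α_ _ _ _).hom ≫ B ◁ (β_ D E).hom := by
  have h := braiding_naturality_left φ E
  have e (A : C) : (α_ A D E).hom ≫ A ◁ (β_ D E).hom =
      (β_ (A ⊗ D) E).hom ≫ (α_ _ _ _).inv ≫ (β_ A E).inv ▷ D ≫ (α_ _ _ _).hom := by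
    rw [braiding_tensor_left_hom]
    simp
  rw [e B, reassoc_of% h, midL]
  have e' : (α_ A E D).inv ≫ (β_ A E).hom ▷ D ≫ (α_ _ _ _).hom =
      A ◁ (β_ D E).inv ≫ (α_ _ _ _).inv ≫ (β_ (A ⊗ D) E).hom := by
    rw [braiding_tensor_left_hom]
    simp
  rw [reassoc_of% e']

/-- The strand `E` may be taken around `ψ` on the left instead of on the right. -/
theorem midR_eq (E : C) {A B D : C} (ψ : D ⊗ A ⟶ D ⊗ B) :
    midR E ψ = (β_ E D).inv ▷ A ≫ (α_ _ _ _).hom ≫ E ◁ ψ ≫ (α_ _ _ _).inv ≫ (β_ E D).hom ▷ B := by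
  have h := braiding_naturality_right E ψ
  have e (B : C) : (α_ E D B).inv ≫ (β_ E D).hom ▷ B =
      (β_ E (D ⊗ B)).hom ≫ (α_ _ _ _).hom ≫ D ◁ (β_ E B).inv ≫ (α_ _ _ _).inv := by
    rw [braiding_tensor_right_hom]
    simp
  rw [e B, reassoc_of% h, midR]
  have e' : (α_ D E A).hom ≫ D ◁ (β_ E A).hom ≫ (α_ _ _ _).inv =
      (β_ E D).inv ▷ A ≫ (α_ _ _ _).hom ≫ (β_ E (D ⊗ A)).hom := by
    rw [braiding_tensor_right_hom]
    simp
  rw [reassoc_of% e']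

theorem midR_naturality {A B D E E' : C} (e : E ⟶ E') (ψ : D ⊗ A ⟶ D ⊗ B) :
    midR E ψ ≫ (D ◁ e) ▷ B = (D ◁ e) ▷ A ≫ midR E' ψ := by
  calc
    _ = (α_ _ _ _).hom ≫ D ◁ (β_ E A).hom ≫ (α_ _ _ _).inv ≫ ψ ▷ E ≫ (α_ _ _ _).hom ≫
        D ◁ ((β_ E B).inv ≫ e ▷ B) ≫ (α_ _ _ _).inv := by simp [midR]
    _ = (α_ _ _ _).hom ≫ D ◁ (β_ E A).hom ≫ (α_ _ _ _).inv ≫ (ψ ▷ E ≫ (D ⊗ B) ◁ e) ≫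
        (α_ _ _ _).hom ≫ D ◁ (β_ E' B).inv ≫ (α_ _ _ _).inv := by
      rw [← braiding_inv_naturality_right]; monoidal
    _ = (α_ _ _ _).hom ≫ D ◁ ((β_ E A).hom ≫ A ◁ e) ≫ (α_ _ _ _).inv ≫ ψ ▷ E' ≫
        (α_ _ _ _).hom ≫ D ◁ (β_ E' B).inv ≫ (α_ _ _ _).inv := by
      rw [← whisker_exchange]; monoidal
    _ = _ := by rw [← braiding_naturality_left, midR]; monoidal

namespace M12Cell

variable {A₁₂ A₀₂ A₀₁ : SemigroupIn C} (t : M12Cell A₁₂ A₀₂ A₀₁)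

theorem hatφ_eq : t.hatφ = midL A₀₁.X t.φ ≫ (α_ _ _ _).inv ≫ A₀₁.mul ▷ A₁₂.X := by
  simp [hatφ, midL_eq]

theorem hatψ_eq : t.hatψ = midR A₁₂.X t.ψ ≫ (α_ _ _ _).hom ≫ A₀₁.X ◁ A₁₂.mul := by
  simp [hatψ, midR_eq]

end M12Cell

/-! ### The 2-simplices of `M₁₂` given by a multiplier bimonoid -/

namespace MultiplierBimonoid

variable (B : MultiplierBimonoid C)

theorem semigroup_mul_eq : B.semigroup.mul = B.t₂ ≫ B.X ◁ B.e ≫ (ρ_ B.X).hom := B.mul_eq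

/-- The counit is multiplicative. -/
theorem mul_counit : B.semigroup.mul ≫ B.e = B.X ◁ B.e ≫ (ρ_ B.X).hom ≫ B.e := by
  change (B.t₁ ≫ B.e ▷ B.X ≫ (λ_ B.X).hom) ≫ B.e = _
  calc
    _ = B.t₁ ≫ (B.e ▷ B.X ≫ 𝟙_ C ◁ B.e) ≫ (λ_ _).hom := by simp
    _ = (B.t₁ ≫ B.X ◁ B.e) ≫ B.e ▷ 𝟙_ C ≫ (λ_ _).hom := by rw [← whisker_exchange]; simp
    _ = _ := by rw [B.counit₁]; monoidal

theorem t₁_mul : B.t₁ ▷ B.X ≫ (α_ _ _ _).hom ≫ B.X ◁ B.semigroup.mul =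
    (α_ _ _ _).hom ≫ B.X ◁ B.semigroup.mul ≫ B.t₁ := by
  change B.t₁ ▷ B.X ≫ (α_ _ _ _).hom ≫ B.X ◁ (B.t₁ ≫ B.e ▷ B.X ≫ (λ_ B.X).hom) =
    (α_ _ _ _).hom ≫ B.X ◁ (B.t₁ ≫ B.e ▷ B.X ≫ (λ_ B.X).hom) ≫ B.t₁
  calc
    _ = (B.t₁ ▷ B.X ≫ (α_ _ _ _).hom ≫ B.X ◁ B.t₁) ≫ B.X ◁ B.e ▷ B.X ≫ B.X ◁ (λ_ _).hom := by simp
    _ = 𝟙 _ ⊗≫ B.X ◁ B.t₁ ≫ midL B.X B.t₁ ⊗≫ (B.t₁ ≫ B.X ◁ B.e) ▷ B.X ⊗≫ 𝟙 _ := by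
      rw [B.fusion₁]; monoidal
    _ = 𝟙 _ ⊗≫ B.X ◁ B.t₁ ≫ (midL B.X B.t₁ ≫ B.X ◁ B.e ▷ B.X) ≫ B.X ◁ (λ_ _).hom := by
      rw [B.counit₁]; monoidal
    _ = _ := by rw [MultiplierBimonoid.midL_naturality, midL_unit]; monoidal

theorem mul_t₁ : B.semigroup.mul ▷ B.X ≫ B.t₁ = (α_ _ _ _).hom ≫ B.X ◁ B.t₁ ≫ midL B.X B.t₁ ≫
    (α_ _ _ _).inv ≫ B.semigroup.mul ▷ B.X := by
  change (B.t₁ ≫ B.e ▷ B.X ≫ (λ_ B.X).hom) ▷ B.X ≫ B.t₁ = (α_ _ _ _).hom ≫ B.X ◁ B.t₁ ≫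
    midL B.X B.t₁ ≫ (α_ _ _ _).inv ≫ (B.t₁ ≫ B.e ▷ B.X ≫ (λ_ B.X).hom) ▷ B.X
  calc
    _ = 𝟙 _ ⊗≫ B.t₁ ▷ B.X ⊗≫ (B.e ▷ (B.X ⊗ B.X) ≫ 𝟙_ C ◁ B.t₁) ≫ (λ_ _).hom := by monoidal
    _ = (B.t₁ ▷ B.X ≫ (α_ _ _ _).hom ≫ B.X ◁ B.t₁) ≫ B.e ▷ (B.X ⊗ B.X) ≫ (λ_ _).hom := by
      rw [← whisker_exchange]; monoidal
    _ = _ := by rw [B.fusion₁]; monoidal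

theorem mul_t₂ : B.X ◁ B.t₂ ≫ (α_ _ _ _).inv ≫ B.semigroup.mul ▷ B.X =
    (α_ _ _ _).inv ≫ B.semigroup.mul ▷ B.X ≫ B.t₂ := by
  rw [semigroup_mul_eq]
  change B.X ◁ B.t₂ ≫ (α_ _ _ _).inv ≫ (B.t₂ ≫ B.X ◁ B.e ≫ (ρ_ B.X).hom) ▷ B.X =
    (α_ _ _ _).inv ≫ (B.t₂ ≫ B.X ◁ B.e ≫ (ρ_ B.X).hom) ▷ B.X ≫ B.t₂
  calc
    _ = (B.X ◁ B.t₂ ≫ (α_ _ _ _).inv ≫ B.t₂ ▷ B.X) ≫ (B.X ◁ B.e) ▷ B.X ≫ (ρ_ _).hom ▷ B.X := by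
      simp
    _ = 𝟙 _ ⊗≫ B.t₂ ▷ B.X ≫ midR B.X B.t₂ ⊗≫ B.X ◁ (B.t₂ ≫ B.e ▷ B.X) ⊗≫ 𝟙 _ := by
      rw [B.fusion₂]; monoidal
    _ = 𝟙 _ ⊗≫ B.t₂ ▷ B.X ≫ (midR B.X B.t₂ ≫ (B.X ◁ B.e) ▷ B.X) ≫ (ρ_ _).hom ▷ B.X := by
      rw [B.counit₂]; monoidal
    _ = _ := by rw [midR_naturality, midR_unit]; monoidal

theorem t₂_mul : B.X ◁ B.semigroup.mul ≫ B.t₂ = (α_ _ _ _).inv ≫ B.t₂ ▷ B.X ≫ midR B.X B.t₂ ≫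
    (α_ _ _ _).hom ≫ B.X ◁ B.semigroup.mul := by
  rw [semigroup_mul_eq]
  change B.X ◁ (B.t₂ ≫ B.X ◁ B.e ≫ (ρ_ B.X).hom) ≫ B.t₂ = (α_ _ _ _).inv ≫ B.t₂ ▷ B.X ≫
    midR B.X B.t₂ ≫ (α_ _ _ _).hom ≫ B.X ◁ (B.t₂ ≫ B.X ◁ B.e ≫ (ρ_ B.X).hom)
  calc
    _ = 𝟙 _ ⊗≫ B.X ◁ B.t₂ ⊗≫ ((B.X ⊗ B.X) ◁ B.e ≫ B.t₂ ▷ 𝟙_ C) ≫ (ρ_ _).hom := by monoidal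
    _ = (B.X ◁ B.t₂ ≫ (α_ _ _ _).inv ≫ B.t₂ ▷ B.X) ≫ (B.X ⊗ B.X) ◁ B.e ≫ (ρ_ _).hom := by
      rw [whisker_exchange]; monoidal
    _ = _ := by rw [B.fusion₂]; monoidal

theorem mul_compat : B.X ◁ B.t₁ ≫ (α_ _ _ _).inv ≫ B.semigroup.mul ▷ B.X =
    (α_ _ _ _).inv ≫ B.t₂ ▷ B.X ≫ (α_ _ _ _).hom ≫ B.X ◁ B.semigroup.mul := by
  have h := B.semigroup_mul_eq
  change B.X ◁ B.t₁ ≫ (α_ _ _ _).inv ≫ B.semigroup.mul ▷ B.X =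
    (α_ _ _ _).inv ≫ B.t₂ ▷ B.X ≫ (α_ _ _ _).hom ≫ B.X ◁ (B.t₁ ≫ B.e ▷ B.X ≫ (λ_ B.X).hom)
  rw [h]
  change B.X ◁ B.t₁ ≫ (α_ _ _ _).inv ≫ (B.t₂ ≫ B.X ◁ B.e ≫ (ρ_ B.X).hom) ▷ B.X = _
  calc
    _ = (α_ _ _ _).inv ≫ ((α_ _ _ _).hom ≫ B.X ◁ B.t₁ ≫ (α_ _ _ _).inv ≫ B.t₂ ▷ B.X ≫
        (α_ _ _ _).hom) ≫ B.X ◁ B.e ▷ B.X ≫ B.X ◁ (λ_ _).hom := by monoidal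
    _ = _ := by rw [← B.compat]; monoidal

/-- The 2-simplex `(t₁ | t₂)` of `M₁₂`. -/
def cellτ : M12Cell B.semigroup B.semigroup B.semigroup where
  φ := B.t₁
  ψ := B.t₂
  φ_mul := B.t₁_mul
  mul_φ := B.mul_t₁
  mul_ψ := B.mul_t₂
  ψ_mul := B.t₂_mul
  compat := B.mul_compat

/-- The 2-simplex `(e | e)` of `M₁₂`. -/
def cellε : M12Cell SemigroupIn.unit B.semigroup SemigroupIn.unit where
  φ := (ρ_ B.X).hom ≫ B.e ≫ (λ_ (𝟙_ C)).inv
  ψ := (λ_ B.X).hom ≫ B.e ≫ (λ_ (𝟙_ C)).inv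
  φ_mul := by
    change ((ρ_ B.X).hom ≫ B.e ≫ (λ_ (𝟙_ C)).inv) ▷ 𝟙_ C ≫ _ =
      (α_ B.X (𝟙_ C) (𝟙_ C)).hom ≫ B.X ◁ (λ_ (𝟙_ C)).hom ≫ (ρ_ B.X).hom ≫ B.e ≫ _
    rw [← rightUnitor_naturality_assoc]
    monoidal
  mul_φ := by
    have h : (B.t₁ ≫ B.e ▷ B.X ≫ (λ_ B.X).hom) ≫ B.e = _ := B.mul_counit
    rw [midL_unit]
    change (B.t₁ ≫ B.e ▷ B.X ≫ (λ_ B.X).hom) ▷ 𝟙_ C ≫ (ρ_ B.X).hom ≫ B.e ≫ _ =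
      (α_ B.X B.X (𝟙_ C)).hom ≫ B.X ◁ ((ρ_ B.X).hom ≫ B.e ≫ (λ_ (𝟙_ C)).inv) ≫
      (B.X ◁ (λ_ _).hom ≫ ((ρ_ B.X).hom ≫ B.e ≫ (λ_ (𝟙_ C)).inv) ≫ _) ≫ _
    generalize B.t₁ ≫ B.e ▷ B.X ≫ (λ_ B.X).hom = m at h ⊢
    rw [MonoidalCategory.rightUnitor_naturality_assoc, reassoc_of% h]
    monoidal
  mul_ψ := by
    change 𝟙_ C ◁ ((λ_ B.X).hom ≫ B.e ≫ (λ_ (𝟙_ C)).inv) ≫ _ =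
      (α_ (𝟙_ C) (𝟙_ C) B.X).inv ≫ (λ_ (𝟙_ C)).hom ▷ B.X ≫ (λ_ B.X).hom ≫ B.e ≫ _
    rw [← leftUnitor_naturality_assoc]
    monoidal
  ψ_mul := by
    have h : (B.t₁ ≫ B.e ▷ B.X ≫ (λ_ B.X).hom) ≫ B.e = _ := B.mul_counit
    rw [midR_unit]
    change 𝟙_ C ◁ (B.t₁ ≫ B.e ▷ B.X ≫ (λ_ B.X).hom) ≫ (λ_ B.X).hom ≫ B.e ≫ _ =
      (α_ (𝟙_ C) B.X B.X).inv ≫ ((λ_ B.X).hom ≫ B.e ≫ (λ_ (𝟙_ C)).inv) ▷ B.X ≫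
      ((ρ_ _).hom ▷ B.X ≫ ((λ_ B.X).hom ≫ B.e ≫ (λ_ (𝟙_ C)).inv) ≫ _) ≫ _
    generalize B.t₁ ≫ B.e ▷ B.X ≫ (λ_ B.X).hom = m at h ⊢
    rw [MonoidalCategory.leftUnitor_naturality_assoc, reassoc_of% h]
    calc
      _ = 𝟙 _ ⊗≫ (B.X ◁ B.e ≫ B.e ▷ 𝟙_ C) ⊗≫ 𝟙 _ := by monoidal
      _ = _ := by rw [whisker_exchange]; monoidal
  compat := by
    change 𝟙_ C ◁ ((ρ_ B.X).hom ≫ B.e ≫ (λ_ (𝟙_ C)).inv) ≫ _ =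
      (α_ (𝟙_ C) B.X (𝟙_ C)).inv ≫ ((λ_ B.X).hom ≫ B.e ≫ (λ_ (𝟙_ C)).inv) ▷ 𝟙_ C ≫ _
    monoidal

end MultiplierBimonoid

/-! ### Multiplier bimonoids as maps from the Catalan simplicial set -/

namespace CatalanMap

/-- The data of a map from the Catalan simplicial set to `M₁₂` given by a multiplier bimonoid. The
fillers express the fusion equations and the compatibility of `t₁` with `t₂` (`tet_assoc`), the
equations `(1 e) t₁ = 1 e` and `m = (1 e) t₂` (`tet_right`), the equations `(e 1) t₂ = e 1` and
`m = (e 1) t₁` (`tet_left`), and the multiplicativity of `e` (`tet_counit`), which follows from the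
others. -/
def ofMultiplierBimonoid (B : MultiplierBimonoid C) : CatalanMap (M12Data C) where
  a := B.semigroup
  τ := B.cellτ
  ε := B.cellε
  tet_assoc := by
    refine M12Cell.IsTet.mk B.fusion₁ B.fusion₂ ?_
    have h := (α_ _ _ _).inv ≫= B.compat =≫ (α_ _ _ _).inv
    have h' : B.X ◁ B.t₁ ≫ (α_ _ _ _).inv ≫ B.t₂ ▷ B.X =
        (α_ _ _ _).inv ≫ B.t₂ ▷ B.X ≫ (α_ _ _ _).hom ≫ B.X ◁ B.t₁ ≫ (α_ _ _ _).inv := by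
      simpa using h.symm
    exact h'
  tet_right := by
    have h₁ := B.counit₁
    have hm : B.t₁ ≫ B.e ▷ B.X ≫ (λ_ B.X).hom = _ := B.mul_eq
    have ha : (B.t₁ ≫ B.e ▷ B.X ≫ (λ_ B.X).hom) ▷ B.X ≫ (B.t₁ ≫ B.e ▷ B.X ≫ (λ_ B.X).hom) =
      (α_ _ _ _).hom ≫ B.X ◁ (B.t₁ ≫ B.e ▷ B.X ≫ (λ_ B.X).hom) ≫
        (B.t₁ ≫ B.e ▷ B.X ≫ (λ_ B.X).hom) := B.semigroup.assoc
    constructor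
    · change B.t₁ ▷ 𝟙_ C ≫ (α_ _ _ _).hom ≫ B.X ◁ ((ρ_ B.X).hom ≫ B.e ≫ (λ_ (𝟙_ C)).inv) =
        (α_ _ _ _).hom ≫ B.X ◁ ((ρ_ B.X).hom ≫ B.e ≫ (λ_ (𝟙_ C)).inv) ≫
        midL (𝟙_ C) (𝟙 (B.X ⊗ 𝟙_ C)) ≫ (α_ _ _ _).inv ≫ 𝟙 _ ▷ 𝟙_ C ≫ (α_ _ _ _).hom
      rw [midL_id]
      calc
        _ = 𝟙 _ ⊗≫ (B.t₁ ≫ B.X ◁ B.e) ⊗≫ 𝟙 _ := by monoidal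
        _ = _ := by rw [h₁]; monoidal
    · change B.X ◁ ((B.t₁ ≫ B.e ▷ B.X ≫ (λ_ B.X).hom) ≫ (ρ_ _).inv) ≫ (α_ B.X B.X (𝟙_ C)).inv ≫
        ((B.t₁ ≫ B.e ▷ B.X ≫ (λ_ B.X).hom) ≫ (ρ_ _).inv) ▷ 𝟙_ C =
        (α_ B.X B.X B.X).inv ≫ ((B.t₁ ≫ B.e ▷ B.X ≫ (λ_ B.X).hom) ≫ (ρ_ _).inv) ▷ B.X ≫
        midR (𝟙_ C) B.t₂ ≫ (α_ _ _ _).hom ≫ B.X ◁ ((λ_ B.X).hom ≫ B.e ≫ (λ_ (𝟙_ C)).inv) ≫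
          (α_ _ _ _).inv
      rw [midR_unit]
      generalize B.t₁ ≫ B.e ▷ B.X ≫ (λ_ B.X).hom = m at *
      calc
        _ = (α_ B.X B.X B.X).inv ≫ ((α_ _ _ _).hom ≫ B.X ◁ m ≫ m) ⊗≫ 𝟙 _ := by monoidal
        _ = _ := by rw [← ha, hm]; monoidal
    · change B.X ◁ 𝟙 (B.X ⊗ 𝟙_ C) ≫ (α_ _ _ _).inv ≫
        ((B.t₁ ≫ B.e ▷ B.X ≫ (λ_ B.X).hom) ≫ (ρ_ _).inv) ▷ 𝟙_ C =
        (α_ B.X B.X (𝟙_ C)).inv ≫ B.t₂ ▷ (𝟙_ C) ≫ (α_ _ _ _).hom ≫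
          B.X ◁ ((ρ_ B.X).hom ≫ B.e ≫ (λ_ (𝟙_ C)).inv) ≫ (α_ _ _ _).inv
      rw [hm]
      monoidal
  tet_left := by
    have h₂ := B.counit₂
    have ha : (B.t₁ ≫ B.e ▷ B.X ≫ (λ_ B.X).hom) ▷ B.X ≫ (B.t₁ ≫ B.e ▷ B.X ≫ (λ_ B.X).hom) =
      (α_ _ _ _).hom ≫ B.X ◁ (B.t₁ ≫ B.e ▷ B.X ≫ (λ_ B.X).hom) ≫
        (B.t₁ ≫ B.e ▷ B.X ≫ (λ_ B.X).hom) := B.semigroup.assoc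
    constructor
    · change ((B.t₁ ≫ B.e ▷ B.X ≫ (λ_ B.X).hom) ≫ (λ_ _).inv) ▷ B.X ≫ (α_ (𝟙_ C) B.X B.X).hom ≫
        𝟙_ C ◁ ((B.t₁ ≫ B.e ▷ B.X ≫ (λ_ B.X).hom) ≫ (λ_ _).inv) =
        (α_ B.X B.X B.X).hom ≫ B.X ◁ ((B.t₁ ≫ B.e ▷ B.X ≫ (λ_ B.X).hom) ≫ (λ_ _).inv) ≫
        midL (𝟙_ C) B.t₁ ≫ (α_ _ _ _).inv ≫ ((ρ_ B.X).hom ≫ B.e ≫ (λ_ (𝟙_ C)).inv) ▷ B.X ≫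
        (α_ _ _ _).hom
      rw [midL_unit]
      calc
        _ = ((B.t₁ ≫ B.e ▷ B.X ≫ (λ_ B.X).hom) ▷ B.X ≫ (B.t₁ ≫ B.e ▷ B.X ≫ (λ_ B.X).hom)) ⊗≫
          𝟙 _ := by monoidal
        _ = _ := by rw [ha]; monoidal
    · change 𝟙_ C ◁ B.t₂ ≫ (α_ _ _ _).inv ≫ ((λ_ B.X).hom ≫ B.e ≫ (λ_ (𝟙_ C)).inv) ▷ B.X =
        (α_ _ _ _).inv ≫ ((λ_ B.X).hom ≫ B.e ≫ (λ_ (𝟙_ C)).inv) ▷ B.X ≫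
        midR (𝟙_ C) (𝟙 (𝟙_ C ⊗ B.X)) ≫ (α_ _ _ _).hom ≫ 𝟙_ C ◁ 𝟙 (𝟙_ C ⊗ B.X) ≫ (α_ _ _ _).inv
      rw [midR_id]
      calc
        _ = 𝟙 _ ⊗≫ (B.t₂ ≫ B.e ▷ B.X) ⊗≫ 𝟙 _ := by monoidal
        _ = _ := by rw [h₂]; monoidal
    · change 𝟙_ C ◁ B.t₁ ≫ (α_ _ _ _).inv ≫ ((λ_ B.X).hom ≫ B.e ≫ (λ_ (𝟙_ C)).inv) ▷ B.X =
        (α_ _ _ _).inv ≫ 𝟙 (𝟙_ C ⊗ B.X) ▷ B.X ≫ (α_ _ _ _).hom ≫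
          𝟙_ C ◁ ((B.t₁ ≫ B.e ▷ B.X ≫ (λ_ B.X).hom) ≫ (λ_ _).inv) ≫ (α_ _ _ _).inv
      monoidal
  tet_counit := by
    have h : (B.t₁ ≫ B.e ▷ B.X ≫ (λ_ B.X).hom) ≫ B.e = _ := B.mul_counit
    constructor
    · change ((B.t₁ ≫ B.e ▷ B.X ≫ (λ_ B.X).hom) ≫ (λ_ _).inv) ▷ 𝟙_ C ≫ (α_ (𝟙_ C) B.X (𝟙_ C)).hom ≫
        𝟙_ C ◁ ((ρ_ B.X).hom ≫ B.e ≫ (λ_ (𝟙_ C)).inv) =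
        (α_ B.X B.X (𝟙_ C)).hom ≫ B.X ◁ ((ρ_ B.X).hom ≫ B.e ≫ (λ_ (𝟙_ C)).inv) ≫
        midL (𝟙_ C) (𝟙 (B.X ⊗ 𝟙_ C)) ≫ (α_ _ _ _).inv ≫
        ((ρ_ B.X).hom ≫ B.e ≫ (λ_ (𝟙_ C)).inv) ▷ 𝟙_ C ≫ (α_ _ _ _).hom
      rw [midL_id]
      generalize B.t₁ ≫ B.e ▷ B.X ≫ (λ_ B.X).hom = m at *
      calc
        _ = 𝟙 _ ⊗≫ (m ≫ B.e) ⊗≫ 𝟙 _ := by monoidal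
        _ = _ := by rw [h]; monoidal
    · change 𝟙_ C ◁ ((B.t₁ ≫ B.e ▷ B.X ≫ (λ_ B.X).hom) ≫ (ρ_ _).inv) ≫
        (α_ (𝟙_ C) B.X (𝟙_ C)).inv ≫ ((λ_ B.X).hom ≫ B.e ≫ (λ_ (𝟙_ C)).inv) ▷ 𝟙_ C =
        (α_ (𝟙_ C) B.X B.X).inv ≫ ((λ_ B.X).hom ≫ B.e ≫ (λ_ (𝟙_ C)).inv) ▷ B.X ≫
        midR (𝟙_ C) (𝟙 (𝟙_ C ⊗ B.X)) ≫ (α_ _ _ _).hom ≫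
        𝟙_ C ◁ ((λ_ B.X).hom ≫ B.e ≫ (λ_ (𝟙_ C)).inv) ≫ (α_ _ _ _).inv
      rw [midR_id]
      generalize B.t₁ ≫ B.e ▷ B.X ≫ (λ_ B.X).hom = m at *
      calc
        _ = 𝟙 _ ⊗≫ (m ≫ B.e) ⊗≫ 𝟙 _ := by monoidal
        _ = 𝟙 _ ⊗≫ (B.X ◁ B.e ≫ B.e ▷ 𝟙_ C) ⊗≫ 𝟙 _ := by rw [h]; monoidal
        _ = _ := by rw [whisker_exchange]; monoidal
    · change 𝟙_ C ◁ 𝟙 (B.X ⊗ 𝟙_ C) ≫ (α_ _ _ _).inv ≫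
        ((λ_ B.X).hom ≫ B.e ≫ (λ_ (𝟙_ C)).inv) ▷ 𝟙_ C =
        (α_ _ _ _).inv ≫ 𝟙 (𝟙_ C ⊗ B.X) ▷ 𝟙_ C ≫ (α_ _ _ _).hom ≫
        𝟙_ C ◁ ((ρ_ B.X).hom ≫ B.e ≫ (λ_ (𝟙_ C)).inv) ≫ (α_ _ _ _).inv
      monoidal

theorem ofMultiplierBimonoid_injective :
    Function.Injective (ofMultiplierBimonoid (C := C)) := by
  intro B B' h
  -- the part of the structure that does not depend on the semigroup structure of `a`
  let g (x : CatalanMap (M12Data C)) : Σ' X : C, (X ⊗ X ⟶ X ⊗ X) × (X ⊗ X ⟶ X ⊗ X) ×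
      (X ⊗ 𝟙_ C ⟶ 𝟙_ C ⊗ 𝟙_ C) :=
    ⟨SemigroupIn.X x.a, M12Cell.φ x.τ, M12Cell.ψ x.τ, M12Cell.φ x.ε⟩
  replace h := congrArg g h
  obtain ⟨X, t₁, t₂, e, _⟩ := B
  obtain ⟨X', t₁', t₂', e', _⟩ := B'
  obtain ⟨h, h'⟩ := PSigma.mk.inj h
  obtain rfl : X = X' := h
  obtain ⟨h₁, h'⟩ := Prod.mk.inj (eq_of_heq h')
  obtain ⟨h₂, h₃⟩ := Prod.mk.inj h'
  obtain rfl : t₁ = t₁' := h₁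
  obtain rfl : t₂ = t₂' := h₂
  replace h₃ : (ρ_ X).hom ≫ e ≫ (λ_ (𝟙_ C)).inv = (ρ_ X).hom ≫ e' ≫ (λ_ (𝟙_ C)).inv := h₃
  obtain rfl : e = e' := (cancel_mono _).mp ((cancel_epi _).mp h₃)
  rfl

/-- Heterogeneous equality of the components suffices, since the semigroup structures of the images
of `α` need only be propositionally equal. -/
theorem eq_ofMultiplierBimonoid (x : CatalanMap (M12Data C)) (B : MultiplierBimonoid C)
    (ha : x.a = B.semigroup) (h₁ : HEq (M12Cell.φ x.τ) B.t₁) (h₂ : HEq (M12Cell.ψ x.τ) B.t₂)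
    (h₃ : HEq (M12Cell.φ x.ε) B.cellε.φ) (h₄ : HEq (M12Cell.ψ x.ε) B.cellε.ψ) :
    ofMultiplierBimonoid B = x := by
  obtain ⟨a, τ, ε, _, _, _, _⟩ := x
  subst ha
  obtain rfl : τ = B.cellτ := M12Cell.ext (eq_of_heq h₁) (eq_of_heq h₂)
  obtain rfl : ε = B.cellε := M12Cell.ext (eq_of_heq h₃) (eq_of_heq h₄)
  rfl

theorem ofMultiplierBimonoid_surjective :
    Function.Surjective (ofMultiplierBimonoid (C := C)) := by
  intro x
  obtain ⟨⟨X, m, ha⟩, τ, ε, h1, h2, h3, h4⟩ := x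
  obtain ⟨e, he₁⟩ : ∃ e : X ⟶ 𝟙_ C, M12Cell.φ ε = (ρ_ X).hom ≫ e ≫ (λ_ (𝟙_ C)).inv :=
    exists_eq_rightUnitor _
  obtain ⟨e', he₂⟩ : ∃ e : X ⟶ 𝟙_ C, M12Cell.ψ ε = (λ_ X).hom ≫ e ≫ (λ_ (𝟙_ C)).inv :=
    exists_eq_leftUnitor _
  have he : (𝟙_ C) ◁ M12Cell.φ ε ≫ (α_ (𝟙_ C) (𝟙_ C) (𝟙_ C)).inv ≫ (λ_ (𝟙_ C)).hom ▷ (𝟙_ C) =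
    (α_ (𝟙_ C) X (𝟙_ C)).inv ≫ M12Cell.ψ ε ▷ (𝟙_ C) ≫ (α_ (𝟙_ C) (𝟙_ C) (𝟙_ C)).hom ≫
      𝟙_ C ◁ (λ_ (𝟙_ C)).hom := M12Cell.compat ε
  rw [he₁, he₂] at he
  replace he : (𝟙_ C) ◁ ((ρ_ X).hom ≫ e ≫ (λ_ (𝟙_ C)).inv) ≫ (α_ (𝟙_ C) (𝟙_ C) (𝟙_ C)).inv ≫
    (λ_ (𝟙_ C)).hom ▷ (𝟙_ C) = (α_ (𝟙_ C) X (𝟙_ C)).inv ≫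
    ((λ_ X).hom ≫ e' ≫ (λ_ (𝟙_ C)).inv) ▷ (𝟙_ C) ≫ (α_ (𝟙_ C) (𝟙_ C) (𝟙_ C)).hom ≫
      𝟙_ C ◁ (λ_ (𝟙_ C)).hom := he
  -- the compatibility of the two components of `ε` shows that they come from the same `e`
  obtain rfl : e = e' := by
    calc
      _ = 𝟙 _ ⊗≫ ((𝟙_ C) ◁ ((ρ_ X).hom ≫ e ≫ (λ_ (𝟙_ C)).inv) ≫ (α_ _ _ _).inv ≫
        (λ_ (𝟙_ C)).hom ▷ (𝟙_ C)) ⊗≫ 𝟙 _ := by monoidal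
      _ = _ := by rw [he]; monoidal
  obtain ⟨t₁, ht₁⟩ : ∃ t : X ⊗ X ⟶ X ⊗ X, M12Cell.φ τ = t := ⟨_, rfl⟩
  obtain ⟨t₂, ht₂⟩ : ∃ t : X ⊗ X ⟶ X ⊗ X, M12Cell.ψ τ = t := ⟨_, rfl⟩
  replace h1 : M12Cell.IsTet τ τ τ τ := h1
  replace h2 : M12Cell.IsTet ε (M12Cell.s1 _) τ (M12Cell.s1 _) := h2
  replace h3 : M12Cell.IsTet (M12Cell.s0 _) τ (M12Cell.s0 _) ε := h3
  obtain ⟨h11, h12, h13⟩ := h1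
  obtain ⟨h21, -, h23⟩ := h2
  obtain ⟨-, h32, h33⟩ := h3
  rw [ht₁] at h11 h21 h33
  rw [ht₂] at h12 h23 h32
  rw [ht₁, ht₂] at h13
  rw [he₁] at h21 h23
  rw [he₂] at h32 h33
  replace h21 : t₁ ▷ 𝟙_ C ≫ (α_ _ _ _).hom ≫ X ◁ ((ρ_ X).hom ≫ e ≫ (λ_ (𝟙_ C)).inv) =
        (α_ _ _ _).hom ≫ X ◁ ((ρ_ X).hom ≫ e ≫ (λ_ (𝟙_ C)).inv) ≫
        midL (𝟙_ C) (𝟙 (X ⊗ 𝟙_ C)) ≫ (α_ _ _ _).inv ≫ 𝟙 _ ▷ 𝟙_ C ≫ (α_ _ _ _).hom := h21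
  replace h23 : X ◁ 𝟙 (X ⊗ 𝟙_ C) ≫ (α_ _ _ _).inv ≫ (m ≫ (ρ_ _).inv) ▷ 𝟙_ C =
        (α_ X X (𝟙_ C)).inv ≫ t₂ ▷ (𝟙_ C) ≫ (α_ _ _ _).hom ≫
          X ◁ ((ρ_ X).hom ≫ e ≫ (λ_ (𝟙_ C)).inv) ≫ (α_ _ _ _).inv := h23
  replace h32 : 𝟙_ C ◁ t₂ ≫ (α_ _ _ _).inv ≫ ((λ_ X).hom ≫ e ≫ (λ_ (𝟙_ C)).inv) ▷ X =
        (α_ _ _ _).inv ≫ ((λ_ X).hom ≫ e ≫ (λ_ (𝟙_ C)).inv) ▷ X ≫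
        midR (𝟙_ C) (𝟙 (𝟙_ C ⊗ X)) ≫ (α_ _ _ _).hom ≫ 𝟙_ C ◁ 𝟙 (𝟙_ C ⊗ X) ≫ (α_ _ _ _).inv :=
    h32
  replace h33 : 𝟙_ C ◁ t₁ ≫ (α_ _ _ _).inv ≫ ((λ_ X).hom ≫ e ≫ (λ_ (𝟙_ C)).inv) ▷ X =
        (α_ _ _ _).inv ≫ 𝟙 (𝟙_ C ⊗ X) ▷ X ≫ (α_ _ _ _).hom ≫
          𝟙_ C ◁ (m ≫ (λ_ _).inv) ≫ (α_ _ _ _).inv := h33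
  rw [midL_id] at h21
  rw [midR_id] at h32
  have hm : m = t₁ ≫ e ▷ X ≫ (λ_ X).hom := by
    calc
      _ = 𝟙 _ ⊗≫ ((α_ _ _ _).inv ≫ 𝟙 (𝟙_ C ⊗ X) ▷ X ≫ (α_ _ _ _).hom ≫
          𝟙_ C ◁ (m ≫ (λ_ _).inv) ≫ (α_ _ _ _).inv) ⊗≫ 𝟙 _ := by monoidal
      _ = _ := by rw [← h33]; monoidal
  have hm' : m = t₂ ≫ X ◁ e ≫ (ρ_ X).hom := by
    calc
      _ = 𝟙 _ ⊗≫ (X ◁ 𝟙 (X ⊗ 𝟙_ C) ≫ (α_ _ _ _).inv ≫ (m ≫ (ρ_ _).inv) ▷ 𝟙_ C) ⊗≫ 𝟙 _ := by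
        monoidal
      _ = _ := by rw [h23]; monoidal
  let B : MultiplierBimonoid C :=
    { X := X
      t₁ := t₁
      t₂ := t₂
      e := e
      fusion₁ := h11
      fusion₂ := h12
      counit₁ := by
        calc
          _ = 𝟙 _ ⊗≫ (t₁ ▷ 𝟙_ C ≫ (α_ _ _ _).hom ≫ X ◁ ((ρ_ X).hom ≫ e ≫ (λ_ (𝟙_ C)).inv)) ⊗≫
            𝟙 _ := by monoidal
          _ = _ := by rw [h21]; monoidal
      counit₂ := by
        calc
          _ = 𝟙 _ ⊗≫ (𝟙_ C ◁ t₂ ≫ (α_ _ _ _).inv ≫ ((λ_ X).hom ≫ e ≫ (λ_ (𝟙_ C)).inv) ▷ X) ⊗≫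
            𝟙 _ := by monoidal
          _ = _ := by rw [h32]; monoidal
      compat := by
        have h : X ◁ t₁ ≫ (α_ X X X).inv ≫ t₂ ▷ X =
          (α_ X X X).inv ≫ t₂ ▷ X ≫ (α_ X X X).hom ≫ X ◁ t₁ ≫ (α_ X X X).inv := h13
        have h' := (α_ _ _ _).hom ≫= h =≫ (α_ _ _ _).hom
        simpa using h'.symm
      mul_eq := hm.symm.trans hm' }
  exact ⟨B, eq_ofMultiplierBimonoid _ B (SemigroupIn.ext rfl (heq_of_eq hm)) (heq_of_eq ht₁)
    (heq_of_eq ht₂) (heq_of_eq he₁) (heq_of_eq he₂)⟩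

/-- Simplicial maps from the Catalan simplicial set to `M₁₂` are multiplier bimonoids. -/
noncomputable def multiplierBimonoidEquiv :
    MultiplierBimonoid C ≃ (catalanSSet.{max u v} ⟶ M12 C) :=
  (Equiv.ofBijective ofMultiplierBimonoid
    ⟨ofMultiplierBimonoid_injective, ofMultiplierBimonoid_surjective⟩).trans
      (CatalanMap.equiv (M12Data C))

theorem isClassifiedBy_toMap (B : MultiplierBimonoid C) :
    IsClassifiedBy (ofMultiplierBimonoid B).toMap B where
  map_α := toMap_α _
  map_τ := ⟨B.cellτ, rfl, rfl, toMap_τ _⟩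
  map_ε := ⟨B.cellε, rfl, rfl, toMap_ε _⟩

end CatalanMap

/-! ### Passing a strand under a morphism whose right leg changes type -/

/-- The morphism `A E D ⟶ B E D'` obtained from `f : A D ⟶ B D'` by letting the strand `E` pass
under `f`. For `D = D'` this is `midL E f`. -/
def under (E : C) {A B D D' : C} (f : A ⊗ D ⟶ B ⊗ D') : A ⊗ (E ⊗ D) ⟶ B ⊗ (E ⊗ D') :=
  (α_ _ _ _).inv ≫ (β_ A E).hom ▷ D ≫ (α_ _ _ _).hom ≫ E ◁ f ≫ (α_ _ _ _).inv ≫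
    (β_ B E).inv ▷ D' ≫ (α_ _ _ _).hom

theorem midL_eq_under (E : C) {A B D : C} (φ : A ⊗ D ⟶ B ⊗ D) : midL E φ = under E φ := rfl

variable {A A' B B' D D' E E' F M : C}

theorem under_comp (E : C) {B' D'' : C} (f : A ⊗ D ⟶ B ⊗ D') (g : B ⊗ D' ⟶ B' ⊗ D'') :
    under E (f ≫ g) = under E f ≫ under E g := by
  simp [under, ← comp_whiskerRight_assoc]

theorem under_whiskerLeft (E A : C) (g : D ⟶ D') : under E (A ◁ g) = A ◁ (E ◁ g) := by
  calc
    _ = (α_ _ _ _).inv ≫ ((β_ A E).hom ▷ D ≫ (E ⊗ A) ◁ g) ≫ (β_ A E).inv ▷ D' ≫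
        (α_ _ _ _).hom := by simp [under]
    _ = _ := by rw [← whisker_exchange]; simp [← comp_whiskerRight_assoc]

theorem under_whiskerRight_tensor (E F : C) (f : A ⊗ D ⟶ B ⊗ D') :
    under E ((α_ _ _ _).inv ≫ f ▷ F ≫ (α_ _ _ _).hom) =
      A ◁ (α_ _ _ _).inv ≫ (α_ _ _ _).inv ≫ under E f ▷ F ≫ (α_ _ _ _).hom ≫
        B ◁ (α_ _ _ _).hom := by
  simp only [under]
  monoidal

theorem under_under (E F : C) (f : A ⊗ D ⟶ B ⊗ D') :
    under E (under F f) = A ◁ (α_ _ _ _).inv ≫ under (E ⊗ F) f ≫ B ◁ (α_ _ _ _).hom := by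
  simp only [under, braiding_tensor_right_hom, braiding_tensor_right_inv]
  monoidal

theorem under_naturality (e : E ⟶ E') (f : A ⊗ D ⟶ B ⊗ D') :
    under E f ≫ B ◁ e ▷ D' = A ◁ e ▷ D ≫ under E' f := by
  calc
    _ = (α_ _ _ _).inv ≫ (β_ A E).hom ▷ D ≫ (α_ _ _ _).hom ≫ E ◁ f ≫ (α_ _ _ _).inv ≫
        ((β_ B E).inv ≫ B ◁ e) ▷ D' ≫ (α_ _ _ _).hom := by simp [under]
    _ = (α_ _ _ _).inv ≫ (β_ A E).hom ▷ D ≫ (α_ _ _ _).hom ≫ (E ◁ f ≫ e ▷ (B ⊗ D')) ≫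
        (α_ _ _ _).inv ≫ (β_ B E').inv ▷ D' ≫ (α_ _ _ _).hom := by
      rw [← braiding_inv_naturality_left]; monoidal
    _ = (α_ _ _ _).inv ≫ ((β_ A E).hom ≫ e ▷ A) ▷ D ≫ (α_ _ _ _).hom ≫ E' ◁ f ≫
        (α_ _ _ _).inv ≫ (β_ B E').inv ▷ D' ≫ (α_ _ _ _).hom := by
      rw [whisker_exchange]; monoidal
    _ = _ := by rw [← braiding_naturality_right, under]; monoidal

/-- The strand `E` may be taken around `f` on the right instead of on the left. -/
theorem braiding_under (E : C) (f : A ⊗ D ⟶ B ⊗ D') :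
    A ◁ (β_ D E).hom ≫ under E f =
      (α_ _ _ _).inv ≫ f ▷ E ≫ (α_ _ _ _).hom ≫ B ◁ (β_ D' E).hom := by
  have h := braiding_naturality_left f E
  have e (A D : C) : (α_ A D E).hom ≫ A ◁ (β_ D E).hom =
      (β_ (A ⊗ D) E).hom ≫ (α_ _ _ _).inv ≫ (β_ A E).inv ▷ D ≫ (α_ _ _ _).hom := by
    rw [braiding_tensor_left_hom]
    simp
  rw [e B D', reassoc_of% h, braiding_tensor_left_hom, under]
  simp

/-- Moving the outer part of a composite strand to the right of `f`. -/
theorem braiding_under_tensor (F E : C) (f : A ⊗ D ⟶ B ⊗ D') :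
    A ◁ (F ◁ (β_ D E).hom ≫ (α_ _ _ _).inv) ≫ under (F ⊗ E) f =
      A ◁ (α_ _ _ _).inv ≫ (α_ _ _ _).inv ≫ under F f ▷ E ≫ (α_ _ _ _).hom ≫ B ◁ (α_ _ _ _).hom ≫
        B ◁ (F ◁ (β_ D' E).hom ≫ (α_ _ _ _).inv) := by
  have h := congrArg (under F) (braiding_under E f)
  have e : (α_ A D E).inv ≫ f ▷ E ≫ (α_ _ _ _).hom ≫ B ◁ (β_ D' E).hom =
      ((α_ A D E).inv ≫ f ▷ E ≫ (α_ _ _ _).hom) ≫ B ◁ (β_ D' E).hom := by simp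
  rw [under_comp, under_whiskerLeft, under_under, e, under_comp, under_whiskerRight_tensor,
    under_whiskerLeft] at h
  rw [← cancel_mono (B ◁ (α_ _ _ _).hom)]
  simpa using h

/-! ### Actions transported along a 2-simplex -/

/-- If `B` acts on `M` by `ρ`, then `φ : A D ⟶ B D` lets `A` act on `M D`. -/
def act (φ : A ⊗ D ⟶ B ⊗ D) (ρ : B ⊗ M ⟶ M) : A ⊗ (M ⊗ D) ⟶ M ⊗ D :=
  under M φ ≫ (α_ _ _ _).inv ≫ ρ ▷ D

/-- Before `φ` is applied, the strand `M` may be taken to the right of it. -/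
theorem braiding_act (φ : A ⊗ D ⟶ B ⊗ D) (ρ : B ⊗ M ⟶ M) :
    A ◁ (β_ D M).hom ≫ act φ ρ =
      (α_ _ _ _).inv ≫ φ ▷ M ≫ (α_ _ _ _).hom ≫ B ◁ (β_ D M).hom ≫ (α_ _ _ _).inv ≫ ρ ▷ D := by
  rw [act, reassoc_of% braiding_under]

/-- If `r : M Y ⟶ N` is equivariant for actions of `B`, then so is the induced morphism
`(M D) Y ⟶ N D` for the transported actions of `A`. -/
theorem act_braiding {N Y : C} {φ : A ⊗ D ⟶ B ⊗ D} {ρ : B ⊗ M ⟶ M} {ρ' : B ⊗ N ⟶ N}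
    {r : M ⊗ Y ⟶ N} (hr : ρ ▷ Y ≫ r = (α_ _ _ _).hom ≫ B ◁ r ≫ ρ') :
    A ◁ (M ◁ (β_ D Y).hom ≫ (α_ _ _ _).inv ≫ r ▷ D) ≫ act φ ρ' =
      A ◁ (α_ _ _ _).inv ≫ (α_ _ _ _).inv ≫ act φ ρ ▷ Y ≫ (α_ _ _ _).hom ≫ M ◁ (β_ D Y).hom ≫
        (α_ _ _ _).inv ≫ r ▷ D := by
  have h := braiding_under_tensor M Y φ
  calc
    _ = A ◁ (M ◁ (β_ D Y).hom ≫ (α_ _ _ _).inv) ≫ (A ◁ r ▷ D ≫ under N φ) ≫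
        (α_ _ _ _).inv ≫ ρ' ▷ D := by simp [act]
    _ = (A ◁ (M ◁ (β_ D Y).hom ≫ (α_ _ _ _).inv) ≫ under (M ⊗ Y) φ) ⊗≫
        ((α_ _ _ _).hom ≫ B ◁ r ≫ ρ') ▷ D := by rw [← under_naturality]; monoidal
    _ = 𝟙 _ ⊗≫ under M φ ▷ Y ⊗≫ ((B ⊗ M) ◁ (β_ D Y).hom ≫ ρ ▷ (Y ⊗ D)) ⊗≫ r ▷ D := by
      rw [← hr, h]; monoidal
    _ = _ := by rw [whisker_exchange, act]; monoidal

/-- If `φ` is compatible with the multiplication of `A`, then `act φ ρ` is an action of `A`. -/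
theorem mul_act {φ : A ⊗ D ⟶ B ⊗ D} {ρ : B ⊗ M ⟶ M} {m : B ⊗ B ⟶ B} {n : A ⊗ A ⟶ A}
    (hφ : n ▷ D ≫ φ = (α_ _ _ _).hom ≫ A ◁ φ ≫ midL B φ ≫ (α_ _ _ _).inv ≫ m ▷ D)
    (hρ : m ▷ M ≫ ρ = (α_ _ _ _).hom ≫ B ◁ ρ ≫ ρ) :
    n ▷ (M ⊗ D) ≫ act φ ρ = (α_ _ _ _).hom ≫ A ◁ act φ ρ ≫ act φ ρ := by
  rw [midL_eq_under] at hφ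
  have h := braiding_under_tensor B M φ
  rw [← cancel_epi ((A ⊗ A) ◁ (β_ D M).hom)]
  calc
    _ = n ▷ (D ⊗ M) ≫ (A ◁ (β_ D M).hom ≫ under M φ) ≫ (α_ _ _ _).inv ≫ ρ ▷ D := by
      rw [whisker_exchange_assoc]; simp [act]
    _ = 𝟙 _ ⊗≫ (n ▷ D ≫ φ) ▷ M ⊗≫ B ◁ (β_ D M).hom ⊗≫ ρ ▷ D := by
      rw [braiding_under]; monoidal
    _ = 𝟙 _ ⊗≫ A ◁ φ ▷ M ⊗≫ under B φ ▷ M ⊗≫ (m ▷ (D ⊗ M) ≫ B ◁ (β_ D M).hom) ⊗≫ ρ ▷ D := by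
      rw [hφ]; monoidal
    _ = 𝟙 _ ⊗≫ A ◁ φ ▷ M ⊗≫ under B φ ▷ M ⊗≫ (B ⊗ B) ◁ (β_ D M).hom ⊗≫
        ((α_ _ _ _).hom ≫ B ◁ ρ ≫ ρ) ▷ D := by
      rw [← whisker_exchange, ← hρ]; monoidal
    _ = 𝟙 _ ⊗≫ A ◁ φ ▷ M ⊗≫ (A ◁ (α_ _ _ _).inv ≫ (α_ _ _ _).inv ≫ under B φ ▷ M ≫
        (α_ _ _ _).hom ≫ B ◁ (α_ _ _ _).hom ≫ B ◁ (B ◁ (β_ D M).hom ≫ (α_ _ _ _).inv)) ≫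
        B ◁ ρ ▷ D ⊗≫ ρ ▷ D := by monoidal
    _ = 𝟙 _ ⊗≫ A ◁ φ ▷ M ⊗≫ A ◁ (B ◁ (β_ D M).hom ≫ (α_ _ _ _).inv) ≫
        (under (B ⊗ M) φ ≫ B ◁ ρ ▷ D) ⊗≫ ρ ▷ D := by
      rw [← h]; monoidal
    _ = 𝟙 _ ⊗≫ A ◁ ((α_ _ _ _).inv ≫ φ ▷ M ≫ (α_ _ _ _).hom ≫ B ◁ (β_ D M).hom) ⊗≫ A ◁ ρ ▷ D ≫
        act φ ρ := by
      rw [under_naturality, act]; monoidal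
    _ = _ := by
      rw [← braiding_under]; simp only [act]; monoidal

/-- If `φ` is a morphism of right `D`-modules, then so is `act φ ρ`. -/
theorem act_mul {φ : A ⊗ D ⟶ B ⊗ D} {ρ : B ⊗ M ⟶ M} {m : D ⊗ D ⟶ D}
    (hφ : φ ▷ D ≫ (α_ _ _ _).hom ≫ B ◁ m = (α_ _ _ _).hom ≫ A ◁ m ≫ φ) :
    act φ ρ ▷ D ≫ (α_ _ _ _).hom ≫ M ◁ m =
      (α_ _ _ _).hom ≫ A ◁ ((α_ _ _ _).hom ≫ M ◁ m) ≫ act φ ρ := by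
  have e : ((α_ _ _ _).inv ≫ φ ▷ D ≫ (α_ _ _ _).hom) ≫ B ◁ m = A ◁ m ≫ φ := by simp [hφ]
  have h := congrArg (under M) e
  rw [under_comp, under_whiskerRight_tensor, under_whiskerLeft, under_comp,
    under_whiskerLeft] at h
  calc
    _ = 𝟙 _ ⊗≫ (under M φ ▷ D) ⊗≫ (ρ ▷ (D ⊗ D) ≫ M ◁ m) := by simp only [act]; monoidal
    _ = 𝟙 _ ⊗≫ ((A ◁ (α_ _ _ _).inv ≫ (α_ _ _ _).inv ≫ under M φ ▷ D ≫ (α_ _ _ _).hom ≫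
        B ◁ (α_ _ _ _).hom) ≫ B ◁ M ◁ m) ⊗≫ ρ ▷ D := by rw [← whisker_exchange]; monoidal
    _ = _ := by rw [h, act]; monoidal

variable {A A₂ B D D' D'' M N P X Y Z : C}

/-! ### Composites of transported actions -/

theorem tensorμ_comp_eq (ρ : B ⊗ M ⟶ N) (m : D ⊗ D' ⟶ D'') :
    tensorμ B D M D' ≫ (ρ ⊗ₘ m) = (α_ (B ⊗ D) M D').inv ≫
      ((α_ _ _ _).hom ≫ B ◁ (β_ D M).hom ≫ (α_ _ _ _).inv ≫ ρ ▷ D) ▷ D' ≫ (α_ _ _ _).hom ≫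
        N ◁ m := by
  simp only [tensorμ, MonoidalCategory.tensorHom_def]
  monoidal

/-- Transporting an action `ρ` of `B` along `φ` amounts to composing the morphism of `NDSemigroup 𝒬`
with first component `act φ n` with the monoidal product of the one with first component `ρ` and
the identity of `D`: this is the defining equation of such a composite. -/
theorem tensorμ_comp_act {φ : A ⊗ D ⟶ B ⊗ D} {ρ : B ⊗ M ⟶ M} {n : B ⊗ B ⟶ B} {m : D ⊗ D ⟶ D}
    (hφ : φ ▷ D ≫ (α_ _ _ _).hom ≫ B ◁ m = (α_ _ _ _).hom ≫ A ◁ m ≫ φ)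
    (hρ : n ▷ M ≫ ρ = (α_ _ _ _).hom ≫ B ◁ ρ ≫ ρ) :
    A ◁ (tensorμ B D M D ≫ (ρ ⊗ₘ m)) ≫ act φ ρ =
      (α_ _ _ _).inv ≫ act φ n ▷ (M ⊗ D) ≫ tensorμ B D M D ≫ (ρ ⊗ₘ m) := by
  have h := act_mul (ρ := ρ) hφ
  have h' := act_braiding (φ := φ) hρ
  rw [tensorμ_comp_eq]
  calc
    _ = 𝟙 _ ⊗≫ A ◁ (B ◁ (β_ D M).hom ≫ (α_ _ _ _).inv ≫ ρ ▷ D) ▷ D ⊗≫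
        ((α_ _ _ _).hom ≫ A ◁ ((α_ _ _ _).hom ≫ M ◁ m) ≫ act φ ρ) := by monoidal
    _ = 𝟙 _ ⊗≫ (A ◁ (B ◁ (β_ D M).hom ≫ (α_ _ _ _).inv ≫ ρ ▷ D) ≫ act φ ρ) ▷ D ⊗≫
        M ◁ m := by rw [← h]; monoidal
    _ = _ := by rw [h']; monoidal

/-- The fusion equation of a 3-simplex, after the strand `X` has been multiplied in. -/
theorem fusion_act {φ₀₁₂ : A₂ ⊗ Y ⟶ X ⊗ Y} {φ₀₂₃ : A ⊗ Z ⟶ A₂ ⊗ Z} {φ₀₁₃ : A ⊗ P ⟶ X ⊗ P}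
    {φ₁₂₃ : P ⊗ Z ⟶ Y ⊗ Z} (m : X ⊗ X ⟶ X)
    (h : φ₀₁₃ ▷ Z ≫ (α_ _ _ _).hom ≫ X ◁ φ₁₂₃ = (α_ _ _ _).hom ≫ A ◁ φ₁₂₃ ≫ midL Y φ₀₂₃ ≫
      (α_ _ _ _).inv ≫ φ₀₁₂ ▷ Z ≫ (α_ _ _ _).hom) :
    A ◁ (X ◁ φ₁₂₃) ≫ A ◁ (α_ _ _ _).inv ≫ act φ₀₂₃ (act φ₀₁₂ m) ≫ (α_ _ _ _).hom =
      A ◁ (α_ _ _ _).inv ≫ (α_ _ _ _).inv ≫ act φ₀₁₃ m ▷ Z ≫ (α_ _ _ _).hom ≫ X ◁ φ₁₂₃ := by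
  rw [midL_eq_under] at h
  have e : ((α_ _ _ _).inv ≫ φ₀₁₃ ▷ Z ≫ (α_ _ _ _).hom) ≫ X ◁ φ₁₂₃ = A ◁ φ₁₂₃ ≫ under Y φ₀₂₃ ≫
      (α_ _ _ _).inv ≫ φ₀₁₂ ▷ Z ≫ (α_ _ _ _).hom := by simp [h]
  have h' := congrArg (under X) e
  rw [under_comp, under_whiskerRight_tensor, under_whiskerLeft, under_comp, under_comp,
    under_whiskerRight_tensor, under_whiskerLeft, under_under] at h'
  calc
    _ = (A ◁ (X ◁ φ₁₂₃) ≫ (A ◁ (α_ _ _ _).inv ≫ under (X ⊗ Y) φ₀₂₃ ≫ A₂ ◁ (α_ _ _ _).hom) ≫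
        A₂ ◁ (α_ _ _ _).inv ≫ (α_ _ _ _).inv ≫ under X φ₀₁₂ ▷ Z ≫ (α_ _ _ _).hom ≫
        X ◁ (α_ _ _ _).hom) ⊗≫ m ▷ (Y ⊗ Z) := by simp only [act]; monoidal
    _ = 𝟙 _ ⊗≫ under X φ₀₁₃ ▷ Z ⊗≫ ((X ⊗ X) ◁ φ₁₂₃ ≫ m ▷ (Y ⊗ Z)) := by rw [← h']; monoidal
    _ = _ := by rw [whisker_exchange]; simp only [act]; monoidal

/-- The fusion equation of a 3-simplex, after the strands `X` and `Y` have been multiplied in. -/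
theorem fusion_act_act {φ₀₁₂ : A₂ ⊗ Y ⟶ X ⊗ Y} {φ₀₂₃ : A ⊗ Z ⟶ A₂ ⊗ Z} {φ₀₁₃ : A ⊗ P ⟶ X ⊗ P}
    {φ₁₂₃ : P ⊗ Z ⟶ Y ⊗ Z} (m : X ⊗ X ⟶ X) {n : Y ⊗ Y ⟶ Y}
    (h : φ₀₁₃ ▷ Z ≫ (α_ _ _ _).hom ≫ X ◁ φ₁₂₃ = (α_ _ _ _).hom ≫ A ◁ φ₁₂₃ ≫ midL Y φ₀₂₃ ≫
      (α_ _ _ _).inv ≫ φ₀₁₂ ▷ Z ≫ (α_ _ _ _).hom)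
    (hn : φ₀₁₂ ▷ Y ≫ (α_ _ _ _).hom ≫ X ◁ n = (α_ _ _ _).hom ≫ A₂ ◁ n ≫ φ₀₁₂) :
    A ◁ (X ◁ act φ₁₂₃ n) ≫ A ◁ (α_ _ _ _).inv ≫ act φ₀₂₃ (act φ₀₁₂ m) ≫ (α_ _ _ _).hom =
      A ◁ (α_ _ _ _).inv ≫ (α_ _ _ _).inv ≫ act φ₀₁₃ m ▷ (Y ⊗ Z) ≫ (α_ _ _ _).hom ≫
        X ◁ act φ₁₂₃ n := by
  have h₁ := fusion_act m h
  have h₂ := act_braiding (φ := φ₀₂₃) (act_mul (ρ := m) hn)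
  rw [← cancel_epi (A ◁ X ◁ P ◁ (β_ Z Y).hom)]
  calc
    _ = 𝟙 _ ⊗≫ A ◁ X ◁ (P ◁ (β_ Z Y).hom ≫ act φ₁₂₃ n) ⊗≫ act φ₀₂₃ (act φ₀₁₂ m) ⊗≫ 𝟙 _ := by
      monoidal
    _ = 𝟙 _ ⊗≫ A ◁ X ◁ φ₁₂₃ ▷ Y ⊗≫ (A ◁ ((X ⊗ Y) ◁ (β_ Z Y).hom ≫ (α_ _ _ _).inv ≫
        ((α_ _ _ _).hom ≫ X ◁ n) ▷ Z) ≫ act φ₀₂₃ (act φ₀₁₂ m)) ⊗≫ 𝟙 _ := by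
      rw [braiding_act]; monoidal
    _ = 𝟙 _ ⊗≫ (A ◁ (X ◁ φ₁₂₃) ≫ A ◁ (α_ _ _ _).inv ≫ act φ₀₂₃ (act φ₀₁₂ m) ≫ (α_ _ _ _).hom) ▷ Y
        ⊗≫ (X ⊗ Y) ◁ (β_ Z Y).hom ⊗≫ X ◁ n ▷ Z ⊗≫ 𝟙 _ := by rw [h₂]; monoidal
    _ = 𝟙 _ ⊗≫ act φ₀₁₃ m ▷ (Z ⊗ Y) ⊗≫
        X ◁ ((α_ _ _ _).inv ≫ φ₁₂₃ ▷ Y ≫ (α_ _ _ _).hom ≫ Y ◁ (β_ Z Y).hom ≫ (α_ _ _ _).inv ≫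
          n ▷ Z) := by rw [h₁]; monoidal
    _ = 𝟙 _ ⊗≫ (act φ₀₁₃ m ▷ (Z ⊗ Y) ≫ (X ⊗ P) ◁ (β_ Z Y).hom) ⊗≫ X ◁ act φ₁₂₃ n := by
      rw [← braiding_act]; monoidal
    _ = _ := by rw [← whisker_exchange]; monoidal

/-- The defining equation of the composite of the morphisms with first components `act φ₀₁₃ m` and
`m ⊗ act φ₁₂₃ n`: by the fusion equation, its first component is the action transported along
`φ₀₁₂` and `φ₀₂₃`. -/
theorem tensorμ_comp_act_act {φ₀₁₂ : A₂ ⊗ Y ⟶ X ⊗ Y} {φ₀₂₃ : A ⊗ Z ⟶ A₂ ⊗ Z}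
    {φ₀₁₃ : A ⊗ P ⟶ X ⊗ P} {φ₁₂₃ : P ⊗ Z ⟶ Y ⊗ Z} {m : X ⊗ X ⟶ X} {n : Y ⊗ Y ⟶ Y}
    (h : φ₀₁₃ ▷ Z ≫ (α_ _ _ _).hom ≫ X ◁ φ₁₂₃ = (α_ _ _ _).hom ≫ A ◁ φ₁₂₃ ≫ midL Y φ₀₂₃ ≫
      (α_ _ _ _).inv ≫ φ₀₁₂ ▷ Z ≫ (α_ _ _ _).hom)
    (hm : m ▷ X ≫ m = (α_ _ _ _).hom ≫ X ◁ m ≫ m)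
    (hn : φ₀₁₂ ▷ Y ≫ (α_ _ _ _).hom ≫ X ◁ n = (α_ _ _ _).hom ≫ A₂ ◁ n ≫ φ₀₁₂) :
    A ◁ (tensorμ X P X (Y ⊗ Z) ≫ (m ⊗ₘ act φ₁₂₃ n)) ≫
        A ◁ (α_ _ _ _).inv ≫ act φ₀₂₃ (act φ₀₁₂ m) ≫ (α_ _ _ _).hom =
      (α_ _ _ _).inv ≫ act φ₀₁₃ m ▷ (X ⊗ (Y ⊗ Z)) ≫ tensorμ X P X (Y ⊗ Z) ≫
        (m ⊗ₘ act φ₁₂₃ n) := by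
  have h₁ := fusion_act_act m h hn
  have h₂ := act_braiding (φ := φ₀₁₃) hm
  rw [tensorμ_comp_eq]
  calc
    _ = 𝟙 _ ⊗≫ A ◁ (X ◁ (β_ P X).hom ≫ (α_ _ _ _).inv ≫ m ▷ P) ▷ (Y ⊗ Z) ⊗≫
        (A ◁ (X ◁ act φ₁₂₃ n) ≫ A ◁ (α_ _ _ _).inv ≫ act φ₀₂₃ (act φ₀₁₂ m) ≫ (α_ _ _ _).hom) := by
      monoidal
    _ = 𝟙 _ ⊗≫ (A ◁ (X ◁ (β_ P X).hom ≫ (α_ _ _ _).inv ≫ m ▷ P) ≫ act φ₀₁₃ m) ▷ (Y ⊗ Z) ⊗≫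
        X ◁ act φ₁₂₃ n := by rw [h₁]; monoidal
    _ = _ := by rw [h₂]; monoidal

/-! ### The compatibility of the two components -/

theorem braiding_tensorμ_comp {m : B ⊗ B ⟶ B} {n : D ⊗ D ⟶ D} :
    (B ⊗ D) ◁ (β_ D B).hom ≫ tensorμ B D B D ≫ (m ⊗ₘ n) =
      𝟙 _ ⊗≫ B ◁ (n ▷ B ≫ (β_ D B).hom) ⊗≫ m ▷ D := by
  rw [braiding_naturality_left, braiding_tensor_left_hom, tensorμ_comp_eq]
  calc
    _ = 𝟙 _ ⊗≫ B ◁ D ◁ (β_ D B).hom ⊗≫ B ◁ (β_ D B).hom ▷ D ⊗≫ (m ▷ (D ⊗ D) ≫ B ◁ n) := by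
      monoidal
    _ = _ := by rw [← whisker_exchange]; monoidal

theorem whiskerLeft_tensorμ_comp {m : B ⊗ B ⟶ B} {n : D ⊗ D ⟶ D}
    (hm : m ▷ B ≫ m = (α_ _ _ _).hom ≫ B ◁ m ≫ m) :
    (B ⊗ D) ◁ (B ◁ (β_ D B).hom ≫ (α_ _ _ _).inv ≫ m ▷ D) ≫ tensorμ B D B D ≫ (m ⊗ₘ n) =
      𝟙 _ ⊗≫ B ◁ (β_ D B).hom ▷ (D ⊗ B) ⊗≫ m ▷ (D ⊗ D ⊗ B) ⊗≫ B ◁ (n ▷ B ≫ (β_ D B).hom) ⊗≫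
        m ▷ D := by
  have hb := braiding_naturality_right D m
  rw [braiding_tensor_right_hom] at hb
  have h := braiding_tensorμ_comp (m := m) (n := n)
  calc
    _ = 𝟙 _ ⊗≫ B ◁ D ◁ B ◁ (β_ D B).hom ⊗≫ B ◁ (D ◁ m ≫ (β_ D B).hom) ▷ D ⊗≫
        (m ▷ (D ⊗ D) ≫ B ◁ n) := by rw [tensorμ_comp_eq]; monoidal
    _ = 𝟙 _ ⊗≫ B ◁ D ◁ B ◁ (β_ D B).hom ⊗≫ B ◁ (β_ D B).hom ▷ B ▷ D ⊗≫
        B ◁ B ◁ (β_ D B).hom ▷ D ⊗≫ ((α_ _ _ _).hom ≫ B ◁ m ≫ m) ▷ (D ⊗ D) ⊗≫ B ◁ n := by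
      rw [hb]; monoidal
    _ = 𝟙 _ ⊗≫ B ◁ ((D ⊗ B) ◁ (β_ D B).hom ≫ (β_ D B).hom ▷ (B ⊗ D)) ⊗≫
        ((B ⊗ B) ◁ ((β_ D B).hom ▷ D) ≫ m ▷ ((B ⊗ D) ⊗ D)) ⊗≫ m ▷ (D ⊗ D) ⊗≫ B ◁ n := by
      rw [← hm]; monoidal
    _ = 𝟙 _ ⊗≫ B ◁ (β_ D B).hom ▷ (D ⊗ B) ⊗≫ ((B ⊗ B) ◁ (D ◁ (β_ D B).hom) ≫
        m ▷ (D ⊗ (B ⊗ D))) ⊗≫ B ◁ ((β_ D B).hom ▷ D) ⊗≫ m ▷ (D ⊗ D) ⊗≫ B ◁ n := by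
      rw [whisker_exchange, whisker_exchange]; monoidal
    _ = 𝟙 _ ⊗≫ B ◁ (β_ D B).hom ▷ (D ⊗ B) ⊗≫ m ▷ (D ⊗ D ⊗ B) ⊗≫
        ((B ⊗ D) ◁ (β_ D B).hom ≫ tensorμ B D B D ≫ (m ⊗ₘ n)) := by
      rw [whisker_exchange, tensorμ_comp_eq]; monoidal
    _ = _ := by rw [h]; monoidal

/-- The compatibility of `ψ̂` with `φ̂`: they satisfy `x φ̂(a, y) = ψ̂(x, a) y` in the semigroup
`B D`. -/
theorem hat_compat {φ : A ⊗ D ⟶ B ⊗ D} {ψ : B ⊗ A ⟶ B ⊗ D} {m : B ⊗ B ⟶ B} {n : D ⊗ D ⟶ D}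
    (hm : m ▷ B ≫ m = (α_ _ _ _).hom ≫ B ◁ m ≫ m)
    (hn : n ▷ D ≫ n = (α_ _ _ _).hom ≫ D ◁ n ≫ n)
    (h : B ◁ φ ≫ (α_ _ _ _).inv ≫ m ▷ D = (α_ _ _ _).inv ≫ ψ ▷ D ≫ (α_ _ _ _).hom ≫ B ◁ n) :
    (midR D ψ ≫ (α_ _ _ _).hom ≫ B ◁ n) ▷ (B ⊗ D) ≫ tensorμ B D B D ≫ (m ⊗ₘ n) =
      (α_ _ _ _).hom ≫ (B ⊗ D) ◁ act φ m ≫ tensorμ B D B D ≫ (m ⊗ₘ n) := by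
  have h₁ := braiding_tensorμ_comp (m := m) (n := n)
  have h₂ := whiskerLeft_tensorμ_comp (n := n) hm
  have hb := braiding_naturality_right D m
  rw [braiding_tensor_right_hom] at hb
  rw [← cancel_epi ((((β_ D B).hom ▷ A) ▷ (B ⊗ D))),
    ← cancel_epi (((D ⊗ B) ⊗ A) ◁ (β_ D B).hom), midR_eq]
  -- after precomposition with two braidings, the hypothesis `h` identifies the two sides
  trans 𝟙 _ ⊗≫ D ◁ (B ◁ φ ≫ (α_ _ _ _).inv ≫ m ▷ D) ▷ B ⊗≫ (β_ D B).hom ▷ (D ⊗ B) ⊗≫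
    B ◁ (n ▷ B ≫ (β_ D B).hom) ⊗≫ m ▷ D
  · rw [h]
    calc
      _ = 𝟙 _ ⊗≫ (((D ⊗ B) ⊗ A) ◁ (β_ D B).hom ≫ ((β_ D B).hom ▷ A ≫ (β_ D B).inv ▷ A ≫
          (α_ _ _ _).hom ≫ D ◁ ψ ≫ (α_ _ _ _).inv ≫ (β_ D B).hom ▷ D ≫ (α_ _ _ _).hom ≫ B ◁ n) ▷
          (B ⊗ D)) ⊗≫ tensorμ B D B D ≫ (m ⊗ₘ n) := by monoidal
      _ = 𝟙 _ ⊗≫ D ◁ ψ ▷ (D ⊗ B) ⊗≫ (β_ D B).hom ▷ (D ⊗ D ⊗ B) ⊗≫ B ◁ n ▷ (D ⊗ B) ⊗≫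
          ((B ⊗ D) ◁ (β_ D B).hom ≫ tensorμ B D B D ≫ (m ⊗ₘ n)) := by
        rw [whisker_exchange, ← comp_whiskerRight_assoc (β_ D B).hom, Iso.hom_inv_id]
        monoidal
      _ = 𝟙 _ ⊗≫ D ◁ ψ ▷ (D ⊗ B) ⊗≫ (β_ D B).hom ▷ (D ⊗ D ⊗ B) ⊗≫ B ◁ (n ▷ D ≫ n) ▷ B ⊗≫
          B ◁ (β_ D B).hom ⊗≫ m ▷ D := by rw [h₁]; monoidal
      _ = 𝟙 _ ⊗≫ D ◁ ψ ▷ (D ⊗ B) ⊗≫ ((β_ D B).hom ▷ ((D ⊗ D) ⊗ B) ≫ (B ⊗ D) ◁ (n ▷ B)) ⊗≫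
          B ◁ (n ▷ B ≫ (β_ D B).hom) ⊗≫ m ▷ D := by rw [hn]; monoidal
      _ = _ := by rw [← whisker_exchange]; monoidal
  · calc
      _ = 𝟙 _ ⊗≫ D ◁ B ◁ φ ▷ B ⊗≫ (D ◁ m ≫ (β_ D B).hom) ▷ (D ⊗ B) ⊗≫
          B ◁ (n ▷ B ≫ (β_ D B).hom) ⊗≫ m ▷ D := by monoidal
      _ = 𝟙 _ ⊗≫ ((D ⊗ B) ◁ (φ ▷ B) ≫ (β_ D B).hom ▷ ((B ⊗ D) ⊗ B)) ⊗≫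
          (𝟙 ((B ⊗ D) ⊗ (B ⊗ D ⊗ B)) ⊗≫ B ◁ (β_ D B).hom ▷ (D ⊗ B) ⊗≫ m ▷ (D ⊗ D ⊗ B) ⊗≫
            B ◁ (n ▷ B ≫ (β_ D B).hom) ⊗≫ m ▷ D) := by rw [hb]; monoidal
      _ = 𝟙 _ ⊗≫ (β_ D B).hom ▷ ((A ⊗ D) ⊗ B) ⊗≫ (B ⊗ D) ◁ ((α_ _ _ _).inv ≫ φ ▷ B ≫
          (α_ _ _ _).hom ≫ B ◁ (β_ D B).hom ≫ (α_ _ _ _).inv ≫ m ▷ D) ≫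
          tensorμ B D B D ≫ (m ⊗ₘ n) := by rw [whisker_exchange, ← h₂]; monoidal
      _ = 𝟙 _ ⊗≫ ((β_ D B).hom ▷ (A ⊗ (D ⊗ B)) ≫ (B ⊗ D) ◁ (A ◁ (β_ D B).hom)) ≫
          (B ⊗ D) ◁ act φ m ≫ tensorμ B D B D ≫ (m ⊗ₘ n) := by rw [← braiding_act]; monoidal
      _ = _ := by rw [← whisker_exchange]; monoidal

/-! ### The morphisms `(φ̂, ψ̂)` -/

namespace M12Cell

section

variable {A₁₂ A₀₂ A₀₁ : SemigroupIn C}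

theorem hatφ_eq_act (t : M12Cell A₁₂ A₀₂ A₀₁) : t.hatφ = act t.φ A₀₁.mul := t.hatφ_eq

/-- By non-degeneracy of `A₀₁`, the multiplication in `φ̂` can be cancelled. -/
theorem φ_eq_of_hatφ_eq (h₀₁ : A₀₁.NonDegenerate) {t t' : M12Cell A₁₂ A₀₂ A₀₁}
    (h : t.hatφ = t'.hatφ) : t.φ = t'.φ := by
  rw [hatφ_eq_act, hatφ_eq_act] at h
  have e (t : M12Cell A₁₂ A₀₂ A₀₁) : (t.φ ≫ (β_ A₁₂.X A₀₁.X).inv) ▷ A₀₁.X ≫ (α_ _ _ _).hom ≫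
      A₁₂.X ◁ A₀₁.mul = (α_ _ _ _).hom ≫ (A₀₂.X ◁ (β_ A₁₂.X A₀₁.X).hom ≫ act t.φ A₀₁.mul) ≫
        (β_ A₁₂.X A₀₁.X).inv := by
    rw [comp_whiskerRight_assoc, braid_mul_right, braiding_act]
    simp
  exact (cancel_mono _).mp (h₀₁.right _ _ ((e t).trans (Eq.trans (by rw [h]) (e t').symm)))

/-- By non-degeneracy of `A₁₂`, the multiplication in `ψ̂` can be cancelled. -/
theorem ψ_eq_of_hatψ_eq (h₁₂ : A₁₂.NonDegenerate) {t t' : M12Cell A₁₂ A₀₂ A₀₁}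
    (h : t.hatψ = t'.hatψ) : t.ψ = t'.ψ := by
  have e (t : M12Cell A₁₂ A₀₂ A₀₁) : A₁₂.X ◁ (t.ψ ≫ (β_ A₁₂.X A₀₁.X).inv) ≫ (α_ _ _ _).inv ≫
      A₁₂.mul ▷ A₀₁.X = (α_ _ _ _).inv ≫ (β_ A₁₂.X A₀₁.X).hom ▷ A₀₂.X ≫ t.hatψ ≫
        (β_ A₁₂.X A₀₁.X).inv := by
    rw [whiskerLeft_comp_assoc, braid_mul_left, hatψ]
    simp [← comp_whiskerRight_assoc]
  exact (cancel_mono _).mp (h₁₂.left _ _ ((e t).trans (Eq.trans (by rw [h]) (e t').symm)))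

end

variable {𝒬 : MorphismProperty C} [h𝒬 : SuitableClass 𝒬]

/-- The morphism `(φ̂, ψ̂) : A₀₂ ⇸ A₀₁ A₁₂` of `NDSemigroup 𝒬`. -/
def hat {A₁₂ A₀₂ A₀₁ : NDSemigroup 𝒬}
    (t : M12Cell A₁₂.toSemigroupIn A₀₂.toSemigroupIn A₀₁.toSemigroupIn)
    (hφ : 𝒬 t.hatφ) (hψ : 𝒬 t.hatψ) : A₀₂ ⟶ A₀₁ ⊗ A₁₂ :=
  show MHom A₀₂ (A₀₁.tensor A₁₂) from
  { fst := t.hatφ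
    snd := t.hatψ
    fst_mem := hφ
    snd_mem := hψ
    mul_fst := by
      rw [hatφ_eq_act]
      exact mul_act t.mul_φ A₀₁.assoc
    snd_mul := by
      rw [hatφ_eq_act, hatψ_eq]
      exact hat_compat A₀₁.assoc A₁₂.assoc t.compat }

theorem s0_hatφ (A : NDSemigroup 𝒬) : (s0 A.toSemigroupIn).hatφ = MHom.fst (λ_ A).inv := by
  change _ = (λ_ A.X).inv ▷ (𝟙_ C ⊗ A.X) ≫ ((NDSemigroup.unit 𝒬).tensor A).mul
  rw [← cancel_mono (λ_ A.X).hom, Category.assoc, NDSemigroup.unit_tensor_mul, hatφ_eq, midL_unit,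
    MonoidalCategory.tensorHom_def]
  dsimp only [s0]
  monoidal

theorem s0_hatψ (A : NDSemigroup 𝒬) : (s0 A.toSemigroupIn).hatψ = MHom.snd (λ_ A).inv := by
  change _ = (𝟙_ C ⊗ A.X) ◁ (λ_ A.X).inv ≫ ((NDSemigroup.unit 𝒬).tensor A).mul
  rw [← cancel_mono (λ_ A.X).hom, Category.assoc, NDSemigroup.unit_tensor_mul, hatψ_eq,
    MonoidalCategory.tensorHom_def]
  dsimp only [s0]
  rw [midR_id]
  monoidal

theorem s1_hatφ (A : NDSemigroup 𝒬) : (s1 A.toSemigroupIn).hatφ = MHom.fst (ρ_ A).inv := by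
  change _ = (ρ_ A.X).inv ▷ (A.X ⊗ 𝟙_ C) ≫ (A.tensor (NDSemigroup.unit 𝒬)).mul
  rw [← cancel_mono (ρ_ A.X).hom, Category.assoc, NDSemigroup.tensor_unit_mul, hatφ_eq,
    MonoidalCategory.tensorHom_def]
  dsimp only [s1]
  rw [midL_id]
  monoidal

theorem s1_hatψ (A : NDSemigroup 𝒬) : (s1 A.toSemigroupIn).hatψ = MHom.snd (ρ_ A).inv := by
  change _ = (A.X ⊗ 𝟙_ C) ◁ (ρ_ A.X).inv ≫ (A.tensor (NDSemigroup.unit 𝒬)).mul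
  rw [← cancel_mono (ρ_ A.X).hom, Category.assoc, NDSemigroup.tensor_unit_mul, hatψ_eq, midR_unit,
    MonoidalCategory.tensorHom_def]
  dsimp only [s1]
  monoidal

/-- The 3-simplex condition of `M₁₂` implies that of the nerve. Both composites are determined by
their first components, which are the action of `A₀₃` on `A₀₁ A₁₂ A₂₃` transported along `φ₀₁₂` and
`φ₀₂₃`; only the first fusion equation is involved. -/
theorem IsTet.comp_hat {A₀₁ A₀₂ A₀₃ A₁₂ A₁₃ A₂₃ : NDSemigroup 𝒬}
    {t₁₂₃ : M12Cell A₂₃.toSemigroupIn A₁₃.toSemigroupIn A₁₂.toSemigroupIn}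
    {t₀₂₃ : M12Cell A₂₃.toSemigroupIn A₀₃.toSemigroupIn A₀₂.toSemigroupIn}
    {t₀₁₃ : M12Cell A₁₃.toSemigroupIn A₀₃.toSemigroupIn A₀₁.toSemigroupIn}
    {t₀₁₂ : M12Cell A₁₂.toSemigroupIn A₀₂.toSemigroupIn A₀₁.toSemigroupIn}
    (h : IsTet t₁₂₃ t₀₂₃ t₀₁₃ t₀₁₂) {w₁₂₃ : A₁₃ ⟶ A₁₂ ⊗ A₂₃} {w₀₂₃ : A₀₃ ⟶ A₀₂ ⊗ A₂₃}
    {w₀₁₃ : A₀₃ ⟶ A₀₁ ⊗ A₁₃} {w₀₁₂ : A₀₂ ⟶ A₀₁ ⊗ A₁₂} (h₁₂₃ : w₁₂₃.fst = t₁₂₃.hatφ)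
    (h₀₂₃ : w₀₂₃.fst = t₀₂₃.hatφ) (h₀₁₃ : w₀₁₃.fst = t₀₁₃.hatφ) (h₀₁₂ : w₀₁₂.fst = t₀₁₂.hatφ) :
    w₀₂₃ ≫ w₀₁₂ ▷ A₂₃ = (w₀₁₃ ≫ A₀₁ ◁ w₁₂₃) ≫ (α_ A₀₁ A₁₂ A₂₃).inv := by
  rw [hatφ_eq_act] at h₁₂₃ h₀₂₃ h₀₁₃ h₀₁₂
  -- the first component of the composite on the left
  have hL : (w₀₂₃ ≫ w₀₁₂ ▷ A₂₃).fst = act t₀₂₃.φ (act t₀₁₂.φ A₀₁.mul) := by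
    have : Epi (A₀₃.X ◁ (w₀₁₂ ▷ A₂₃).fst) := SuitableClass.epi (𝒬 := 𝒬)
      (SuitableClass.whiskerLeft _ (w₀₁₂ ▷ A₂₃).fst_mem)
    rw [← cancel_epi (A₀₃.X ◁ (w₀₁₂ ▷ A₂₃).fst), NDSemigroup.comp_fst, h₀₂₃]
    change _ = A₀₃.X ◁ (tensorμ A₀₂.X A₂₃.X (A₀₁.X ⊗ A₁₂.X) A₂₃.X ≫ (w₀₁₂.fst ⊗ₘ A₂₃.mul)) ≫ _
    rw [h₀₁₂, tensorμ_comp_act t₀₂₃.φ_mul (mul_act t₀₁₂.mul_φ A₀₁.assoc), ← h₀₁₂]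
    rfl
  have hL' : ((w₀₂₃ ≫ w₀₁₂ ▷ A₂₃) ≫ (α_ A₀₁ A₁₂ A₂₃).hom).fst =
      A₀₃.X ◁ (α_ _ _ _).inv ≫ act t₀₂₃.φ (act t₀₁₂.φ A₀₁.mul) ≫ (α_ _ _ _).hom := by
    have e : A₀₃.X ◁ (α_ A₀₁.X A₁₂.X A₂₃.X).hom ≫
        ((w₀₂₃ ≫ w₀₁₂ ▷ A₂₃) ≫ (α_ A₀₁ A₁₂ A₂₃).hom).fst = _ :=
      NDSemigroup.comp_homOfIso_fst (B := (A₀₁.tensor A₁₂).tensor A₂₃)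
        (D := A₀₁.tensor (A₁₂.tensor A₂₃)) (w₀₂₃ ≫ w₀₁₂ ▷ A₂₃) (α_ A₀₁.X A₁₂.X A₂₃.X)
        (NDSemigroup.tensor_assoc_mul A₀₁ A₁₂ A₂₃)
    rw [hL] at e
    rw [← e]
    exact (whiskerLeft_inv_hom_assoc _ (α_ A₀₁.X A₁₂.X A₂₃.X) _).symm
  rw [Iso.eq_comp_inv]
  refine (NDSemigroup.comp_eq ?_).symm
  rw [hL', h₀₁₃]
  change A₀₃.X ◁ (tensorμ A₀₁.X A₁₃.X A₀₁.X (A₁₂.X ⊗ A₂₃.X) ≫ (A₀₁.mul ⊗ₘ w₁₂₃.fst)) ≫ _ =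
    _ ≫ _ ≫ tensorμ A₀₁.X A₁₃.X A₀₁.X (A₁₂.X ⊗ A₂₃.X) ≫ (A₀₁.mul ⊗ₘ w₁₂₃.fst)
  rw [h₁₂₃]
  exact tensorμ_comp_act_act h.fusion₁ A₀₁.assoc t₀₁₂.φ_mul

end M12Cell

open CoskData

/-! ### The simplicial subset `Q` -/

section Subcomplex

variable (𝒬 : MorphismProperty C)

/-- The 1-simplices of `Q`: the non-degenerate semigroups with multiplication in `𝒬`. -/
structure GoodEdge (A : (M12Data C).Edge) : Prop where
  nonDegenerate : SemigroupIn.NonDegenerate A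
  mul_mem : 𝒬 (SemigroupIn.mul A)

/-- The 2-simplices of `Q`: those with faces in `Q` for which `φ̂` and `ψ̂` are in `𝒬`. -/
structure GoodTri (t : (M12Data C).Tri) : Prop where
  d0 : GoodEdge 𝒬 t.d0
  d1 : GoodEdge 𝒬 t.d1
  d2 : GoodEdge 𝒬 t.d2
  hatφ_mem : 𝒬 (M12Cell.hatφ t.cell)
  hatψ_mem : 𝒬 (M12Cell.hatψ t.cell)

variable {𝒬}

/-- A 1-simplex of `Q`, as an object of `NDSemigroup 𝒬`. -/
def GoodEdge.toND {A : (M12Data C).Edge} (h : GoodEdge 𝒬 A) : NDSemigroup 𝒬 where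
  toSemigroupIn := A
  nonDegenerate := h.nonDegenerate
  mul_mem := h.mul_mem

theorem GoodEdge.toND_congr {A B : (M12Data C).Edge} (hA : GoodEdge 𝒬 A) (hB : GoodEdge 𝒬 B)
    (h : A = B) : hA.toND = hB.toND := by
  subst h
  rfl

variable (𝒬) in
/-- The simplicial subset `Q` of `M₁₂`. -/
def goodSubcomplex : (M12 C).Subcomplex where
  obj _ := {x | ∀ i j k hij hjk, GoodTri 𝒬 (Simplex.tri x i j k hij hjk)}
  map _ _ hx _ _ _ _ _ := hx _ _ _ _ _

theorem goodEdge_of_mem {n : ℕ} {x : Simplices (M12 C) n} (hx : x ∈ (goodSubcomplex 𝒬).obj _)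
    (i j : Fin (n + 1)) (h : i ≤ j) : GoodEdge 𝒬 (Simplex.edge x i j h) :=
  (Simplex.tri_d1 x i i j le_rfl h) ▸ (hx i i j le_rfl h).d1

/-- In dimension at least 3, the condition can be checked on faces, since a triangle `i ≤ j ≤ k`
misses some vertex. -/
theorem mem_goodSubcomplex_iff_δ {n : ℕ} (hn : 2 ≤ n) (x : Simplices (M12 C) (n + 1)) :
    x ∈ (goodSubcomplex 𝒬).obj _ ↔
      ∀ i : Fin (n + 2), (M12 C).δ i x ∈ (goodSubcomplex 𝒬).obj _ := by
  refine ⟨fun h i => (goodSubcomplex 𝒬).map _ h, fun h i j k hij hjk => ?_⟩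
  obtain ⟨l, hl⟩ : ∃ l : Fin (n + 2), l ∉ ({i, j, k} : Finset (Fin (n + 2))) := by
    by_contra! hl
    have := (Finset.card_le_card fun l _ => hl l : (Finset.univ : Finset (Fin (n + 2))).card ≤ _)
    have := Finset.card_le_three (a := i) (b := j) (c := k)
    simp only [Finset.card_univ, Fintype.card_fin] at *
    omega
  simp only [Finset.mem_insert, Finset.mem_singleton, not_or] at hl
  obtain ⟨i, rfl⟩ := Fin.exists_succAbove_eq (Ne.symm hl.1)
  obtain ⟨j, rfl⟩ := Fin.exists_succAbove_eq (Ne.symm hl.2.1)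
  obtain ⟨k, rfl⟩ := Fin.exists_succAbove_eq (Ne.symm hl.2.2)
  exact h l i j k (Fin.succAbove_le_succAbove_iff.mp hij) (Fin.succAbove_le_succAbove_iff.mp hjk)

variable [h𝒬 : SuitableClass 𝒬]

theorem goodEdge_one : GoodEdge 𝒬 (M12Data C).one :=
  ⟨(NDSemigroup.unit 𝒬).nonDegenerate, (NDSemigroup.unit 𝒬).mul_mem⟩

theorem goodTri_s0Tri {A : (M12Data C).Edge} (h : GoodEdge 𝒬 A) :
    GoodTri 𝒬 ((M12Data C).s0Tri A) :=
  ⟨h, h, goodEdge_one, (M12Cell.s0_hatφ h.toND).symm ▸ (λ_ h.toND).inv.fst_mem,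
    (M12Cell.s0_hatψ h.toND).symm ▸ (λ_ h.toND).inv.snd_mem⟩

theorem goodTri_s1Tri {A : (M12Data C).Edge} (h : GoodEdge 𝒬 A) :
    GoodTri 𝒬 ((M12Data C).s1Tri A) :=
  ⟨goodEdge_one, h, h, (M12Cell.s1_hatφ h.toND).symm ▸ (ρ_ h.toND).inv.fst_mem,
    (M12Cell.s1_hatψ h.toND).symm ▸ (ρ_ h.toND).inv.snd_mem⟩

/-- Degenerate faces need not be checked. -/
theorem mem_goodSubcomplex_of_lt {n : ℕ} {x : Simplices (M12 C) n}
    (he : ∀ i j (h : i < j), GoodEdge 𝒬 (Simplex.edge x i j h.le))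
    (ht : ∀ i j k (h : i < j) (h' : j < k), GoodTri 𝒬 (Simplex.tri x i j k h.le h'.le)) :
    x ∈ (goodSubcomplex 𝒬).obj _ := by
  have he' : ∀ i j h, GoodEdge 𝒬 (Simplex.edge x i j h) := by
    intro i j h
    rcases h.eq_or_lt with rfl | h'
    · rw [Simplex.edge_refl x]
      exact goodEdge_one
    · exact he i j h'
  intro i j k hij hjk
  rcases hij.eq_or_lt with rfl | hij'
  · rw [Simplex.tri_left x]
    exact goodTri_s0Tri (he' _ _ _)
  rcases hjk.eq_or_lt with rfl | hjk'
  · rw [Simplex.tri_right x]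
    exact goodTri_s1Tri (he' _ _ _)
  exact ht i j k hij' hjk'

theorem mem_goodSubcomplex_zero (x : Simplices (M12 C) 0) : x ∈ (goodSubcomplex 𝒬).obj _ :=
  mem_goodSubcomplex_of_lt (fun i j h => absurd (Subsingleton.elim (α := Fin 1) i j) h.ne)
    (fun i j _ h _ => absurd (Subsingleton.elim (α := Fin 1) i j) h.ne)

theorem mem_goodSubcomplex_one (x : Simplices (M12 C) 1) :
    x ∈ (goodSubcomplex 𝒬).obj _ ↔ GoodEdge 𝒬 (toEdge x) := by
  refine ⟨fun h => goodEdge_of_mem h _ _ _, fun h => mem_goodSubcomplex_of_lt ?_ ?_⟩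
  · intro i j hij
    obtain ⟨rfl, rfl⟩ := eq_of_lt hij
    exact h
  · intro i j k hij hjk
    have hij' := (eq_of_lt hij).2
    have hjk' := (eq_of_lt hjk).1
    exact absurd (hij'.symm.trans hjk') (by decide)

theorem mem_goodSubcomplex_two (x : Simplices (M12 C) 2) :
    x ∈ (goodSubcomplex 𝒬).obj _ ↔ GoodTri 𝒬 (toTri x) := by
  refine ⟨fun h => h _ _ _ _ _, fun h => mem_goodSubcomplex_of_lt ?_ ?_⟩
  · have h0 := h.d0
    have h1 := h.d1
    have h2 := h.d2
    rw [show (toTri x).d0 = _ from Simplex.tri_d0 x _ _ _ _ _] at h0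
    rw [show (toTri x).d1 = _ from Simplex.tri_d1 x _ _ _ _ _] at h1
    rw [show (toTri x).d2 = _ from Simplex.tri_d2 x _ _ _ _ _] at h2
    intro i j hij
    fin_cases i <;> fin_cases j <;> first | (exfalso; revert hij; decide) | assumption
  · intro i j k hij hjk
    obtain ⟨rfl, rfl, rfl⟩ := eq_of_lt_lt hij hjk
    exact h

theorem mem_goodSubcomplex_two_iff_δ (x : Simplices (M12 C) 2) :
    x ∈ (goodSubcomplex 𝒬).obj _ ↔ (∀ i : Fin 3, (M12 C).δ i x ∈ (goodSubcomplex 𝒬).obj _) ∧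
      𝒬 (M12Cell.hatφ (toTri x).cell) ∧ 𝒬 (M12Cell.hatψ (toTri x).cell) := by
  refine ⟨fun h => ⟨fun i => (goodSubcomplex 𝒬).map _ h, ((mem_goodSubcomplex_two x).mp h).hatφ_mem,
    ((mem_goodSubcomplex_two x).mp h).hatψ_mem⟩, fun ⟨h, h₁, h₂⟩ =>
      (mem_goodSubcomplex_two x).mpr ⟨?_, ?_, ?_, h₁, h₂⟩⟩
  · rw [show (toTri x).d0 = _ from Simplex.tri_d0 x _ _ _ _ _]
    exact (mem_goodSubcomplex_one _).mp (h 0)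
  · rw [show (toTri x).d1 = _ from Simplex.tri_d1 x _ _ _ _ _]
    exact (mem_goodSubcomplex_one _).mp (h 1)
  · rw [show (toTri x).d2 = _ from Simplex.tri_d2 x _ _ _ _ _]
    exact (mem_goodSubcomplex_one _).mp (h 2)

/-! ### The map from `Q` to the nerve -/

/-- The image of a 2-simplex of `Q` in the nerve. -/
noncomputable def GoodTri.toNerve {t : (M12Data C).Tri} (h : GoodTri 𝒬 t) :
    (monoidalNerveData (NDSemigroup 𝒬)ᵒᵖ).Tri :=
  nerveTri (M12Cell.hat (A₁₂ := h.d0.toND) (A₀₂ := h.d1.toND) (A₀₁ := h.d2.toND) t.cell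
    h.hatφ_mem h.hatψ_mem)

theorem GoodTri.toNerve_congr {t t' : (M12Data C).Tri} (h : GoodTri 𝒬 t) (h' : GoodTri 𝒬 t')
    (e : t = t') : h.toNerve = h'.toNerve := by
  subst e
  rfl

/-- The map from `Q` to the nerve is injective on 2-simplices. -/
theorem GoodTri.eq_of_toNerve_eq {t t' : (M12Data C).Tri} (h : GoodTri 𝒬 t) (h' : GoodTri 𝒬 t')
    (e : h.toNerve = h'.toNerve) : t = t' := by
  obtain ⟨A, B, D, t⟩ := t
  obtain ⟨A', B', D', t'⟩ := t'
  obtain ⟨e₀, e₁, e₂, e₃⟩ := Tri.mk.inj e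
  obtain rfl : A = A' := congrArg (fun X => X.unop.toSemigroupIn) e₀
  obtain rfl : B = B' := congrArg (fun X => X.unop.toSemigroupIn) e₁
  obtain rfl : D = D' := congrArg (fun X => X.unop.toSemigroupIn) e₂
  have e₄ := Quiver.Hom.op_inj (eq_of_heq e₃)
  have hφ := M12Cell.φ_eq_of_hatφ_eq h.d2.nonDegenerate (congrArg MHom.fst e₄)
  have hψ := M12Cell.ψ_eq_of_hatψ_eq h.d0.nonDegenerate (congrArg MHom.snd e₄)
  exact congrArg (Tri.mk _ _ _) (M12Cell.ext hφ hψ)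

theorem GoodTri.toNerve_s0Tri {A : (M12Data C).Edge} (hA : GoodEdge 𝒬 A)
    (h : GoodTri 𝒬 ((M12Data C).s0Tri A)) :
    h.toNerve = (monoidalNerveData (NDSemigroup 𝒬)ᵒᵖ).s0Tri (op hA.toND) :=
  congrArg (Tri.mk _ _ _) (congrArg Quiver.Hom.op
    (NDSemigroup.hom_ext (M12Cell.s0_hatφ hA.toND)))

theorem GoodTri.toNerve_s1Tri {A : (M12Data C).Edge} (hA : GoodEdge 𝒬 A)
    (h : GoodTri 𝒬 ((M12Data C).s1Tri A)) :
    h.toNerve = (monoidalNerveData (NDSemigroup 𝒬)ᵒᵖ).s1Tri (op hA.toND) :=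
  congrArg (Tri.mk _ _ _) (congrArg Quiver.Hom.op
    (NDSemigroup.hom_ext (M12Cell.s1_hatφ hA.toND)))

theorem GoodTri.isTet_toNerve {t₁₂₃ t₀₂₃ t₀₁₃ t₀₁₂ : (M12Data C).Tri}
    (h : IsTet t₁₂₃ t₀₂₃ t₀₁₃ t₀₁₂) (h₁₂₃ : GoodTri 𝒬 t₁₂₃) (h₀₂₃ : GoodTri 𝒬 t₀₂₃)
    (h₀₁₃ : GoodTri 𝒬 t₀₁₃) (h₀₁₂ : GoodTri 𝒬 t₀₁₂) :
    IsTet h₁₂₃.toNerve h₀₂₃.toNerve h₀₁₃.toNerve h₀₁₂.toNerve := by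
  cases h with
  | mk t₁₂₃ t₀₂₃ t₀₁₃ t₀₁₂ h =>
    refine IsTet.mk _ _ _ _ (Quiver.Hom.unop_inj ?_)
    exact M12Cell.IsTet.comp_hat (A₀₁ := h₀₁₃.d2.toND) (A₀₂ := h₀₂₃.d2.toND)
      (A₀₃ := h₀₁₃.d1.toND) (A₁₂ := h₁₂₃.d2.toND) (A₁₃ := h₁₂₃.d1.toND) (A₂₃ := h₁₂₃.d0.toND)
      (t₁₂₃ := t₁₂₃) (t₀₂₃ := t₀₂₃) (t₀₁₃ := t₀₁₃) (t₀₁₂ := t₀₁₂) h rfl rfl rfl rfl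

variable (𝒬) in
/-- The simplicial map from `Q` to the nerve of `(NDSemigroup 𝒬)ᵒᵖ`. -/
noncomputable def goodToNerve :
    (goodSubcomplex 𝒬 : SSet.{max u v}) ⟶ monoidalNerve (NDSemigroup 𝒬)ᵒᵖ where
  app _ := ↾fun x =>
    show (monoidalNerveData (NDSemigroup 𝒬)ᵒᵖ).Simplex _ from
    { edge := fun i j h => op (goodEdge_of_mem x.2 i j h).toND
      tri := fun i j k h h' => (x.2 i j k h h').toNerve
      tri_d0 := fun i j k h h' =>
        congrArg op (GoodEdge.toND_congr _ _ (Simplex.tri_d0 x.1 i j k h h'))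
      tri_d1 := fun i j k h h' =>
        congrArg op (GoodEdge.toND_congr _ _ (Simplex.tri_d1 x.1 i j k h h'))
      tri_d2 := fun i j k h h' =>
        congrArg op (GoodEdge.toND_congr _ _ (Simplex.tri_d2 x.1 i j k h h'))
      edge_refl := fun i =>
        congrArg op (GoodEdge.toND_congr _ goodEdge_one (Simplex.edge_refl x.1 i))
      tri_left := fun i k h =>
        (GoodTri.toNerve_congr _ (goodTri_s0Tri (goodEdge_of_mem x.2 i k h))
          (Simplex.tri_left x.1 i k h)).trans (GoodTri.toNerve_s0Tri _ _)
      tri_right := fun i k h =>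
        (GoodTri.toNerve_congr _ (goodTri_s1Tri (goodEdge_of_mem x.2 i k h))
          (Simplex.tri_right x.1 i k h)).trans (GoodTri.toNerve_s1Tri _ _)
      tet := fun i j k l hij hjk hkl =>
        GoodTri.isTet_toNerve (Simplex.tet x.1 i j k l hij hjk hkl) _ _ _ _ }
  naturality _ _ _ := rfl

theorem goodToNerve_injective (n : SimplexCategoryᵒᵖ) :
    Function.Injective ((goodToNerve 𝒬).app n) := by
  intro x y h
  refine Subtype.ext (simplex_ext (x := x.1) (y := y.1) (fun i j hij => ?_)
    fun i j k hij hjk => ?_)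
  · exact congrArg (fun z : (monoidalNerveData (NDSemigroup 𝒬)ᵒᵖ).Simplex _ =>
      (Simplex.edge z i j hij).unop.toSemigroupIn) h
  · exact GoodTri.eq_of_toNerve_eq (x.2 i j k hij hjk) (y.2 i j k hij hjk)
      (congrArg (fun z : (monoidalNerveData (NDSemigroup 𝒬)ᵒᵖ).Simplex _ =>
        Simplex.tri z i j k hij hjk) h)

theorem isHat_goodToNerve (x : Simplices (goodSubcomplex 𝒬 : SSet.{max u v}) 2) :
    IsHat (toTri (D := M12Data C) x.1) (toTri ((goodToNerve 𝒬).app _ x)) :=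
  ⟨_, _, _, _, _, rfl, rfl, rfl, rfl⟩

end Subcomplex
end Braided

section

variable {C : Type u} [Category.{v} C] [MonoidalCategory C] {𝒬 : MorphismProperty C}
  [h𝒬 : SuitableClass 𝒬]

theorem SuitableClass.mem_iff_of_isIso {X Y Z W : C} (i : W ⟶ X) (f : X ⟶ Y) (j : Y ⟶ Z) [IsIso i]
    [IsIso j] : 𝒬 (i ≫ f ≫ j) ↔ 𝒬 f := by
  refine ⟨fun h => ?_, fun h => h𝒬.comp _ _ (h𝒬.of_isIso i inferInstance)
    (h𝒬.comp _ _ h (h𝒬.of_isIso j inferInstance))⟩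
  have h' := h𝒬.comp _ _ (h𝒬.cancel _ _ (h𝒬.of_isIso i inferInstance) h)
    (h𝒬.of_isIso (inv j) inferInstance)
  simpa using h'

end

section Braided

variable {C : Type u} [Category.{v} C] [MonoidalCategory C] [BraidedCategory C]
  {𝒬 : MorphismProperty C} [h𝒬 : SuitableClass 𝒬]

open CoskData

/-! ### Maps from the Catalan simplicial set to `Q` -/

namespace MultiplierBimonoid

section

variable (B : MultiplierBimonoid C)

theorem cellτ_hatφ : B.cellτ.hatφ = B.d₁ := B.cellτ.hatφ_eq

theorem cellτ_hatψ : B.cellτ.hatψ = B.d₂ := B.cellτ.hatψ_eq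

theorem cellε_hatφ : B.cellε.hatφ =
    (B.X ◁ (λ_ (𝟙_ C)).hom ≫ (ρ_ B.X).hom) ≫ B.e ≫ (λ_ (𝟙_ C)).inv := by
  rw [M12Cell.hatφ_eq, midL_unit]
  dsimp only [cellε]
  monoidal

theorem cellε_hatψ : B.cellε.hatψ =
    ((λ_ (𝟙_ C)).hom ▷ B.X ≫ (λ_ B.X).hom) ≫ B.e ≫ (λ_ (𝟙_ C)).inv := by
  rw [M12Cell.hatψ_eq, midR_unit]
  dsimp only [cellε]
  monoidal

end

/-- The morphism `e` is in `𝒬` if and only if `φ̂` (equivalently `ψ̂`) is, for the 2-simplex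
`(e | e)`, because these differ by unit isomorphisms. -/
theorem inClass_iff_good (B : MultiplierBimonoid C) : B.InClass 𝒬 ↔ GoodEdge 𝒬 B.semigroup ∧
    GoodTri 𝒬 ⟨_, _, _, B.cellτ⟩ ∧ GoodTri 𝒬 ⟨_, _, _, B.cellε⟩ := by
  have h : 𝒬 B.cellε.hatφ ↔ 𝒬 B.e := by
    rw [cellε_hatφ]
    exact SuitableClass.mem_iff_of_isIso _ _ _
  have h' : 𝒬 B.cellε.hatψ ↔ 𝒬 B.e := by
    rw [cellε_hatψ]
    exact SuitableClass.mem_iff_of_isIso _ _ _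
  constructor
  · intro hB
    have hA : GoodEdge 𝒬 B.semigroup := ⟨hB.nonDegenerate, hB.mul_mem⟩
    exact ⟨hA, ⟨hA, hA, hA, B.cellτ_hatφ ▸ hB.d₁_mem, B.cellτ_hatψ ▸ hB.d₂_mem⟩,
      ⟨goodEdge_one, hA, goodEdge_one, h.mpr hB.e_mem, h'.mpr hB.e_mem⟩⟩
  · rintro ⟨hA, hτ, hε⟩
    exact ⟨hA.nonDegenerate, hA.mul_mem, h.mp hε.hatφ_mem, B.cellτ_hatφ ▸ hτ.hatφ_mem,
      B.cellτ_hatψ ▸ hτ.hatψ_mem⟩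

end MultiplierBimonoid

namespace CatalanMap

/-- A map from the Catalan simplicial set lands in `Q` as soon as its generators do. -/
theorem toMap_mem_iff (x : CatalanMap (M12Data C)) :
    (∀ n y, x.toMap.app n y ∈ (goodSubcomplex 𝒬).obj n) ↔
      GoodEdge 𝒬 x.a ∧ GoodTri 𝒬 ⟨_, _, _, x.τ⟩ ∧ GoodTri 𝒬 ⟨_, _, _, x.ε⟩ := by
  constructor
  · intro h
    have hτ : GoodTri 𝒬 ⟨_, _, _, x.τ⟩ := (mem_goodSubcomplex_two _).mp (h _ catalanτ)
    exact ⟨hτ.d0, hτ, (mem_goodSubcomplex_two _).mp (h _ catalanε)⟩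
  · rintro ⟨ha, hτ, hε⟩ n y i j k hij hjk
    change GoodTri 𝒬 (x.mapTri (Simplex.tri y i j k hij hjk))
    obtain ⟨p, q, r, t⟩ := Simplex.tri y i j k hij hjk
    cases t
    · exact goodTri_s0Tri goodEdge_one
    · exact goodTri_s0Tri ha
    · exact goodTri_s1Tri ha
    · exact hτ
    · exact hε

end CatalanMap

/-- Maps to a simplicial subset are the maps with values in it. -/
def subcomplexLiftEquiv {X Y : SSet.{v}} (A : Y.Subcomplex) :
    (X ⟶ (A : SSet.{v})) ≃ { f : X ⟶ Y // ∀ n x, f.app n x ∈ A.obj n } where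
  toFun f := ⟨f ≫ A.ι, fun n x => (f.app n x).2⟩
  invFun f := SSet.Subcomplex.lift f.1 (by
    rintro n _ ⟨x, rfl⟩
    exact f.2 n x)
  left_inv _ := rfl
  right_inv _ := rfl

theorem apply_mem_iff_inClass (f : catalanSSet.{max u v} ⟶ M12 C) :
    (∀ n y, f.app n y ∈ (goodSubcomplex 𝒬).obj n) ↔
      (CatalanMap.multiplierBimonoidEquiv.symm f).InClass 𝒬 := by
  obtain ⟨B, rfl⟩ := CatalanMap.multiplierBimonoidEquiv.surjective f
  rw [Equiv.symm_apply_apply]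
  exact (CatalanMap.toMap_mem_iff _).trans B.inClass_iff_good.symm

variable (𝒬) in
/-- Maps from the Catalan simplicial set to `Q` are the multiplier bimonoids with the properties
`MultiplierBimonoid.InClass`. -/
noncomputable def catalanGoodEquiv :
    (catalanSSet.{max u v} ⟶ (goodSubcomplex 𝒬 : SSet.{max u v})) ≃
      { B : MultiplierBimonoid C // B.InClass 𝒬 } :=
  (subcomplexLiftEquiv _).trans
    (CatalanMap.multiplierBimonoidEquiv.symm.subtypeEquiv apply_mem_iff_inClass)

/-! ### The comonoid of a multiplier bimonoid -/

theorem isClassifiedByComon_comonEquiv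
    (f : catalanSSet.{max u v} ⟶ monoidalNerve (NDSemigroup 𝒬)ᵒᵖ) :
    IsClassifiedByComon f (comonEquiv (NDSemigroup 𝒬) f) := by
  obtain ⟨K, rfl⟩ := (comonEquiv (NDSemigroup 𝒬)).symm.surjective f
  rw [Equiv.apply_symm_apply]
  exact ⟨CatalanMap.toMap_α _, CatalanMap.toMap_τ _, CatalanMap.toMap_ε _⟩

theorem goodTri_onTri (q : catalanSSet.{max u v} ⟶ (goodSubcomplex 𝒬 : SSet.{max u v}))
    (t : catalanData.{max u v}.Tri) : GoodTri 𝒬 (onTri (q ≫ (goodSubcomplex 𝒬).ι) t) :=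
  (mem_goodSubcomplex_two _).mp (q.app _ (ofTri t)).2

theorem onTri_comp_goodToNerve
    (q : catalanSSet.{max u v} ⟶ (goodSubcomplex 𝒬 : SSet.{max u v}))
    (t : catalanData.{max u v}.Tri) :
    onTri (q ≫ goodToNerve 𝒬) t = (goodTri_onTri q t).toNerve := rfl

/-- The comonoid classified by the image of a map `q` to `Q` is read off from the images of `τ` and
`ε`, whose components are `φ̂` and `ψ̂`. -/
theorem corresponds_of_comp_eq
    {q : catalanSSet.{max u v} ⟶ (goodSubcomplex 𝒬 : SSet.{max u v})} {B : MultiplierBimonoid C}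
    (h : B.InClass 𝒬)
    (hq : q ≫ (goodSubcomplex 𝒬).ι = (CatalanMap.ofMultiplierBimonoid B).toMap)
    {K : Comon (NDSemigroup 𝒬)} (hK : q ≫ goodToNerve 𝒬 = (CatalanMap.ofComon K).toMap) :
    Corresponds B K := by
  obtain ⟨hA, hτ, hε⟩ := B.inClass_iff_good.mp h
  have eτ : nerveTri (ComonObj.comul (X := K.X)) = hτ.toNerve := by
    have e := onTri_comp_goodToNerve q ⟨_, _, _, CatalanCell.tau⟩
    rw [hK] at e
    exact e.trans (GoodTri.toNerve_congr _ hτ (by rw [hq]; rfl))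
  have eε : nerveTri (ComonObj.counit (X := K.X) ≫ (λ_ (𝟙_ (NDSemigroup 𝒬))).inv) =
      hε.toNerve := by
    have e := onTri_comp_goodToNerve q ⟨_, _, _, CatalanCell.eps⟩
    rw [hK] at e
    exact e.trans (GoodTri.toNerve_congr _ hε (by rw [hq]; rfl))
  obtain @⟨X, s⟩ := K
  obtain rfl : X = B.ndSemigroup h := op_injective (Tri.mk.inj eτ).1
  have eτ' := Quiver.Hom.op_inj (eq_of_heq (Tri.mk.inj eτ).2.2.2)
  have eε' := Quiver.Hom.op_inj (eq_of_heq (Tri.mk.inj eε).2.2.2)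
  -- the image of `ε` is the counit followed by a unit isomorphism, which has to be removed
  have e₁ : MHom.fst s.counit = (ρ_ B.X).hom ≫ B.e := by
    have e := NDSemigroup.comp_homOfIso_fst
      (B := (NDSemigroup.unit 𝒬).tensor (NDSemigroup.unit 𝒬)) (D := NDSemigroup.unit 𝒬)
      (s.counit ≫ (λ_ (𝟙_ (NDSemigroup 𝒬))).inv) (λ_ (𝟙_ C))
      (NDSemigroup.unit_tensor_mul (NDSemigroup.unit 𝒬))
    have e' : B.X ◁ (λ_ (𝟙_ C)).hom ≫ MHom.fst ((s.counit ≫ (λ_ (𝟙_ (NDSemigroup 𝒬))).inv) ≫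
        (λ_ (𝟙_ (NDSemigroup 𝒬))).hom) = B.cellε.hatφ ≫ (λ_ (𝟙_ C)).hom :=
      e.trans (congrArg (fun w : MHom _ _ => w.fst ≫ (λ_ (𝟙_ C)).hom) eε')
    rw [Category.assoc, Iso.inv_hom_id, Category.comp_id, B.cellε_hatφ] at e'
    have k : ((B.X ◁ (λ_ (𝟙_ C)).hom ≫ (ρ_ B.X).hom) ≫ B.e ≫ (λ_ (𝟙_ C)).inv) ≫ (λ_ (𝟙_ C)).hom =
        B.X ◁ (λ_ (𝟙_ C)).hom ≫ (ρ_ B.X).hom ≫ B.e := by simp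
    exact (cancel_epi (B.X ◁ (λ_ (𝟙_ C)).hom)).mp (e'.trans k)
  refine ⟨h, s, rfl, (congrArg MHom.fst eτ').trans B.cellτ_hatφ,
    (congrArg MHom.snd eτ').trans B.cellτ_hatψ, e₁, ?_⟩
  -- the second component is determined by the first one
  apply SemigroupIn.unit_nonDegenerate.hom_ext'
  have e₂ : MHom.snd s.counit ▷ 𝟙_ C ≫ (λ_ (𝟙_ C)).hom = (α_ (𝟙_ C) B.X (𝟙_ C)).hom ≫
    𝟙_ C ◁ MHom.fst s.counit ≫ (λ_ (𝟙_ C)).hom := MHom.snd_mul s.counit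
  rw [e₁] at e₂
  refine e₂.trans ?_
  dsimp only
  monoidal

theorem Corresponds.unique {B : MultiplierBimonoid C} {K K' : Comon (NDSemigroup 𝒬)}
    (h : Corresponds B K) (h' : Corresponds B K') : K = K' := by
  obtain ⟨_, s, rfl, hc, -, he, -⟩ := h
  obtain ⟨_, s', rfl, hc', -, he', -⟩ := h'
  obtain rfl : s = s' := by
    obtain ⟨e, d, _, _, _⟩ := s
    obtain ⟨e', d', _, _, _⟩ := s'
    obtain rfl : e = e' := NDSemigroup.hom_ext (he.trans he'.symm)
    obtain rfl : d = d' := NDSemigroup.hom_ext (hc.trans hc'.symm)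
    rfl
  rfl

theorem corresponds_catalanGoodEquiv
    (q : catalanSSet.{max u v} ⟶ (goodSubcomplex 𝒬 : SSet.{max u v})) :
    Corresponds (catalanGoodEquiv 𝒬 q).1 (comonEquiv (NDSemigroup 𝒬) (q ≫ goodToNerve 𝒬)) :=
  corresponds_of_comp_eq (catalanGoodEquiv 𝒬 q).2
    (CatalanMap.multiplierBimonoidEquiv.apply_symm_apply _).symm
    ((comonEquiv (NDSemigroup 𝒬)).symm_apply_apply _).symm

theorem corresponds_iff (a : catalanSSet.{max u v} ⟶ M12 C)
    (k : catalanSSet.{max u v} ⟶ monoidalNerve (NDSemigroup 𝒬)ᵒᵖ) :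
    Corresponds (CatalanMap.multiplierBimonoidEquiv.symm a) (comonEquiv (NDSemigroup 𝒬) k) ↔
      ∃ q : catalanSSet.{max u v} ⟶ (goodSubcomplex 𝒬 : SSet.{max u v}),
        q ≫ (goodSubcomplex 𝒬).ι = a ∧ q ≫ goodToNerve 𝒬 = k := by
  constructor
  · intro h
    obtain ⟨hB, -⟩ := id h
    obtain ⟨q, hq⟩ := (catalanGoodEquiv 𝒬).surjective ⟨_, hB⟩
    have hq' := corresponds_catalanGoodEquiv q
    rw [hq] at hq'
    exact ⟨q, CatalanMap.multiplierBimonoidEquiv.symm.injective (congrArg Subtype.val hq),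
      (comonEquiv (NDSemigroup 𝒬)).injective (hq'.unique h)⟩
  · rintro ⟨q, rfl, rfl⟩
    exact corresponds_catalanGoodEquiv q

theorem exists_corresponds {B : MultiplierBimonoid C} (h : B.InClass 𝒬) :
    ∃ K : Comon (NDSemigroup 𝒬), Corresponds B K := by
  obtain ⟨q, hq⟩ := (catalanGoodEquiv 𝒬).surjective ⟨B, h⟩
  have := corresponds_catalanGoodEquiv q
  rw [hq] at this
  exact ⟨_, this⟩

/-- The multiplier bimonoid is determined by the comonoid, because the map from `Q` to the nerve
is injective. -/
theorem Corresponds.eq {B B' : MultiplierBimonoid C} {K : Comon (NDSemigroup 𝒬)}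
    (h : Corresponds B K) (h' : Corresponds B' K) : B = B' := by
  obtain ⟨a, rfl⟩ := CatalanMap.multiplierBimonoidEquiv.symm.surjective B
  obtain ⟨a', rfl⟩ := CatalanMap.multiplierBimonoidEquiv.symm.surjective B'
  obtain ⟨k, rfl⟩ := (comonEquiv (NDSemigroup 𝒬)).surjective K
  obtain ⟨q, rfl, hq⟩ := (corresponds_iff a k).mp h
  obtain ⟨q', rfl, hq'⟩ := (corresponds_iff a' k).mp h'
  obtain rfl : q = q' := by
    ext n x
    refine goodToNerve_injective n ?_
    exact congrArg (fun f : catalanSSet ⟶ monoidalNerve (NDSemigroup 𝒬)ᵒᵖ => f.app n x)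
      (hq.trans hq'.symm)
  rfl

theorem isClassifiedBy_multiplierBimonoidEquiv (f : catalanSSet.{max u v} ⟶ M12 C) :
    IsClassifiedBy f (CatalanMap.multiplierBimonoidEquiv.symm f) := by
  obtain ⟨B, rfl⟩ := CatalanMap.multiplierBimonoidEquiv.surjective f
  rw [Equiv.symm_apply_apply]
  exact CatalanMap.isClassifiedBy_toMap B

end Braided
end MultBimon

theorem mainTheorem4 {C : Type u} [Category.{v} C] [MonoidalCategory C] [BraidedCategory C]
    (𝒬 : MorphismProperty C) [SuitableClass 𝒬] :
    ∃ (Q : (M12 C).Subcomplex)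
      (F : (Q : SSet.{max u v}) ⟶ monoidalNerve (NDSemigroup 𝒬)ᵒᵖ)
      (Φ : (catalanSSet.{max u v} ⟶ M12 C) ≃ MultiplierBimonoid C)
      (ΦQ : (catalanSSet.{max u v} ⟶ (Q : SSet.{max u v})) ≃
        { B : MultiplierBimonoid C // B.InClass 𝒬 })
      (Ψ : (catalanSSet.{max u v} ⟶ monoidalNerve (NDSemigroup 𝒬)ᵒᵖ) ≃ Comon (NDSemigroup 𝒬)),
      -- the simplices of `Q`
      (∀ x : Simplices (M12 C) 0, x ∈ Q.obj _) ∧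
      (∀ x : Simplices (M12 C) 1, x ∈ Q.obj _ ↔
        SemigroupIn.NonDegenerate (CoskData.toEdge x) ∧
          𝒬 (SemigroupIn.mul (CoskData.toEdge x))) ∧
      (∀ x : Simplices (M12 C) 2, x ∈ Q.obj _ ↔
        (∀ i : Fin 3, (M12 C).δ i x ∈ Q.obj _) ∧
          𝒬 (M12Cell.hatφ (CoskData.toTri x).cell) ∧ 𝒬 (M12Cell.hatψ (CoskData.toTri x).cell)) ∧
      (∀ n : ℕ, 2 ≤ n → ∀ x : Simplices (M12 C) (n + 1), x ∈ Q.obj _ ↔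
        ∀ i : Fin (n + 2), (M12 C).δ i x ∈ Q.obj _) ∧
      -- the maps from the Catalan simplicial set
      (∀ f, IsClassifiedBy f (Φ f)) ∧
      (∀ f, (ΦQ f).1 = Φ (f ≫ Q.ι)) ∧
      (∀ f, IsClassifiedByComon f (Ψ f)) ∧
      -- the injective simplicial map to the nerve
      (∀ n, Function.Injective (F.app n)) ∧
      (∀ x : Simplices (Q : SSet.{max u v}) 1,
        (CoskData.toEdge (F.app _ x)).unop.toSemigroupIn =
          CoskData.toEdge (D := M12Data C) x.1) ∧
      (∀ x : Simplices (Q : SSet.{max u v}) 2,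
        IsHat (CoskData.toTri (D := M12Data C) x.1) (CoskData.toTri (F.app _ x))) ∧
      -- the correspondence between multiplier bimonoids and comonoids
      (∀ f, Corresponds (ΦQ f).1 (Ψ (f ≫ F))) ∧
      (∀ a c, Corresponds (Φ a) (Ψ c) ↔
        ∃ q : catalanSSet.{max u v} ⟶ (Q : SSet.{max u v}), q ≫ Q.ι = a ∧ q ≫ F = c) ∧
      (∀ B : MultiplierBimonoid C, B.InClass 𝒬 →
        ∃! K : Comon (NDSemigroup 𝒬), Corresponds B K) ∧
      (∀ (B B' : MultiplierBimonoid C) (K : Comon (NDSemigroup 𝒬)),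
        Corresponds B K → Corresponds B' K → B = B') := by
  refine ⟨goodSubcomplex 𝒬, goodToNerve 𝒬, CatalanMap.multiplierBimonoidEquiv.symm,
    catalanGoodEquiv 𝒬, comonEquiv (NDSemigroup 𝒬), mem_goodSubcomplex_zero, fun x => ?_,
    mem_goodSubcomplex_two_iff_δ, fun n hn => mem_goodSubcomplex_iff_δ hn,
    isClassifiedBy_multiplierBimonoidEquiv, fun _ => rfl, isClassifiedByComon_comonEquiv,
    goodToNerve_injective, fun _ => rfl, isHat_goodToNerve, corresponds_catalanGoodEquiv,
    corresponds_iff, fun B h => ?_, fun _ _ _ => Corresponds.eq⟩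
  · exact (mem_goodSubcomplex_one x).trans ⟨fun h => ⟨h.1, h.2⟩, fun h => ⟨h.1, h.2⟩⟩
  · obtain ⟨K, hK⟩ := exists_corresponds h
    exact ⟨K, hK, fun _ h' => h'.unique hK⟩
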